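/- Proposition. The generalized Lindelöf hypothesis (GLH) is the assertion that for every $\varepsilon>0$ there is a constant $C_\varepsilon$ such that $$|L(\sigma+it,\chi)|\le C_\varepsilon\,(q(1+|t|))^{\varepsilon}$$ for every integer $q\ge 1$, every Dirichlet character $\chi$ modulo $q$, and every $s=\sigma+it$ with $\sigma\ge 1/2$ and $|s-1|\ge 1/2$. For an integer $q\ge 3$ and a real number $\lambda$, let $N(\lambda)$ be the number of distinct Dirichlet characters $\chi$ modulo $q$ for which $L(s,\chi)$ has at least one zero in the region $$\sigma\ge 1-\frac{\lambda}{\log q},\qquad |t|\le 1 .$$ Label these characters $\chi^{(1)},\dots,\chi^{(N)}$, where $N=N(\lambda)$, and for each $k$ choose any zero $\rho^{(k)}=1-\lambda^{(k)}/\log q+i\gamma^{(k)}$ of $L(s,\chi^{(k)})$ in this region. Assume GLH. Then: (i) For all $\delta,a,b>0$ there is $q_3=q_3(\delta,a,b)$ such that for all $q\ge q_3$, all $\lambda\le\log\log q$, and every choice of the zeros $\rho^{(k)}$, $$\sum_{k=1}^{N(\lambda)}\frac{\lambda^{(k)}}{e^{(3a+2b)\lambda^{(k)}}-e^{2a\lambda^{(k)}}}\le\frac{a+b}{2ab}+\delta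 .$$ (ii) In particular, there is $q_0$ such that for all $q\ge q_0$, all $\lambda\le\log\log q$, and every choice of the zeros $\rho^{(k)}$, $$\sum_{k=1}^{N(\lambda)}e^{-0.1\lambda^{(k)}}\le 3 .$$ -/

import Mathlib

/-- The generalized Lindelöf hypothesis for Dirichlet `L`-functions: for every `ε > 0`,
`L(σ + it, χ) ≪_ε (q (1 + |t|)) ^ ε` for all moduli `q ≥ 1`, all characters `χ` modulo `q`
(primitive or not, principal or not), and all `s = σ + it` with `σ ≥ 1/2`, `|s - 1| ≥ 1/2`;
the implied constant depends only on `ε`. -/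
def GLH : Prop :=
  ∀ ε : ℝ, 0 < ε → ∃ C : ℝ, 0 < C ∧
    ∀ (q : ℕ) [NeZero q] (χ : DirichletCharacter ℂ q) (s : ℂ),
      1 / 2 ≤ s.re → 1 / 2 ≤ ‖s - 1‖ →
        ‖χ.LFunction s‖ ≤ C * ((q : ℝ) * (1 + |s.im|)) ^ ε

/-- `ρ` is a zero of `L(s, χ)`. The point `s = 1` is excluded for the principal character, where
`L(s, χ)` has a pole (and where `LFunction` takes an arbitrary value). -/
def IsLZero {q : ℕ} [NeZero q] (χ : DirichletCharacter ℂ q) (ρ : ℂ) : Prop :=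
  (χ ≠ 1 ∨ ρ ≠ 1) ∧ χ.LFunction ρ = 0

/-- `ρ` is a zero of `L(s, χ)`, for `χ` modulo `q`, in the region
`σ ≥ 1 - lam / log q`, `|t| ≤ 1`. -/
def IsLZeroNearOne {q : ℕ} [NeZero q] (lam : ℝ) (χ : DirichletCharacter ℂ q) (ρ : ℂ) : Prop :=
  IsLZero χ ρ ∧ 1 - lam / Real.log q ≤ ρ.re ∧ |ρ.im| ≤ 1

open Classical in
/-- The set `{χ⁽¹⁾, …, χ⁽ᴺ⁾}`, `N = N(lam)`, of the distinct characters `χ` modulo `q` for which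
`L(s, χ)` has at least one zero in the region `σ ≥ 1 - lam / log q`, `|t| ≤ 1`. -/
noncomputable def charsWithZero (q : ℕ) [NeZero q] (lam : ℝ) :
    Finset (DirichletCharacter ℂ q) :=
  Finset.univ.filter fun χ => ∃ ρ : ℂ, IsLZeroNearOne lam χ ρ

/-- The normalised distance `Λ` of `ρ` from the line `σ = 1`, so that
`ρ = 1 - Λ / log q + iγ`. -/
noncomputable def zeroDepth (q : ℕ) (ρ : ℂ) : ℝ := (1 - ρ.re) * Real.log q

/-!
Write `L = log q`, `U = q ^ a`, `X = q ^ x` with `x = a + b + a / 2`, and let `ρ k = β k + i γ k` be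
the chosen zero of `L(s, χ k)`, at depth `λ k = (1 - β k) L`. The inequality is a large-sieve
inequality in dual form, applied to mollified character sums of length `X` at the zeros.

Two systems of weights enter. The Barban–Vehov weights `ψ(n) = ∑_{d ∣ n} μ(d) P(log d / L)`
(`barbanVehov`), with `P = 1` on `[0, a]` and `P = 0` beyond `a + b`, satisfy `ψ(1) = 1` and
`ψ(n) = 0` for `1 < n ≤ U`. Selberg's weights give `θ(n) = ∑_{d ∣ n} w(d)`, of level `R = q ^ r` with
`r` slightly less than `a / 2`, supported on integers coprime to `q` (`exists_selberg_weights`). The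
sums are cut off by `J(n) = max (1 - n / X) 0 - max (1 - n / U) 0` (`trapezoid`).

Under GLH, moving a line of integration to `Re s = 1 / 2` shows that
`∑_{m ≤ Y} χ(m) m⁻ˢ (1 - m / Y)` is `L(s, χ)` up to `O(q ^ ε Y ^ (1 / 2 - Re s))`
(`GLH.norm_smoothSum_sub_le`). It has two consequences.

* At a zero, the part of `S k = ∑ ψ(n) θ(n) χ k(n) n ^ (-ρ k) J(n)` of length `X` is negligible, while
  the part of length `U` is its term `n = 1`. So `S k = -1 + o(1)`
  (`GLH.eventually_norm_mollifiedSum_add_one_le`).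
* For `j ≠ k` the character `χ j * (χ k)⁻¹` is nonprincipal, and
  `∑ θ(n)² χ j(n) conj (χ k(n)) n ^ (1 - ρ j - conj (ρ k)) J(n)` is negligible, because the main terms
  of lengths `X` and `U` cancel (`GLH.eventually_norm_offDiagonal_le`).

The corresponding diagonal sum is at most `(1 + o(1)) (e ^ ((3a + 2b) λ k) - e ^ (2a λ k)) / (2 r λ k)`,
by the optimality of Selberg's weights (`eventually_diagonal_le`). Cauchy's inequality
(`sq_sum_le_of_nearly_orthogonal`), with the weight
`c k = λ k / (e ^ ((3a + 2b) λ k) - e ^ (2a λ k))` attached to `χ k`, then yields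
`(∑ c k)² ≤ (1 + o(1)) A (∑ c k) / (2 r) + o((∑ c k)²)`, where `A = ∑ ψ(n)² J(n) / n`.

It remains to see that `A ≤ (a + b) / (2 b) + o(1)` for a suitable `P`
(`exists_cutoff_sum_barbanVehov_sq_le`); since `r` is close to `a / 2` this gives
`∑ c k ≤ (a + b) / (2 a b) + δ`. The asymptotic formula for sums of `ψ(n)² / n` over smooth ranges of
`log n` (`tendsto_tsum_barbanVehov_sq`) is obtained by Fourier inversion of `P` and of the cutoff:
this turns the sum into an integral of the Dirichlet series with coefficients
`(∑_{d ∣ n} μ(d) d ^ (-iz / L)) (∑_{d ∣ n} μ(d) d ^ (-iz' / L))` near `s = 1`, which is a quotient of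
zeta values times an Euler product that tends to `1`, so only the pole of `ζ` matters in the limit.
By the formula, `A` is governed by `∫ (x - t) P'(t)² dt`, and `P` is chosen as a smoothed version of
the function which is linear on `[a, a + b]`.
-/

open Finset

/-! ### Selberg's sieve weights and the divisor bound -/

lemma card_squarefree_divisors_le (n : ℕ) :
    #{d ∈ n.divisors | Squarefree d} ≤ 2 ^ #n.primeFactors := by
  rw [← Finset.card_powerset]
  refine Finset.card_le_card_of_injOn Nat.primeFactors ?_ ?_
  · intro d hd
    obtain ⟨hd, -⟩ := Finset.mem_filter.mp hd
    exact Finset.mem_coe.mpr (Finset.mem_powerset.mpr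
      (Nat.primeFactors_mono (Nat.dvd_of_mem_divisors hd) (Nat.ne_zero_of_mem_divisors hd)))
  · intro d hd e he h
    have hd := (Finset.mem_filter.mp (Finset.mem_coe.mp hd)).2
    have he := (Finset.mem_filter.mp (Finset.mem_coe.mp he)).2
    rw [← Nat.prod_primeFactors_of_squarefree hd, ← Nat.prod_primeFactors_of_squarefree he, h]

/-- The primes `p ≥ 2 ^ (1 / ε)` contribute at most `p ^ ε` each to `2 ^ ω(n)`, the others a
bounded amount. -/
lemma exists_two_pow_card_primeFactors_le {ε : ℝ} (hε : 0 < ε) :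
    ∃ C : ℝ, 0 < C ∧ ∀ n : ℕ, n ≠ 0 → (2 : ℝ) ^ #n.primeFactors ≤ C * (n : ℝ) ^ ε := by
  obtain ⟨K, hK⟩ := exists_nat_ge ((2 : ℝ) ^ (1 / ε))
  have hKp : ∀ p : ℕ, K ≤ p → (2 : ℝ) ≤ (p : ℝ) ^ ε := by
    intro p hp
    have h1 : (2 : ℝ) ^ (1 / ε) ≤ p := hK.trans (by exact_mod_cast hp)
    calc (2 : ℝ) = ((2 : ℝ) ^ (1 / ε)) ^ ε := by
          rw [← Real.rpow_mul (by norm_num), one_div_mul_cancel hε.ne', Real.rpow_one]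
      _ ≤ _ := Real.rpow_le_rpow (by positivity) h1 hε.le
  refine ⟨2 ^ K, by positivity, fun n hn => ?_⟩
  have hn1 : ((∏ p ∈ n.primeFactors, p : ℕ) : ℝ) ≤ n := by
    exact_mod_cast Nat.le_of_dvd (Nat.pos_of_ne_zero hn) (Nat.prod_primeFactors_dvd n)
  have h1 : ∀ p ∈ n.primeFactors, (2 : ℝ) ≤ (if p < K then 2 else 1) * (p : ℝ) ^ ε := by
    intro p hp
    have hp1 : (1 : ℝ) ≤ p := by exact_mod_cast (Nat.prime_of_mem_primeFactors hp).one_lt.le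
    split_ifs with h
    · linarith [Real.one_le_rpow hp1 hε.le]
    · simpa using hKp p (not_lt.mp h)
  calc (2 : ℝ) ^ #n.primeFactors = ∏ p ∈ n.primeFactors, (2 : ℝ) := by simp
    _ ≤ ∏ p ∈ n.primeFactors, (if p < K then 2 else 1) * (p : ℝ) ^ ε :=
        Finset.prod_le_prod (fun _ _ => by norm_num) h1
    _ = (∏ p ∈ n.primeFactors, (if p < K then (2 : ℝ) else 1)) *
          ((∏ p ∈ n.primeFactors, p : ℕ) : ℝ) ^ ε := by
        rw [Finset.prod_mul_distrib, Nat.cast_prod, Real.finsetProd_rpow]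
        exact fun i _ => by positivity
    _ ≤ 2 ^ K * (n : ℝ) ^ ε := by
        refine mul_le_mul ?_ (Real.rpow_le_rpow (by positivity) hn1 hε.le) (by positivity)
          (by positivity)
        rw [← Finset.prod_filter, Finset.prod_const]
        refine pow_le_pow_right₀ (by norm_num) ?_
        calc #{p ∈ n.primeFactors | p < K} ≤ #(Finset.range K) :=
              Finset.card_le_card fun p hp => by
                simpa using (Finset.mem_filter.mp hp).2
          _ = K := by simp

lemma sum_abs_moebius_le (n : ℕ) :
    ∑ d ∈ n.divisors, |(ArithmeticFunction.moebius d : ℝ)| ≤ 2 ^ #n.primeFactors := by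
  calc ∑ d ∈ n.divisors, |(ArithmeticFunction.moebius d : ℝ)|
      ≤ ∑ d ∈ n.divisors, if Squarefree d then (1 : ℝ) else 0 := by
        refine Finset.sum_le_sum fun d _ => ?_
        split_ifs with h
        · exact_mod_cast ArithmeticFunction.abs_moebius_le_one
        · simp [ArithmeticFunction.moebius_eq_zero_of_not_squarefree h]
    _ = (#{d ∈ n.divisors | Squarefree d} : ℝ) := by
        rw [Finset.sum_ite]; simp
    _ ≤ _ := by exact_mod_cast card_squarefree_divisors_le n

/-- The sieve of dimension one on the primes dividing `P`; it carries no sifted set, since only its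
quadratic form is of interest. -/
noncomputable def reciprocalSieve (P : ℕ) (hP : Squarefree P) : BoundingSieve where
  support := ∅
  prodPrimes := P
  prodPrimes_squarefree := hP
  weights := 0
  weights_nonneg := fun _ => le_rfl
  totalMass := 0
  nu := ⟨fun d => (d : ℝ)⁻¹, by simp⟩
  nu_mult := by
    refine ⟨by simp, ?_⟩
    intro m n _
    simp [mul_comm]
  nu_pos_of_prime := by
    intro p hp _
    simpa using hp.pos
  nu_lt_one_of_prime := by
    intro p hp _
    exact inv_lt_one_of_one_lt₀ (by exact_mod_cast hp.one_lt)

@[simp] lemma reciprocalSieve_nu (P : ℕ) (hP : Squarefree P) (d : ℕ) :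
    (reciprocalSieve P hP).nu d = (d : ℝ)⁻¹ := rfl

lemma prod_one_sub_inv_eq_totient_div {q : ℕ} (hq : q ≠ 0) :
    ∏ p ∈ q.primeFactors, (1 - (p : ℝ)⁻¹) = (q.totient : ℝ) / q := by
  have h := congrArg (fun x : ℚ => (x : ℝ)) (Nat.totient_eq_mul_prod_factors q)
  push_cast at h
  rw [h, mul_div_cancel_left₀ _ (by exact_mod_cast hq)]

lemma sum_inv_le_prod_of_subset_factoredNumbers (S T : Finset ℕ) (hS : ∀ p ∈ S, p.Prime)
    (hT : ∀ n ∈ T, n ∈ Nat.factoredNumbers S) :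
    ∑ n ∈ T, (n : ℝ)⁻¹ ≤ ∏ p ∈ S, (1 - (p : ℝ)⁻¹)⁻¹ := by
  let f : ℕ →* ℝ := ⟨⟨fun n => (n : ℝ)⁻¹, by simp⟩, fun m n => by simp [mul_comm]⟩
  have hf : ∀ n, f n = (n : ℝ)⁻¹ := fun _ => rfl
  have h := (EulerProduct.summable_and_hasSum_factoredNumbers_prod_filter_prime_geometric (f := f)
    (fun {p} hp => by
      rw [hf, norm_inv, Real.norm_natCast]
      exact inv_lt_one_of_one_lt₀ (by exact_mod_cast hp.one_lt)) S).2
  rw [Finset.filter_true_of_mem hS] at h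
  simp only [hf] at h
  calc ∑ n ∈ T, (n : ℝ)⁻¹ = ∑ n ∈ T.subtype (· ∈ Nat.factoredNumbers S), ((n : ℕ) : ℝ)⁻¹ := by
        rw [Finset.sum_subtype_eq_sum_filter (f := fun n : ℕ => (n : ℝ)⁻¹),
          Finset.filter_true_of_mem hT]
    _ ≤ _ := sum_le_hasSum _ (fun i _ => by positivity) h

/-- Group the integers `n ≤ R` according to the product `r` of the primes dividing `n` but not
`q`; the reciprocals with a given `r` add up to at most `g(r) q / φ(q)`. -/
lemma log_le_totient_ratio_mul_sum_selbergTerms {q : ℕ} (hq : q ≠ 0) {R : ℝ} (hR : 0 ≤ R)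
    {P : ℕ} (hP : Squarefree P) (hPR : ∀ p : ℕ, p.Prime → (p ∣ P ↔ (p : ℝ) ≤ R ∧ ¬ p ∣ q)) :
    ((q.totient : ℝ) / q) * Real.log R ≤
      ∑ m ∈ P.divisors with m ≤ ⌊R⌋₊, (reciprocalSieve P hP).selbergTerms m := by
  have hP0 : P ≠ 0 := hP.ne_zero
  have hprod : 0 < ∏ p ∈ q.primeFactors, (1 - (p : ℝ)⁻¹) := by
    refine Finset.prod_pos fun p hp => sub_pos.mpr (inv_lt_one_of_one_lt₀ ?_)
    exact_mod_cast (Nat.prime_of_mem_primeFactors hp).one_lt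
  set r : ℕ → ℕ := fun n => ∏ p ∈ n.primeFactors with ¬ p ∣ q, p with hr
  have hrp : ∀ n, (r n).primeFactors = n.primeFactors.filter (fun p => ¬ p ∣ q) := fun n =>
    Nat.primeFactors_prod fun p hp => Nat.prime_of_mem_primeFactors (Finset.mem_filter.mp hp).1
  have hrn : ∀ n, r n ∣ n := fun n =>
    (Finset.prod_dvd_prod_of_subset _ _ _ (Finset.filter_subset _ _)).trans
      (Nat.prod_primeFactors_dvd n)
  -- `r n` is the product of the primes dividing `n` but not `q`
  have hlog : Real.log R ≤ ∑ n ∈ Finset.Icc 1 ⌊R⌋₊, (n : ℝ)⁻¹ := by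
    have := log_le_harmonic_floor R hR
    rw [harmonic_eq_sum_Icc] at this
    push_cast at this
    exact this
  have hmaps : ∀ n ∈ Finset.Icc 1 ⌊R⌋₊, r n ∈ P.divisors.filter (fun m => m ≤ ⌊R⌋₊) := by
    intro n hn
    obtain ⟨h1, h2⟩ := Finset.mem_Icc.mp hn
    have hnR : (n : ℝ) ≤ R := (Nat.le_floor_iff hR).mp h2
    refine Finset.mem_filter.mpr ⟨Nat.mem_divisors.mpr ⟨?_, hP0⟩, ?_⟩
    · refine (Finset.prod_dvd_prod_of_subset _ P.primeFactors _ ?_).trans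
        (Nat.prod_primeFactors_dvd P)
      intro p hp
      obtain ⟨hp, hpq⟩ := Finset.mem_filter.mp hp
      have hpp := Nat.prime_of_mem_primeFactors hp
      refine Nat.mem_primeFactors.mpr ⟨hpp, (hPR p hpp).mpr ⟨?_, hpq⟩, hP0⟩
      exact le_trans (by exact_mod_cast Nat.le_of_dvd h1 (Nat.dvd_of_mem_primeFactors hp)) hnR
    · exact (Nat.le_of_dvd h1 (hrn n)).trans h2
  have hfib : ∀ m ∈ P.divisors.filter (fun m => m ≤ ⌊R⌋₊),
      ∑ n ∈ Finset.Icc 1 ⌊R⌋₊ with r n = m, (n : ℝ)⁻¹ ≤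
        (reciprocalSieve P hP).selbergTerms m * (∏ p ∈ q.primeFactors, (1 - (p : ℝ)⁻¹))⁻¹ := by
    intro m hm
    have hmP := (Nat.mem_divisors.mp (Finset.mem_filter.mp hm).1).1
    have hm0 : m ≠ 0 := ne_zero_of_dvd_ne_zero hP0 hmP
    have hdisj : Disjoint m.primeFactors q.primeFactors := by
      rw [Finset.disjoint_left]
      intro p hp hpq
      have hpp := Nat.prime_of_mem_primeFactors hp
      exact ((hPR p hpp).mp ((Nat.dvd_of_mem_primeFactors hp).trans hmP)).2
        (Nat.dvd_of_mem_primeFactors hpq)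
    have key := sum_inv_le_prod_of_subset_factoredNumbers (m.primeFactors ∪ q.primeFactors)
      ((Finset.filter (fun n => r n = m) (Finset.Icc 1 ⌊R⌋₊)).image (fun n => n / m)) (by
        intro p hp
        rcases Finset.mem_union.mp hp with h | h <;> exact Nat.prime_of_mem_primeFactors h) (by
        intro k hk
        obtain ⟨n, hn, rfl⟩ := Finset.mem_image.mp hk
        obtain ⟨hnI, rfl⟩ := Finset.mem_filter.mp hn
        have hn1 := (Finset.mem_Icc.mp hnI).1
        have h0 : n / r n ≠ 0 :=
          (Nat.div_pos (Nat.le_of_dvd hn1 (hrn n)) (Nat.pos_of_dvd_of_pos (hrn n) hn1)).ne'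
        refine Nat.mem_factoredNumbers_of_primeFactors_subset h0 fun p hp => ?_
        have hpn : p ∈ n.primeFactors :=
          Nat.primeFactors_mono (Nat.div_dvd_of_dvd (hrn n)) (by omega) hp
        rw [Finset.mem_union, hrp, Finset.mem_filter, Nat.mem_primeFactors (n := q)]
        by_cases hpq : p ∣ q
        · exact Or.inr ⟨Nat.prime_of_mem_primeFactors hp, hpq, hq⟩
        · exact Or.inl ⟨hpn, hpq⟩)
    rw [Finset.sum_image (by
      intro n hn n' hn' h
      obtain ⟨-, h1⟩ := Finset.mem_filter.mp hn
      obtain ⟨-, h2⟩ := Finset.mem_filter.mp hn'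
      have e1 := Nat.div_mul_cancel (h1 ▸ hrn n)
      have e2 := Nat.div_mul_cancel (h2 ▸ hrn n')
      simp only at h
      rw [← e1, ← e2, h]), Finset.prod_union hdisj] at key
    rw [BoundingSieve.selbergTerms_apply]
    simp only [reciprocalSieve_nu]
    calc ∑ n ∈ Finset.Icc 1 ⌊R⌋₊ with r n = m, (n : ℝ)⁻¹
        = (m : ℝ)⁻¹ * ∑ n ∈ Finset.Icc 1 ⌊R⌋₊ with r n = m, ((n / m : ℕ) : ℝ)⁻¹ := by
          rw [Finset.mul_sum]
          refine Finset.sum_congr rfl fun n hn => ?_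
          obtain ⟨-, h1⟩ := Finset.mem_filter.mp hn
          rw [Nat.cast_div (h1 ▸ hrn n) (by exact_mod_cast hm0), inv_div, ← mul_div_assoc,
            inv_mul_cancel₀ (by exact_mod_cast hm0), one_div]
      _ ≤ _ := by
          rw [mul_assoc, ← Finset.prod_inv_distrib]
          exact mul_le_mul_of_nonneg_left key (by positivity)
  rw [← prod_one_sub_inv_eq_totient_div hq, ← le_div_iff₀' hprod, div_eq_mul_inv, Finset.sum_mul]
  refine hlog.trans ?_
  rw [← Finset.sum_fiberwise_of_maps_to hmaps]
  exact Finset.sum_le_sum hfib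

lemma sum_divisors_moebius (n : ℕ) :
    ∑ d ∈ n.divisors, (ArithmeticFunction.moebius d : ℝ) = if n = 1 then 1 else 0 := by
  have h : ∑ d ∈ n.divisors, ArithmeticFunction.moebius d = if n = 1 then 1 else 0 := by
    rw [← ArithmeticFunction.coe_mul_zeta_apply, ArithmeticFunction.moebius_mul_coe_zeta,
      ArithmeticFunction.one_apply]
  exact_mod_cast h

/-- The Möbius function above `l`; this inverts the change of variables in Selberg's quadratic form. -/
lemma sum_moebius_filter_dvd {l m : ℕ} (hm : Squarefree m) :
    ∑ d ∈ m.divisors with l ∣ d, (ArithmeticFunction.moebius d : ℝ) =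
      if m = l then (ArithmeticFunction.moebius l : ℝ) else 0 := by
  have hm0 := hm.ne_zero
  by_cases hlm : l ∣ m
  · obtain ⟨k, rfl⟩ := hlm
    have hl0 : l ≠ 0 := left_ne_zero_of_mul hm0
    have hk0 : k ≠ 0 := right_ne_zero_of_mul hm0
    have himg : {d ∈ (l * k).divisors | l ∣ d} = k.divisors.image (l * ·) := by
      ext d
      simp only [Finset.mem_filter, Nat.mem_divisors, Finset.mem_image]
      constructor
      · rintro ⟨⟨h1, -⟩, ⟨c, rfl⟩⟩
        exact ⟨c, ⟨Nat.dvd_of_mul_dvd_mul_left (Nat.pos_of_ne_zero hl0) h1, hk0⟩, rfl⟩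
      · rintro ⟨c, ⟨h1, -⟩, rfl⟩
        exact ⟨⟨Nat.mul_dvd_mul_left l h1, hm0⟩, Dvd.intro _ rfl⟩
    rw [himg, Finset.sum_image (fun a _ b _ h => Nat.eq_of_mul_eq_mul_left
      (Nat.pos_of_ne_zero hl0) h)]
    have h1 : ∀ c ∈ k.divisors, (ArithmeticFunction.moebius (l * c) : ℝ) =
        (ArithmeticFunction.moebius l : ℝ) * (ArithmeticFunction.moebius c : ℝ) := by
      intro c hc
      have hcop : Nat.Coprime l c := (Nat.coprime_of_squarefree_mul hm).coprime_dvd_right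
        (Nat.dvd_of_mem_divisors hc)
      rw [ArithmeticFunction.isMultiplicative_moebius.map_mul_of_coprime hcop]
      push_cast; rfl
    rw [Finset.sum_congr rfl h1, ← Finset.mul_sum]
    rw [sum_divisors_moebius]
    by_cases hk1 : k = 1
    · simp [hk1]
    · have : l * k ≠ l := fun h => hk1 (Nat.eq_of_mul_eq_mul_left (Nat.pos_of_ne_zero hl0)
        (by simpa using h))
      simp [hk1, this]
  · rw [if_neg (fun h : m = l => hlm (dvd_of_eq h.symm)), Finset.sum_eq_zero]
    intro d hd
    obtain ⟨h1, h2⟩ := Finset.mem_filter.mp hd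
    exact absurd (h2.trans (Nat.dvd_of_mem_divisors h1)) hlm

/-- Selberg's weights of level `R` for the primes not dividing `q`. They minimise the quadratic form
`∑ w(d) w(e) / [d, e]` under `w(1) = 1`; the minimum is `1 / G`, where `G` is the sum of Selberg's
function `g` over the admissible integers up to `R`. -/
theorem exists_selberg_weights {q : ℕ} (hq : q ≠ 0) {R : ℝ} (hR : 1 < R) :
    ∃ w : ℕ → ℝ, w 1 = 1 ∧ (∀ d, |w d| ≤ 1) ∧
      (∀ d, w d ≠ 0 → d ∈ Finset.Icc 1 ⌊R⌋₊ ∧ d.Coprime q) ∧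
      ((q.totient : ℝ) / q) * ∑ d ∈ Finset.Icc 1 ⌊R⌋₊, ∑ e ∈ Finset.Icc 1 ⌊R⌋₊,
        w d * w e / (d.lcm e : ℝ) ≤ 1 / Real.log R := by
  have hR0 : (0 : ℝ) ≤ R := by linarith
  set S : Finset ℕ := {p ∈ Finset.Icc 1 ⌊R⌋₊ | p.Prime ∧ ¬ p ∣ q} with hS
  have hSp : ∀ p ∈ S, p.Prime := fun p hp => (Finset.mem_filter.mp hp).2.1
  set P : ℕ := ∏ p ∈ S, p with hPdef
  have hP : Squarefree P := by
    refine Finset.squarefree_prod_of_pairwise_isCoprime ?_ fun p hp => (hSp p hp).squarefree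
    intro a ha b hb hab
    exact Nat.coprime_iff_isRelPrime.mp ((Nat.coprime_primes (hSp a ha) (hSp b hb)).mpr hab)
  have hP0 : P ≠ 0 := hP.ne_zero
  have hPR : ∀ p : ℕ, p.Prime → (p ∣ P ↔ (p : ℝ) ≤ R ∧ ¬ p ∣ q) := by
    intro p hp
    have h1 : p ∣ P ↔ p ∈ P.primeFactors := by simp [hp, hP0]
    rw [h1, Nat.primeFactors_prod hSp, hS, Finset.mem_filter, Finset.mem_Icc, Nat.le_floor_iff hR0]
    simp [hp, hp.one_lt.le]
  have hPq : ∀ d, d ∣ P → d.Coprime q := by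
    intro d hd
    refine Nat.Coprime.coprime_dvd_left hd (Nat.Coprime.prod_left fun p hp => ?_)
    exact (Nat.Prime.coprime_iff_not_dvd (hSp p hp)).mpr (Finset.mem_filter.mp hp).2.2
  set s := reciprocalSieve P hP with hs
  set g := s.selbergTerms with hg
  set T : Finset ℕ := {m ∈ P.divisors | m ≤ ⌊R⌋₊} with hT
  have hTP : ∀ m ∈ T, m ∣ P := fun m hm =>
    Nat.dvd_of_mem_divisors (Finset.mem_filter.mp hm).1
  have hgpos : ∀ m, m ∣ P → 0 < g m := fun m hm => BoundingSieve.selbergTerms_pos hm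
  set G : ℝ := ∑ m ∈ T, g m with hG
  have hlogR : 0 < Real.log R := Real.log_pos hR
  have hGlow : ((q.totient : ℝ) / q) * Real.log R ≤ G :=
    log_le_totient_ratio_mul_sum_selbergTerms hq hR0 hP hPR
  have hφ : 0 < (q.totient : ℝ) / q := by
    have := Nat.totient_pos.mpr (Nat.pos_of_ne_zero hq)
    positivity
  have hGpos : 0 < G := lt_of_lt_of_le (by positivity) hGlow
  set w : ℕ → ℝ := fun d => d * (ArithmeticFunction.moebius d : ℝ) / G *
    ∑ m ∈ T with d ∣ m, g m with hw
  have hw0 : ∀ d, w d ≠ 0 → d ∈ T := by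
    intro d hd
    have h1 : ∑ m ∈ T with d ∣ m, g m ≠ 0 := right_ne_zero_of_mul hd
    obtain ⟨m, hm, -⟩ := Finset.exists_ne_zero_of_sum_ne_zero h1
    obtain ⟨hm, hdm⟩ := Finset.mem_filter.mp hm
    have hmP := hTP m hm
    refine Finset.mem_filter.mpr ⟨Nat.mem_divisors.mpr ⟨hdm.trans hmP, hP0⟩, ?_⟩
    exact (Nat.le_of_dvd (Nat.pos_of_dvd_of_pos hmP (Nat.pos_of_ne_zero hP0)) hdm).trans
      (Finset.mem_filter.mp hm).2
  have hTI : ∀ d ∈ T, d ∈ Finset.Icc 1 ⌊R⌋₊ := fun d hd => Finset.mem_Icc.mpr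
    ⟨Nat.pos_of_dvd_of_pos (hTP d hd) (Nat.pos_of_ne_zero hP0), (Finset.mem_filter.mp hd).2⟩
  refine ⟨w, ?_, ?_, fun d hd => ⟨hTI d (hw0 d hd), hPq d (hTP d (hw0 d hd))⟩, ?_⟩
  · simp only [hw, isUnit_one, IsUnit.dvd, Finset.filter_true, ← hG]
    simp [hGpos.ne']
  · intro d
    by_cases hd : w d = 0
    · simp [hd]
    have hdT := hw0 d hd
    have hdP := hTP d hdT
    have hd0 : d ≠ 0 := ne_zero_of_dvd_ne_zero hP0 hdP
    -- `(l, m) ↦ l * (m / d)` maps pairs with `l ∣ d ∣ m` injectively to integers counted in `G`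
    have hsum : (d : ℝ) * ∑ m ∈ T with d ∣ m, g m ≤ G := by
      have hdiv : (∑ l ∈ d.divisors, g l) = g d * d := by
        have := BoundingSieve.sum_divisors_selbergTerms_eq_selbergTerms_mul_nu_inv (s := s) hdP
        rw [← Finset.sum_filter] at this
        rw [show s.prodPrimes = P from rfl, Nat.divisors_filter_dvd_of_dvd hP0 hdP] at this
        rw [this, hs, reciprocalSieve_nu, inv_inv]
      have hcop : ∀ m ∈ T, d ∣ m → (m / d).Coprime d := by
        intro m hm hdm
        exact Nat.coprime_of_squarefree_mul
          ((Nat.div_mul_cancel hdm).symm ▸ hP.squarefree_of_dvd (hTP m hm))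
      have hprod : ∀ x ∈ d.divisors ×ˢ {m ∈ T | d ∣ m},
          g (x.1 * (x.2 / d)) = g x.1 * (g x.2 / g d) := by
        rintro ⟨l, m⟩ hx
        obtain ⟨hl, hm⟩ := Finset.mem_product.mp hx
        obtain ⟨hm, hdm⟩ := Finset.mem_filter.mp hm
        have hld := Nat.dvd_of_mem_divisors hl
        have hmul := (BoundingSieve.selbergTerms_isMultiplicative (s := s))
        have h1 := hmul.map_mul_of_coprime ((hcop m hm hdm).symm.coprime_dvd_left hld)
        have h2 := hmul.map_mul_of_coprime (hcop m hm hdm)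
        rw [Nat.div_mul_cancel hdm] at h2
        simp only
        rw [hg, h1, h2, mul_div_cancel_right₀ _ (hgpos d hdP).ne']
      calc (d : ℝ) * ∑ m ∈ T with d ∣ m, g m
          = ∑ x ∈ d.divisors ×ˢ {m ∈ T | d ∣ m}, g (x.1 * (x.2 / d)) := by
            rw [Finset.sum_congr rfl hprod, Finset.sum_product]
            simp only
            rw [← Finset.sum_mul_sum, hdiv, ← Finset.sum_div]
            have := (hgpos d hdP).ne'
            field_simp
        _ = ∑ n ∈ (d.divisors ×ˢ {m ∈ T | d ∣ m}).image (fun x => x.1 * (x.2 / d)), g n := by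
            rw [Finset.sum_image]
            rintro ⟨l, m⟩ hx ⟨l', m'⟩ hx' h
            obtain ⟨hl, hm⟩ := Finset.mem_product.mp hx
            obtain ⟨hm, hdm⟩ := Finset.mem_filter.mp hm
            obtain ⟨hl', hm'⟩ := Finset.mem_product.mp hx'
            obtain ⟨hm', hdm'⟩ := Finset.mem_filter.mp hm'
            have hld := Nat.dvd_of_mem_divisors hl
            have hld' := Nat.dvd_of_mem_divisors hl'
            simp only at h hld hld' hm hm' hdm hdm'
            have e1 : Nat.gcd (l * (m / d)) d = l := by
              rw [Nat.Coprime.gcd_mul_right_cancel l (hcop m hm hdm), Nat.gcd_eq_left hld]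
            have e2 : Nat.gcd (l' * (m' / d)) d = l' := by
              rw [Nat.Coprime.gcd_mul_right_cancel l' (hcop m' hm' hdm'), Nat.gcd_eq_left hld']
            have e3 : l = l' := by rw [← e1, ← e2, h]
            subst e3
            have hl0 : 0 < l := Nat.pos_of_dvd_of_pos hld (Nat.pos_of_ne_zero hd0)
            have e4 := Nat.eq_of_mul_eq_mul_left hl0 h
            rw [Prod.mk.injEq]
            exact ⟨rfl, by rw [← Nat.div_mul_cancel hdm, e4, Nat.div_mul_cancel hdm']⟩
        _ ≤ G := by
            refine Finset.sum_le_sum_of_subset_of_nonneg ?_ fun i hi _ => (hgpos i (hTP i hi)).le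
            intro n hn
            obtain ⟨⟨l, m⟩, hx, rfl⟩ := Finset.mem_image.mp hn
            obtain ⟨hl, hm⟩ := Finset.mem_product.mp hx
            obtain ⟨hm, hdm⟩ := Finset.mem_filter.mp hm
            have hld := Nat.dvd_of_mem_divisors hl
            have hdvd : l * (m / d) ∣ m := by
              calc l * (m / d) ∣ d * (m / d) := Nat.mul_dvd_mul_right hld _
                _ = m := Nat.mul_div_cancel' hdm
            have hm1 := (Finset.mem_Icc.mp (hTI m hm)).1
            exact Finset.mem_filter.mpr ⟨Nat.mem_divisors.mpr ⟨hdvd.trans (hTP m hm), hP0⟩,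
              (Nat.le_of_dvd hm1 hdvd).trans (Finset.mem_filter.mp hm).2⟩
    have hnn : 0 ≤ ∑ m ∈ T with d ∣ m, g m :=
      Finset.sum_nonneg fun m hm => (hgpos m (hTP m (Finset.mem_filter.mp hm).1)).le
    have hmu : |(ArithmeticFunction.moebius d : ℝ)| ≤ 1 := by
      exact_mod_cast ArithmeticFunction.abs_moebius_le_one
    simp only [hw]
    rw [abs_mul, abs_div, abs_mul, abs_of_pos hGpos, abs_of_nonneg hnn, Nat.abs_cast, div_mul_eq_mul_div,
      div_le_one hGpos]
    calc _ ≤ (d : ℝ) * 1 * ∑ m ∈ T with d ∣ m, g m := by gcongr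
      _ ≤ G := by rwa [mul_one]
  -- in the variables `y l = ∑_{l ∣ d} w d / d` the form is diagonal, and here `y l = μ(l) g(l) / G`
  · have hy : ∀ l ∈ P.divisors, (∑ d ∈ P.divisors, if l ∣ d then s.nu d * w d else 0) =
        if l ∈ T then (ArithmeticFunction.moebius l : ℝ) * g l / G else 0 := by
      intro l hl
      have h1 : ∀ d ∈ P.divisors, (if l ∣ d then s.nu d * w d else 0) =
          ∑ m ∈ T, (if l ∣ d ∧ d ∣ m then (ArithmeticFunction.moebius d : ℝ) else 0) * g m / G := by
        intro d hd
        have hd0 : (d : ℝ) ≠ 0 := by exact_mod_cast (Nat.pos_of_mem_divisors hd).ne'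
        split_ifs with h
        · simp only [h, true_and, hs, reciprocalSieve_nu, hw, Finset.sum_filter, Finset.mul_sum]
          refine Finset.sum_congr rfl fun m _ => ?_
          split_ifs
          · field_simp
          · simp
        · simp [h]
      rw [Finset.sum_congr rfl h1, Finset.sum_comm]
      have h2 : ∀ m ∈ T, ∑ d ∈ P.divisors,
          (if l ∣ d ∧ d ∣ m then (ArithmeticFunction.moebius d : ℝ) else 0) * g m / G =
            if m = l then (ArithmeticFunction.moebius l : ℝ) * g l / G else 0 := by
        intro m hm
        have h3 : ∑ d ∈ P.divisors, (if l ∣ d ∧ d ∣ m then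
            (ArithmeticFunction.moebius d : ℝ) else 0) =
            ∑ d ∈ m.divisors with l ∣ d, (ArithmeticFunction.moebius d : ℝ) := by
          rw [← Finset.sum_filter, ← Nat.divisors_filter_dvd_of_dvd hP0 (hTP m hm),
            Finset.filter_filter]
          simp only [and_comm]
        rw [← Finset.sum_div, ← Finset.sum_mul, h3,
          sum_moebius_filter_dvd (hP.squarefree_of_dvd (hTP m hm))]
        split_ifs with h
        · rw [h]
        · simp
      rw [Finset.sum_congr rfl h2, Finset.sum_ite_eq']
    have hmain : s.mainSum (BoundingSieve.lambdaSquared w) = 1 / G := by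
      rw [BoundingSieve.mainSum_lambdaSquared_eq_sum_mul_sum_sq]
      calc _ = ∑ l ∈ P.divisors, if l ∈ T then g l / G ^ 2 else 0 := by
            refine Finset.sum_congr rfl fun l hl => ?_
            rw [show s.prodPrimes = P from rfl, hy l hl]
            have hlP := Nat.dvd_of_mem_divisors hl
            split_ifs
            · have h1 : (ArithmeticFunction.moebius l : ℝ) ^ 2 = 1 := by
                exact_mod_cast ArithmeticFunction.moebius_sq_eq_one_of_squarefree
                  (hP.squarefree_of_dvd hlP)
              have h2 := (hgpos l hlP).ne'
              rw [div_pow, mul_pow, h1]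
              change (g l)⁻¹ * _ = _
              field_simp
            · simp
        _ = ∑ l ∈ T, g l / G ^ 2 := by
            rw [← Finset.sum_filter]
            congr 1
            ext l
            simp only [Finset.mem_filter, and_iff_right_iff_imp]
            exact fun h => (Finset.mem_filter.mp h).1
        _ = 1 / G := by
            rw [← Finset.sum_div, ← hG]
            field_simp
    have hquad : ∑ d ∈ Finset.Icc 1 ⌊R⌋₊, ∑ e ∈ Finset.Icc 1 ⌊R⌋₊, w d * w e / (d.lcm e : ℝ) =
        1 / G := by
      have hsub : ∀ A : Finset ℕ, T ⊆ A → (∀ f : ℕ → ℝ, (∀ d, w d = 0 → f d = 0) →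
          ∑ d ∈ A, f d = ∑ d ∈ T, f d) := by
        intro A hA f hf
        refine (Finset.sum_subset hA fun d _ hd => hf d ?_).symm
        by_contra h
        exact hd (hw0 d h)
      have hTI' : T ⊆ Finset.Icc 1 ⌊R⌋₊ := hTI
      have hTP' : T ⊆ P.divisors := Finset.filter_subset _ _
      rw [← hmain, BoundingSieve.mainSum_lambdaSquared_eq_sum_sum_mul,
        hsub _ hTI' _ (by intro d hd; simp [hd]),
        show s.prodPrimes = P from rfl, hsub _ hTP' _ (by intro d hd; simp [hd])]
      refine Finset.sum_congr rfl fun d hd => ?_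
      rw [hsub _ hTI' _ (by intro d hd; simp [hd]), hsub _ hTP' _ (by intro d hd; simp [hd])]
      refine Finset.sum_congr rfl fun e he => ?_
      simp only [hs, reciprocalSieve_nu, inv_inv]
      have h1 : (d.gcd e : ℝ) * (d.lcm e : ℝ) = d * e := by exact_mod_cast Nat.gcd_mul_lcm d e
      have hd0 : d ≠ 0 := ne_zero_of_dvd_ne_zero hP0 (hTP d hd)
      have he0 : e ≠ 0 := ne_zero_of_dvd_ne_zero hP0 (hTP e he)
      have h2 : (d.lcm e : ℝ) ≠ 0 := by exact_mod_cast Nat.lcm_ne_zero hd0 he0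
      have h3 : (d : ℝ) ≠ 0 := by exact_mod_cast hd0
      have h4 : (e : ℝ) ≠ 0 := by exact_mod_cast he0
      have h5 : (d.gcd e : ℝ) = d * e / (d.lcm e : ℝ) := by rw [eq_div_iff h2, h1]
      have h6 : ∀ x y : ℝ, x * y / (d.lcm e : ℝ) = (d : ℝ)⁻¹ * x * (e : ℝ)⁻¹ * y * d.gcd e := by
        intro x y
        rw [h5]
        field_simp
      exact h6 _ _
    rw [hquad, mul_one_div, div_le_div_iff₀ hGpos hlogR, one_mul]
    exact hGlow

/-! ### Smoothed character sums under the generalized Lindelöf hypothesis -/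

section Contour
open Complex MeasureTheory Set Filter Topology

/-- Shifting a vertical line of integration; the horizontal edges of the rectangles vanish because
of the decay of `F`. -/
lemma integral_vertical_eq_of_decay {F : ℂ → ℂ} {a b K : ℝ} (hab : a ≤ b)
    (hF : DifferentiableOn ℂ F {w | a ≤ w.re ∧ w.re ≤ b})
    (hdecay : ∀ w : ℂ, a ≤ w.re → w.re ≤ b → 1 ≤ |w.im| → ‖F w‖ ≤ K / |w.im|)
    (ha : Integrable fun y : ℝ => F (a + y * I)) (hb : Integrable fun y : ℝ => F (b + y * I)) :
    ∫ y : ℝ, F (a + y * I) = ∫ y : ℝ, F (b + y * I) := by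
  have hrect : ∀ T : ℝ, 0 < T →
      (∫ x : ℝ in a..b, F (x + (-T : ℝ) * I)) - (∫ x : ℝ in a..b, F (x + (T : ℝ) * I)) +
        I • (∫ y : ℝ in (-T)..T, F (b + y * I)) - I • (∫ y : ℝ in (-T)..T, F (a + y * I)) = 0 := by
    intro T hT
    have h := Complex.integral_boundary_rect_eq_zero_of_differentiableOn F
      (⟨a, -T⟩ : ℂ) (⟨b, T⟩ : ℂ) (hF.mono fun w hw => by
        have h := hw.1
        rw [Set.mem_preimage, Set.uIcc_of_le hab] at h
        exact h)
    exact h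
  have hhor : ∀ f : ℝ → ℝ, Tendsto (fun T => |f T|) atTop atTop →
      Tendsto (fun T => ∫ x : ℝ in a..b, F (x + (f T : ℝ) * I)) atTop (𝓝 0) := by
    intro f hf
    have h0 : Tendsto (fun T => K / |f T| * |b - a|) atTop (𝓝 0) := by
      simpa using (hf.const_div_atTop K).mul_const |b - a|
    refine squeeze_zero_norm' ?_ h0
    filter_upwards [hf.eventually_ge_atTop 1] with T hT
    refine intervalIntegral.norm_integral_le_of_norm_le_const fun x hx => ?_
    rw [Set.uIoc_of_le hab] at hx
    have := hdecay (x + (f T : ℝ) * I) (by simpa using hx.1.le) (by simpa using hx.2)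
      (by simpa using hT)
    simpa using this
  have h1 := hhor (fun T => -T) (by simpa using tendsto_abs_atTop_atTop)
  have h2 := hhor (fun T => T) tendsto_abs_atTop_atTop
  have h3 := (intervalIntegral_tendsto_integral hb tendsto_neg_atTop_atBot tendsto_id).const_smul I
  have h4 := (intervalIntegral_tendsto_integral ha tendsto_neg_atTop_atBot tendsto_id).const_smul I
  have h5 := ((h1.sub h2).add h3).sub h4
  have h6 : Tendsto (fun _ : ℝ => (0 : ℂ)) atTop (𝓝 _) := h5.congr' (by
    filter_upwards [eventually_gt_atTop 0] with T hT using hrect T hT)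
  have h7 := tendsto_nhds_unique h6 tendsto_const_nhds
  simp only [sub_zero, zero_add, smul_eq_mul] at h7
  rw [← mul_sub, mul_eq_zero, or_iff_right I_ne_zero, sub_eq_zero] at h7
  exact h7.symm

/-- A lower bound for the denominator of the kernel `1 / (w (w + 1))` away from its poles. -/
lemma le_norm_mul_add_one {w : ℂ} {m : ℝ} (hm : 0 ≤ m) (hm1 : m ≤ 1) (h1 : m ≤ |w.re|)
    (h2 : m ≤ |w.re + 1|) : m ^ 2 * (1 + w.im ^ 2) ≤ ‖w * (w + 1)‖ := by
  have key : ∀ z : ℂ, z.im = w.im → m ≤ |z.re| → m ^ 2 * (1 + w.im ^ 2) ≤ ‖z‖ ^ 2 := by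
    intro z hz h
    rw [← Complex.normSq_eq_norm_sq, Complex.normSq_apply, hz]
    have h3 : m ^ 2 ≤ z.re ^ 2 := by
      rw [← sq_abs z.re]; gcongr
    have h4 : m ^ 2 ≤ 1 := by nlinarith
    nlinarith [sq_nonneg w.im, mul_nonneg (sub_nonneg.mpr h4) (sq_nonneg w.im)]
  have h3 := key w rfl h1
  have h4 := key (w + 1) (by simp) (by simpa using h2)
  rw [norm_mul]
  have h5 : (m ^ 2 * (1 + w.im ^ 2)) ^ 2 ≤ (‖w‖ * ‖w + 1‖) ^ 2 := by
    rw [mul_pow ‖w‖, sq (m ^ 2 * _)]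
    gcongr
  exact le_of_sq_le_sq h5 (by positivity)

lemma integrable_one_add_sq_rpow :
    Integrable fun y : ℝ => (1 + y ^ 2) ^ (-(3 / 4) : ℝ) := by
  have h := integrable_rpow_neg_one_add_norm_sq (E := ℝ) (μ := volume) (r := 3 / 2)
    (by simp; norm_num)
  refine h.congr (Eventually.of_forall fun y => ?_)
  simp only [Real.norm_eq_abs, sq_abs]
  norm_num

/-- The Mellin transform of `max (1 - x) 0`. -/
lemma mellin_triangle {w : ℂ} (hw : 0 < w.re) :
    HasMellin (fun x : ℝ => (Ioc (0 : ℝ) 1).indicator (fun _ => (1 : ℂ)) x -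
      (Ioc (0 : ℝ) 1).indicator (fun x : ℝ => (x : ℂ) ^ (1 : ℂ)) x) w (1 / (w * (w + 1))) := by
  have hw1 : 0 < w.re + (1 : ℂ).re := by simp; linarith
  have h := hasMellin_sub (hasMellin_one_Ioc hw).1 (hasMellin_cpow_Ioc 1 hw1).1
  refine ⟨h.1, h.2.trans ?_⟩
  rw [(hasMellin_one_Ioc hw).2, (hasMellin_cpow_Ioc 1 hw1).2]
  have h0 : w ≠ 0 := fun h => by simp [h] at hw
  have h1 : w + 1 ≠ 0 := fun h => by
    have := congrArg Complex.re h
    simp at this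
    linarith
  field_simp
  ring

lemma integrable_one_div_mul_add_one {c : ℝ} (hc : 1 ≤ c) :
    Integrable fun y : ℝ => (1 : ℂ) / ((c + y * I) * (c + y * I + 1)) := by
  have hne : ∀ y : ℝ, ((c : ℂ) + y * I) * (c + y * I + 1) ≠ 0 := by
    intro y h
    have := le_norm_mul_add_one (w := c + y * I) (m := 1) (by norm_num) le_rfl
      (by simp [abs_of_nonneg (by linarith : 0 ≤ c), hc])
      (by simp only [add_re, ofReal_re, mul_re, I_re, ofReal_im, I_im]
          rw [abs_of_nonneg] <;> linarith)
    rw [h] at this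
    simp at this
    nlinarith [sq_nonneg y]
  refine Integrable.mono' integrable_inv_one_add_sq ?_ (Eventually.of_forall fun y => ?_)
  · exact (Continuous.div continuous_const (by fun_prop) hne).aestronglyMeasurable
  · have := le_norm_mul_add_one (w := c + y * I) (m := 1) (by norm_num) le_rfl
      (by simp [abs_of_nonneg (by linarith : 0 ≤ c), hc])
      (by simp only [add_re, ofReal_re, mul_re, I_re, ofReal_im, I_im]
          rw [abs_of_nonneg] <;> linarith)
    rw [norm_div, norm_one, one_div]
    refine inv_anti₀ (by positivity) ?_
    simpa using this

/-- Perron's formula with the kernel `1 / (w (w + 1))`. -/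
lemma integral_perron {c y : ℝ} (hc : 1 ≤ c) (hy : 0 < y) :
    ∫ t : ℝ, (y : ℂ) ^ ((c : ℂ) + t * I) / ((c + t * I) * (c + t * I + 1)) =
      2 * Real.pi * (max (1 - 1 / y) 0 : ℝ) := by
  have hc0 : 0 < c := by linarith
  set f : ℝ → ℂ := fun x : ℝ => (Ioc (0 : ℝ) 1).indicator (fun _ => (1 : ℂ)) x -
      (Ioc (0 : ℝ) 1).indicator (fun x : ℝ => (x : ℂ) ^ (1 : ℂ)) x with hf
  have hfx : ∀ x : ℝ, 0 < x → f x = ((max (1 - x) 0 : ℝ) : ℂ) := by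
    intro x hx
    by_cases h : x ≤ 1
    · rw [max_eq_left (by linarith)]
      simp [hf, hx, h]
    · rw [max_eq_right (by linarith)]
      simp [hf, h]
  have hmel : ∀ t : ℝ, mellin f (c + t * I) = 1 / ((c + t * I) * (c + t * I + 1)) := fun t =>
    (mellin_triangle (w := c + t * I) (by simpa using hc0)).2
  have hx : 0 < 1 / y := by positivity
  have h := mellinInv_mellin_eq c f hx (mellin_triangle (w := (c : ℂ)) (by simpa using hc0)).1
    (by
      unfold VerticalIntegrable
      simp_rw [hmel]
      exact integrable_one_div_mul_add_one hc)
    (by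
      have hcont : ContinuousAt (fun x : ℝ => ((max (1 - x) 0 : ℝ) : ℂ)) (1 / y) := by fun_prop
      refine hcont.congr ?_
      filter_upwards [lt_mem_nhds hx] with x hx using (hfx x hx).symm)
  rw [hfx _ hx, mellinInv] at h
  simp_rw [hmel] at h
  have hcpow : ∀ t : ℝ, ((1 / y : ℝ) : ℂ) ^ (-((c : ℂ) + t * I)) = (y : ℂ) ^ ((c : ℂ) + t * I) := by
    intro t
    rw [one_div, Complex.ofReal_inv, Complex.inv_cpow _ _ (by
      rw [Complex.arg_ofReal_of_nonneg hy.le]; exact Real.pi_pos.ne), Complex.cpow_neg, inv_inv]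
  simp_rw [hcpow] at h
  rw [← h]
  simp only [smul_eq_mul, mul_one_div, Complex.real_smul]
  push_cast
  have : (2 * Real.pi : ℂ) ≠ 0 := by exact_mod_cast (by positivity : 2 * Real.pi ≠ 0)
  rw [← mul_assoc, mul_one_div_cancel this, one_mul]

lemma one_add_abs_sqrt_le (y : ℝ) : (1 + |y|) ^ (1 / 2 : ℝ) ≤ 2 * (1 + y ^ 2) ^ (1 / 4 : ℝ) := by
  have h1 : 1 + |y| ≤ 2 * (1 + y ^ 2) ^ (1 / 2 : ℝ) := by
    rw [← Real.sqrt_eq_rpow]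
    have : |y| ≤ √(1 + y ^ 2) := Real.abs_le_sqrt (by linarith)
    have h2 : 1 ≤ √(1 + y ^ 2) := Real.one_le_sqrt.mpr (by nlinarith [sq_nonneg y])
    linarith
  calc (1 + |y|) ^ (1 / 2 : ℝ) ≤ (2 * (1 + y ^ 2) ^ (1 / 2 : ℝ)) ^ (1 / 2 : ℝ) := by gcongr
    _ = 2 ^ (1 / 2 : ℝ) * (1 + y ^ 2) ^ (1 / 4 : ℝ) := by
        rw [Real.mul_rpow (by norm_num) (by positivity), ← Real.rpow_mul (by positivity)]
        norm_num
    _ ≤ _ := by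
        gcongr
        calc (2 : ℝ) ^ (1 / 2 : ℝ) ≤ 2 ^ (1 : ℝ) := by gcongr <;> norm_num
          _ = 2 := by norm_num

/-- For a nonprincipal character the bound of `GLH` persists near `s = 1`, by the maximum
principle on the disc `|s - 1| ≤ 1 / 2`. -/
lemma GLH.norm_LFunction_le (hGLH : GLH) {ε : ℝ} (hε : 0 < ε) :
    ∃ C : ℝ, 0 < C ∧ ∀ (q : ℕ) [NeZero q] (χ : DirichletCharacter ℂ q), χ ≠ 1 → ∀ s : ℂ,
      1 / 2 ≤ s.re → ‖χ.LFunction s‖ ≤ C * ((q : ℝ) * (1 + |s.im|)) ^ ε := by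
  obtain ⟨C, hC, h⟩ := hGLH ε hε
  refine ⟨C * 2 ^ ε, by positivity, fun q _ χ hχ s hs => ?_⟩
  have h2 : (1 : ℝ) ≤ 2 ^ ε := Real.one_le_rpow (by norm_num) hε.le
  by_cases hs1 : 1 / 2 ≤ ‖s - 1‖
  · refine (h q χ s hs hs1).trans ?_
    gcongr
    nlinarith
  · have hdiff := DirichletCharacter.differentiable_LFunction hχ
    have hfr : ∀ z ∈ frontier (Metric.ball (1 : ℂ) (1 / 2)),
        ‖χ.LFunction z‖ ≤ C * ((q : ℝ) * 2) ^ ε := by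
      intro z hz
      rw [frontier_ball _ (by norm_num), mem_sphere_iff_norm] at hz
      have h3 : |(z - 1).re| ≤ 1 / 2 := (Complex.abs_re_le_norm _).trans hz.le
      have h4 : |(z - 1).im| ≤ 1 / 2 := (Complex.abs_im_le_norm _).trans hz.le
      simp only [sub_re, one_re, sub_im, one_im, sub_zero] at h3 h4
      refine (h q χ z (by linarith [(abs_le.mp h3).1]) hz.ge).trans ?_
      gcongr
      linarith
    have hmem : s ∈ closure (Metric.ball (1 : ℂ) (1 / 2)) := by
      rw [closure_ball _ (by norm_num), mem_closedBall_iff_norm]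
      exact (not_le.mp hs1).le
    refine (Complex.norm_le_of_forall_mem_frontier_norm_le Metric.isBounded_ball
      hdiff.diffContOnCl hfr hmem).trans ?_
    rw [mul_assoc, ← Real.mul_rpow (by norm_num) (by positivity)]
    refine mul_le_mul_of_nonneg_left (Real.rpow_le_rpow (by positivity) ?_ hε.le) hC.le
    nlinarith [abs_nonneg s.im, (Nat.cast_nonneg q : (0 : ℝ) ≤ q)]

/-- The smoothed sum `∑ χ(m) m⁻ˢ (1 - m / Y)` over `m ≤ Y`. -/
noncomputable def smoothSum {q : ℕ} (χ : DirichletCharacter ℂ q) (s : ℂ) (Y : ℝ) : ℂ :=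
  ∑ m ∈ Finset.Icc 1 ⌊Y⌋₊, χ m * (m : ℂ) ^ (-s) * ((1 - m / Y : ℝ) : ℂ)

lemma smoothSum_eq_sum_max {q : ℕ} (χ : DirichletCharacter ℂ q) (s : ℂ) {Y : ℝ} (hY : 0 < Y)
    {M : ℕ} (hM : ⌊Y⌋₊ ≤ M) :
    smoothSum χ s Y =
      ∑ m ∈ Finset.Icc 1 M, χ m * (m : ℂ) ^ (-s) * ((max (1 - m / Y) 0 : ℝ) : ℂ) := by
  rw [smoothSum, ← Finset.sum_subset (Finset.Icc_subset_Icc_right hM)]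
  · refine Finset.sum_congr rfl fun m hm => ?_
    have : (m : ℝ) ≤ Y := (Nat.le_floor_iff hY.le).mp (Finset.mem_Icc.mp hm).2
    rw [max_eq_left (sub_nonneg.mpr ((div_le_one hY).mpr this))]
  · intro m hm hm'
    have : Y ≤ m := by
      have h1 := (Finset.mem_Icc.mp hm).1
      have h2 : ⌊Y⌋₊ < m := by
        by_contra h
        exact hm' (Finset.mem_Icc.mpr ⟨h1, not_lt.mp h⟩)
      exact (Nat.lt_of_floor_lt h2).le
    rw [max_eq_right (sub_nonpos.mpr ((one_le_div hY).mpr this))]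
    simp

/-- Summing Perron's formula over the terms of the Dirichlet series. -/
lemma integral_LFunction_eq_smoothSum {q : ℕ} [NeZero q] (χ : DirichletCharacter ℂ q) {s : ℂ}
    (hs : 0 < s.re) {Y : ℝ} (hY : 0 < Y) :
    ∫ t : ℝ, χ.LFunction (s + (1 + t * I)) * ((Y : ℂ) ^ ((1 : ℂ) + t * I) /
      ((1 + t * I) * (1 + t * I + 1))) = 2 * Real.pi * smoothSum χ s Y := by
  have hker := integrable_one_div_mul_add_one (c := 1) le_rfl
  simp only [ofReal_one] at hker
  set f : ℕ → ℝ → ℂ := fun m t => LSeries.term (χ ·) (s + (1 + t * I)) m *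
    ((Y : ℂ) ^ ((1 : ℂ) + t * I) / ((1 + t * I) * (1 + t * I + 1))) with hf
  have hnorm : ∀ m t, ‖f m t‖ ≤ Y * ((m : ℝ) ^ (s.re + 1))⁻¹ *
      ‖(1 : ℂ) / ((1 + t * I) * (1 + t * I + 1))‖ := by
    intro m t
    have h1 : ‖(Y : ℂ) ^ ((1 : ℂ) + t * I)‖ = Y := by
      rw [Complex.norm_cpow_eq_rpow_re_of_pos hY]; simp
    rw [hf, norm_mul, norm_div, h1, norm_div, norm_one, mul_one_div, mul_comm Y, mul_div_assoc]
    refine mul_le_mul_of_nonneg_right ?_ (by positivity)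
    rcases Nat.eq_zero_or_pos m with rfl | hm
    · simp; positivity
    · rw [LSeries.term_of_ne_zero hm.ne', norm_div, Complex.norm_natCast_cpow_of_pos hm]
      simp only [add_re, one_re, mul_re, ofReal_re, I_re, ofReal_im, I_im, mul_zero, mul_one,
        sub_self, add_zero]
      rw [div_eq_mul_inv]
      exact mul_le_of_le_one_left (by positivity) (DirichletCharacter.norm_le_one χ _)
  have hcont : ∀ m, Continuous (f m) := by
    intro m
    have hne : ∀ t : ℝ, ((1 : ℂ) + t * I) * (1 + t * I + 1) ≠ 0 := by
      intro t h
      have := congrArg norm h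
      rw [norm_zero] at this
      have h2 := le_norm_mul_add_one (w := 1 + t * I) (m := 1) (by norm_num) le_rfl
        (by simp) (by simp; norm_num)
      rw [this] at h2
      nlinarith [sq_nonneg ((1 : ℂ) + t * I).im]
    refine Continuous.mul ?_ (Continuous.div ?_ (by fun_prop) hne)
    · rcases Nat.eq_zero_or_pos m with rfl | hm
      · simpa using continuous_const
      · simp only [LSeries.term_of_ne_zero hm.ne']
        have hm0 : (m : ℂ) ≠ 0 := by exact_mod_cast hm.ne'
        refine Continuous.div continuous_const ?_ fun t => by simp [hm0]
        exact Continuous.const_cpow (by fun_prop) (Or.inl hm0)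
    · exact Continuous.const_cpow (by fun_prop) (Or.inl (by exact_mod_cast hY.ne'))
  have hint : ∀ m, Integrable (f m) := fun m =>
    Integrable.mono' (hker.norm.const_mul _) (hcont m).aestronglyMeasurable
      (Eventually.of_forall (hnorm m))
  have hsum : Summable fun m => ∫ t, ‖f m t‖ := by
    have h1 : Summable fun m : ℕ => Y * ((m : ℝ) ^ (s.re + 1))⁻¹ *
        ∫ t : ℝ, ‖(1 : ℂ) / ((1 + t * I) * (1 + t * I + 1))‖ :=
      ((Real.summable_nat_rpow_inv.mpr (by linarith)).mul_left Y).mul_right _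
    refine h1.of_nonneg_of_le (fun m => integral_nonneg fun t => norm_nonneg _) fun m => ?_
    rw [← integral_const_mul]
    exact integral_mono (hint m).norm (hker.norm.const_mul _) (hnorm m)
  have hval : ∀ m, ∫ t, f m t =
      2 * Real.pi * (χ m * (m : ℂ) ^ (-s) * ((max (1 - m / Y) 0 : ℝ) : ℂ)) := by
    intro m
    rcases Nat.eq_zero_or_pos m with rfl | hm
    · have : (0 : ℂ) ^ (-s) = 0 := Complex.zero_cpow (by
        intro h; rw [neg_eq_zero] at h; simp [h] at hs)
      simp [hf, this]
    have hm0 : (m : ℂ) ≠ 0 := by exact_mod_cast hm.ne'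
    have hm0' : (0 : ℝ) < m := by exact_mod_cast hm
    have h1 : ∀ t : ℝ, f m t = χ m * (m : ℂ) ^ (-s) *
        (((Y / m : ℝ) : ℂ) ^ ((((1 : ℝ) : ℂ)) + t * I) /
          ((((1 : ℝ) : ℂ) + t * I) * (((1 : ℝ) : ℂ) + t * I + 1))) := by
      intro t
      rw [hf]
      simp only [LSeries.term_of_ne_zero hm.ne', ofReal_one]
      rw [Complex.ofReal_div, Complex.div_cpow_ofReal_nonneg hY.le hm0'.le, Complex.cpow_add _ _ hm0,
        Complex.cpow_neg, ofReal_natCast]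
      field_simp
    simp_rw [h1]
    rw [integral_const_mul, integral_perron le_rfl (by positivity), one_div_div]
    ring
  have hHas := hasSum_integral_of_summable_integral_norm hint hsum
  have hL : ∀ t : ℝ, ∑' m, f m t = χ.LFunction (s + (1 + t * I)) *
      ((Y : ℂ) ^ ((1 : ℂ) + t * I) / ((1 + t * I) * (1 + t * I + 1))) := by
    intro t
    rw [hf, tsum_mul_right, DirichletCharacter.LFunction_eq_LSeries χ (by simp; linarith)]
    rfl
  simp_rw [hL, hval] at hHas
  refine hHas.unique ?_
  rw [smoothSum_eq_sum_max χ s hY le_rfl, Finset.mul_sum]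
  refine hasSum_sum_of_ne_finset_zero fun m hm => ?_
  rcases Nat.eq_zero_or_pos m with rfl | hm1
  · have : (0 : ℂ) ^ (-s) = 0 := Complex.zero_cpow (by
      intro h; rw [neg_eq_zero] at h; simp [h] at hs)
    simp [this]
  · have h2 : ⌊Y⌋₊ < m := by
      by_contra h
      exact hm (Finset.mem_Icc.mpr ⟨hm1, not_lt.mp h⟩)
    have : Y ≤ m := (Nat.lt_of_floor_lt h2).le
    rw [max_eq_right (sub_nonpos.mpr ((one_le_div hY).mpr this))]
    simp

/-- Under `GLH`, `∑ χ(m) m⁻ˢ (1 - m / Y)` over `m ≤ Y` approximates `L(s, χ)` with the error that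
comes from moving the line of integration to `Re (s + w) = 1 / 2`. -/
theorem GLH.norm_smoothSum_sub_le (hGLH : GLH) {ε : ℝ} (hε : 0 < ε) :
    ∃ C : ℝ, 0 < C ∧ ∀ (q : ℕ) [NeZero q] (χ : DirichletCharacter ℂ q), χ ≠ 1 → ∀ (s : ℂ) (Y : ℝ),
      3 / 4 ≤ s.re → s.re ≤ 1 → |s.im| ≤ 2 → 1 ≤ Y →
        ‖smoothSum χ s Y - χ.LFunction s‖ ≤ C * (q : ℝ) ^ ε * Y ^ (1 / 2 - s.re) := by
  -- exponent at most `1 / 2`: then `L(s + w, χ) / (w (w + 1))` is integrable on vertical lines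
  set ε' := min ε (1 / 2) with hε'
  have hε'0 : 0 < ε' := lt_min hε (by norm_num)
  have hε'1 : ε' ≤ 1 / 2 := min_le_right _ _
  obtain ⟨C₀, hC₀, hL⟩ := hGLH.norm_LFunction_le hε'0
  set A : ℝ := ∫ y : ℝ, (1 + y ^ 2) ^ (-(3 / 4) : ℝ) with hA
  have hA0 : 0 ≤ A := integral_nonneg fun y => by positivity
  refine ⟨192 * C₀ * A + 3 * C₀, by positivity, fun q _ χ hχ s Y hs1 hs2 hst hY => ?_⟩
  have hY0 : 0 < Y := by linarith
  have hq1 : (1 : ℝ) ≤ q := by exact_mod_cast NeZero.one_le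
  have hqε : (q : ℝ) ^ ε' ≤ (q : ℝ) ^ ε := Real.rpow_le_rpow_of_exponent_le hq1 (min_le_left _ _)
  set B : ℝ := 3 * C₀ * (q : ℝ) ^ ε with hB
  have hB0 : 0 < B := by positivity
  have hLw : ∀ w : ℂ, 1 / 2 - s.re ≤ w.re →
      ‖χ.LFunction (s + w)‖ ≤ B * (1 + |w.im|) ^ (1 / 2 : ℝ) := by
    intro w hw
    refine (hL q χ hχ (s + w) (by simp; linarith)).trans ?_
    have h1 : 1 + |(s + w).im| ≤ 3 * (1 + |w.im|) := by
      have := abs_add_le s.im w.im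
      rw [add_im]
      linarith [abs_nonneg w.im]
    have h3 : (3 : ℝ) ^ ε' ≤ 3 := by
      calc (3 : ℝ) ^ ε' ≤ 3 ^ (1 : ℝ) :=
            Real.rpow_le_rpow_of_exponent_le (by norm_num) (by linarith)
        _ = 3 := by norm_num
    calc C₀ * ((q : ℝ) * (1 + |(s + w).im|)) ^ ε'
        ≤ C₀ * ((q : ℝ) * (3 * (1 + |w.im|))) ^ ε' := by gcongr
      _ = C₀ * ((q : ℝ) ^ ε' * (3 ^ ε' * (1 + |w.im|) ^ ε')) := by
          rw [Real.mul_rpow (by positivity) (by positivity),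
            Real.mul_rpow (by positivity) (by positivity)]
      _ ≤ C₀ * ((q : ℝ) ^ ε * (3 * (1 + |w.im|) ^ (1 / 2 : ℝ))) := by
          gcongr
          linarith [abs_nonneg w.im]
      _ = _ := by rw [hB]; ring
  have hLs : ‖χ.LFunction s‖ ≤ B := by simpa using hLw 0 (by simp; linarith)
  -- subtracting `L(s, χ)` removes the pole at `w = 0`, so that the shift meets no residue
  set F : ℂ → ℂ := fun w => dslope χ.LFunction s (s + w) * ((Y : ℂ) ^ w / (w + 1)) with hF
  have hYc : (Y : ℂ) ≠ 0 := by exact_mod_cast hY0.ne'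
  have hFeq : ∀ w : ℂ, w ≠ 0 →
      F w = (χ.LFunction (s + w) - χ.LFunction s) * ((Y : ℂ) ^ w / (w * (w + 1))) := by
    intro w hw
    rw [hF]
    simp only
    rw [dslope_of_ne _ (by simpa using hw), slope_def_field, add_sub_cancel_left]
    field_simp
  have hdiffL : ∀ w : ℂ, 1 / 2 - s.re ≤ w.re →
      ‖χ.LFunction (s + w) - χ.LFunction s‖ ≤ 2 * B * (1 + |w.im|) ^ (1 / 2 : ℝ) := by
    intro w hw
    have h1 := (norm_sub_le _ _).trans (add_le_add (hLw w hw) hLs)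
    have h2 : 1 ≤ (1 + |w.im|) ^ (1 / 2 : ℝ) :=
      Real.one_le_rpow (by linarith [abs_nonneg w.im]) (by norm_num)
    nlinarith
  have hF1 : ∀ w : ℂ, 1 / 2 - s.re ≤ w.re → 1 / 4 ≤ |w.re| → 1 / 4 ≤ |w.re + 1| →
      ‖F w‖ ≤ 64 * B * Y ^ w.re * (1 + w.im ^ 2) ^ (-(3 / 4) : ℝ) := by
    intro w hw h1 h2
    have hw0 : w ≠ 0 := by rintro rfl; norm_num at h1
    have h3 := le_norm_mul_add_one (w := w) (m := 1 / 4) (by norm_num) (by norm_num) h1 h2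
    rw [hFeq w hw0, norm_mul, norm_div, Complex.norm_cpow_eq_rpow_re_of_pos hY0]
    have h4 := one_add_abs_sqrt_le w.im
    have h5 : (1 + w.im ^ 2) ^ (-(3 / 4) : ℝ) = (1 + w.im ^ 2) ^ (1 / 4 : ℝ) / (1 + w.im ^ 2) := by
      rw [eq_div_iff (by positivity)]
      nth_rewrite 2 [← Real.rpow_one (1 + w.im ^ 2)]
      rw [← Real.rpow_add (by positivity)]
      norm_num
    calc _ ≤ (2 * B * (2 * (1 + w.im ^ 2) ^ (1 / 4 : ℝ))) *
          (Y ^ w.re / ((1 / 4) ^ 2 * (1 + w.im ^ 2))) := by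
          gcongr
          exact (hdiffL w hw).trans (by gcongr)
      _ = _ := by
          rw [h5]
          field_simp
          norm_num
  have hFdiff : DifferentiableOn ℂ F {w | 1 / 2 - s.re ≤ w.re ∧ w.re ≤ 1} := by
    have hd : Differentiable ℂ (dslope χ.LFunction s) := by
      rw [← differentiableOn_univ, Complex.differentiableOn_dslope Filter.univ_mem]
      exact (DirichletCharacter.differentiable_LFunction hχ).differentiableOn
    intro w hw
    have hw1 : w + 1 ≠ 0 := fun h => by
      have h1 := congrArg Complex.re h
      simp only [add_re, one_re, zero_re] at h1
      have h2 : 1 / 2 - s.re ≤ w.re := hw.1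
      linarith
    refine DifferentiableAt.differentiableWithinAt ?_
    have h1 : DifferentiableAt ℂ (fun w => dslope χ.LFunction s (s + w)) w :=
      DifferentiableAt.comp w (hd _) (by fun_prop)
    refine h1.mul (DifferentiableAt.div ?_ (by fun_prop) hw1)
    exact DifferentiableAt.const_cpow differentiableAt_id (Or.inl hYc)
  have hcontline : ∀ a : ℝ, 1 / 2 - s.re ≤ a → a ≤ 1 → Continuous fun y : ℝ => F (a + y * I) := by
    intro a h1 h2
    refine ContinuousOn.comp_continuous hFdiff.continuousOn (by fun_prop) fun y => ?_
    simp only [Set.mem_ofPred_eq, add_re, ofReal_re, mul_re, I_re, ofReal_im, I_im, mul_zero,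
      mul_one, sub_self, add_zero]
    exact ⟨h1, h2⟩
  have hline : ∀ a : ℝ, 1 / 2 - s.re ≤ a → 1 / 4 ≤ |a| → 1 / 4 ≤ |a + 1| → ∀ y : ℝ,
      ‖F (a + y * I)‖ ≤ 64 * B * Y ^ a * (1 + y ^ 2) ^ (-(3 / 4) : ℝ) := by
    intro a h1 h2 h3 y
    simpa using hF1 (a + y * I) (by simpa using h1) (by simpa using h2) (by simpa using h3)
  have ha1 : (1 : ℝ) / 4 ≤ |1 / 2 - s.re| := by rw [abs_of_nonpos] <;> linarith
  have ha2 : (1 : ℝ) / 4 ≤ |1 / 2 - s.re + 1| := by rw [abs_of_nonneg] <;> linarith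
  have hinta : Integrable fun y : ℝ => F (((1 / 2 - s.re : ℝ) : ℂ) + y * I) :=
    Integrable.mono' (integrable_one_add_sq_rpow.const_mul _)
      (hcontline _ le_rfl (by linarith)).aestronglyMeasurable
      (Eventually.of_forall (hline _ le_rfl ha1 ha2))
  have hintb : Integrable fun y : ℝ => F (((1 : ℝ) : ℂ) + y * I) :=
    Integrable.mono' (integrable_one_add_sq_rpow.const_mul _)
      (hcontline 1 (by linarith) le_rfl).aestronglyMeasurable
      (Eventually.of_forall (hline 1 (by linarith) (by norm_num) (by norm_num)))
  have hshift := integral_vertical_eq_of_decay (F := F) (a := 1 / 2 - s.re) (b := 1)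
    (K := 4 * B * Y) (by linarith) hFdiff (by
      intro w h1 h2 h3
      have hw0 : w ≠ 0 := by rintro rfl; norm_num at h3
      have h0 : 0 < |w.im| := by linarith
      have h4 : |w.im| ^ 2 ≤ ‖w * (w + 1)‖ := by
        rw [norm_mul, sq]
        have h5 : |w.im| ≤ ‖w + 1‖ := by simpa using Complex.abs_im_le_norm (w + 1)
        exact mul_le_mul (Complex.abs_im_le_norm w) h5 (by positivity) (by positivity)
      have h5 : (1 + |w.im|) ^ (1 / 2 : ℝ) ≤ 2 * |w.im| := by
        calc (1 + |w.im|) ^ (1 / 2 : ℝ) ≤ (1 + |w.im|) ^ (1 : ℝ) :=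
              Real.rpow_le_rpow_of_exponent_le (by linarith) (by norm_num)
          _ ≤ _ := by rw [Real.rpow_one]; linarith
      have h6 : Y ^ w.re ≤ Y := by
        calc Y ^ w.re ≤ Y ^ (1 : ℝ) := Real.rpow_le_rpow_of_exponent_le hY h2
          _ = Y := Real.rpow_one Y
      rw [hFeq w hw0, norm_mul, norm_div, Complex.norm_cpow_eq_rpow_re_of_pos hY0]
      calc _ ≤ (2 * B * (2 * |w.im|)) * (Y / |w.im| ^ 2) := by
            gcongr
            exact (hdiffL w h1).trans (by gcongr)
        _ = _ := by field_simp; ring) hinta hintb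
  -- the right edge gives the smoothed sum, up to the term that comes from `L(s, χ)` itself
  have hright : ∫ y : ℝ, F (((1 : ℝ) : ℂ) + y * I) =
      2 * Real.pi * (smoothSum χ s Y - χ.LFunction s * ((1 - 1 / Y : ℝ) : ℂ)) := by
    have h1 := integral_LFunction_eq_smoothSum χ (s := s) (by linarith) hY0
    have h2 := integral_perron (c := 1) le_rfl hY0
    rw [max_eq_left (sub_nonneg.mpr ((div_le_one hY0).mpr hY))] at h2
    have hne : ∀ y : ℝ, (1 : ℂ) + y * I ≠ 0 := fun y h => by
      have := congrArg Complex.re h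
      simp at this
    have hi2 : Integrable fun y : ℝ => χ.LFunction s * ((Y : ℂ) ^ (((1 : ℝ) : ℂ) + y * I) /
        ((((1 : ℝ) : ℂ) + y * I) * (((1 : ℝ) : ℂ) + y * I + 1))) := by
      refine Integrable.const_mul ?_ _
      refine Integrable.mono' ((integrable_one_div_mul_add_one (c := 1) le_rfl).norm.const_mul Y)
        ?_ (Eventually.of_forall fun y => ?_)
      · have hc := (integrable_one_div_mul_add_one (c := 1) le_rfl).aestronglyMeasurable
        have hc2 : Continuous fun y : ℝ => (Y : ℂ) ^ (((1 : ℝ) : ℂ) + y * I) :=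
          Continuous.const_cpow (by fun_prop) (Or.inl hYc)
        refine (hc2.aestronglyMeasurable.mul hc).congr (Eventually.of_forall fun y => ?_)
        exact mul_one_div _ _
      · rw [norm_div, Complex.norm_cpow_eq_rpow_re_of_pos hY0, norm_div, norm_one, mul_one_div]
        simp
    have h3 : ∀ y : ℝ, F (((1 : ℝ) : ℂ) + y * I) + χ.LFunction s *
        ((Y : ℂ) ^ (((1 : ℝ) : ℂ) + y * I) /
        ((((1 : ℝ) : ℂ) + y * I) * (((1 : ℝ) : ℂ) + y * I + 1))) =
        χ.LFunction (s + (1 + y * I)) * ((Y : ℂ) ^ ((1 : ℂ) + y * I) /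
          ((1 + y * I) * (1 + y * I + 1))) := by
      intro y
      rw [ofReal_one, hFeq _ (hne y)]
      ring
    have h4 := integral_add hintb hi2
    simp only [h3] at h4
    rw [h1, integral_const_mul, h2] at h4
    rw [mul_sub]
    linear_combination -h4
  have hleft : ‖∫ y : ℝ, F (((1 / 2 - s.re : ℝ) : ℂ) + y * I)‖ ≤
      64 * B * Y ^ (1 / 2 - s.re) * A := by
    rw [hA, ← integral_const_mul]
    exact norm_integral_le_of_norm_le (integrable_one_add_sq_rpow.const_mul _)
      (Eventually.of_forall (hline _ le_rfl ha1 ha2))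
  rw [hshift, hright, norm_mul] at hleft
  have hpi : (1 : ℝ) ≤ ‖(2 * Real.pi : ℂ)‖ := by
    rw [norm_mul, Complex.norm_real, Real.norm_of_nonneg Real.pi_pos.le]
    simp
    linarith [Real.pi_gt_three]
  have h1 : ‖smoothSum χ s Y - χ.LFunction s * ((1 - 1 / Y : ℝ) : ℂ)‖ ≤
      64 * B * Y ^ (1 / 2 - s.re) * A :=
    (le_mul_of_one_le_left (norm_nonneg _) hpi).trans hleft
  have h2 : smoothSum χ s Y - χ.LFunction s =
      (smoothSum χ s Y - χ.LFunction s * ((1 - 1 / Y : ℝ) : ℂ)) -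
        χ.LFunction s * ((1 / Y : ℝ) : ℂ) := by push_cast; ring
  have h3 : ‖((1 / Y : ℝ) : ℂ)‖ ≤ Y ^ (1 / 2 - s.re) := by
    rw [Complex.norm_real, Real.norm_of_nonneg (by positivity), one_div, ← Real.rpow_neg_one]
    exact Real.rpow_le_rpow_of_exponent_le hY (by linarith)
  calc _ ≤ 64 * B * Y ^ (1 / 2 - s.re) * A + B * Y ^ (1 / 2 - s.re) := by
        rw [h2]
        refine (norm_sub_le _ _).trans (add_le_add h1 ?_)
        rw [norm_mul]
        exact mul_le_mul hLs h3 (norm_nonneg _) hB0.le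
    _ = _ := by rw [hB]; ring

end Contour

/-! ### Bounds for the zeta function near `1` -/

section ZetaNearOne
open Complex Filter Topology

/-- The entire function `(s - 1) ζ(s)`. -/
noncomputable def zetaNoPole : ℂ → ℂ := DirichletCharacter.LFunctionTrivChar₁ 1

lemma continuous_zetaNoPole : Continuous zetaNoPole :=
  (DirichletCharacter.differentiable_LFunctionTrivChar₁ 1).continuous

lemma zetaNoPole_one : zetaNoPole 1 = 1 := by
  simp [zetaNoPole, DirichletCharacter.LFunctionTrivChar₁]

lemma zetaNoPole_of_ne_one {s : ℂ} (hs : s ≠ 1) : zetaNoPole s = (s - 1) * riemannZeta s := by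
  rw [zetaNoPole, DirichletCharacter.LFunctionTrivChar₁, Function.update_of_ne hs,
    DirichletCharacter.LFunctionTrivChar, DirichletCharacter.LFunction_modOne_eq]

lemma zetaNoPole_ne_zero {s : ℂ} (hs : 1 ≤ s.re) : zetaNoPole s ≠ 0 := by
  by_cases h : s = 1
  · simp [h, zetaNoPole_one]
  · rw [zetaNoPole_of_ne_one h]
    exact mul_ne_zero (sub_ne_zero.mpr h) (riemannZeta_ne_zero_of_one_le_re hs)

/-- On the line `Re s = 1 + 1 / L` both `ζ` and `1 / ζ` are bounded by the sum `∑ n ^ (-1 - 1 / L)`,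
which is `O(L)`. -/
lemma exists_norm_riemannZeta_le : ∃ C : ℝ, 0 < C ∧ ∀ L : ℝ, 1 ≤ L → ∀ s : ℂ, s.re = 1 + 1 / L →
    ‖riemannZeta s‖ ≤ C * L ∧ ‖riemannZeta s‖⁻¹ ≤ C * L := by
  obtain ⟨C, hC⟩ := (isCompact_Icc (a := (1 : ℝ)) (b := 2)).exists_bound_of_continuousOn
    (f := fun x : ℝ => zetaNoPole x) (continuous_zetaNoPole.comp continuous_ofReal).continuousOn
  refine ⟨max C 1, by positivity, fun L hL s hs => ?_⟩
  have hL0 : 0 < L := by linarith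
  set σ : ℝ := 1 + 1 / L with hσ
  have hσ1 : 1 < σ := by rw [hσ]; have : 0 < 1 / L := by positivity
                         linarith
  have hσ2 : σ ≤ 2 := by rw [hσ]; have : 1 / L ≤ 1 := (div_le_one hL0).mpr hL
                         linarith
  have hsum : Summable fun n : ℕ => 1 / (n : ℝ) ^ σ := Real.summable_one_div_nat_rpow.mpr hσ1
  have hS : ∑' n : ℕ, 1 / (n : ℝ) ^ σ ≤ max C 1 * L := by
    have h1 := hC σ ⟨hσ1.le, hσ2⟩
    rw [zetaNoPole_of_ne_one (by exact_mod_cast hσ1.ne'),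
      zeta_eq_tsum_one_div_nat_cpow (by simpa using hσ1)] at h1
    have h2 : ∑' n : ℕ, 1 / (n : ℂ) ^ (σ : ℂ) = ((∑' n : ℕ, 1 / (n : ℝ) ^ σ : ℝ) : ℂ) := by
      rw [ofReal_tsum]
      refine tsum_congr fun n => ?_
      rw [ofReal_div, ofReal_one, ofReal_cpow (Nat.cast_nonneg n), ofReal_natCast]
    rw [h2, ← ofReal_one, ← ofReal_sub, ← ofReal_mul, norm_real, Real.norm_eq_abs,
      show σ - 1 = 1 / L by rw [hσ]; ring] at h1
    have h3 := (le_abs_self _).trans h1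
    rw [one_div_mul_eq_div, div_le_iff₀ hL0] at h3
    exact h3.trans (by gcongr; exact le_max_left _ _)
  have hsre : 1 < s.re := by rw [hs]; exact hσ1
  have hterm : ∀ n : ℕ, ‖1 / (n : ℂ) ^ s‖ = 1 / (n : ℝ) ^ σ := by
    intro n
    rcases Nat.eq_zero_or_pos n with rfl | hn
    · have : s ≠ 0 := fun h => by simp [h] at hsre; linarith
      simp [this, Real.zero_rpow (by linarith : σ ≠ 0)]
    · rw [norm_div, norm_one, norm_natCast_cpow_of_pos hn, hs]
  constructor
  · rw [zeta_eq_tsum_one_div_nat_cpow hsre]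
    refine (norm_tsum_le_tsum_norm ?_).trans ?_
    · simpa only [hterm] using hsum
    · simpa only [hterm] using hS
  · have h1 := ArithmeticFunction.LSeries_zeta_mul_Lseries_moebius hsre
    rw [ArithmeticFunction.LSeries_zeta_eq_riemannZeta hsre] at h1
    have h2 : ‖riemannZeta s‖⁻¹ = ‖LSeries (fun n => (ArithmeticFunction.moebius n : ℂ)) s‖ := by
      rw [← norm_inv, inv_eq_of_mul_eq_one_right h1]
    rw [h2, LSeries]
    have hle : ∀ n, ‖LSeries.term (fun n => (ArithmeticFunction.moebius n : ℂ)) s n‖ ≤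
        1 / (n : ℝ) ^ σ := by
      intro n
      rcases Nat.eq_zero_or_pos n with rfl | hn
      · simp; positivity
      · rw [LSeries.term_of_ne_zero hn.ne', norm_div, norm_natCast_cpow_of_pos hn, hs]
        gcongr
        rw [norm_intCast]
        exact_mod_cast ArithmeticFunction.abs_moebius_le_one
    have hsum' : Summable fun n => ‖LSeries.term (fun n => (ArithmeticFunction.moebius n : ℂ)) s n‖ :=
      hsum.of_nonneg_of_le (fun _ => norm_nonneg _) hle
    exact (norm_tsum_le_tsum_norm hsum').trans ((hsum'.tsum_le_tsum hle hsum).trans hS)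

/-- For `|y| ≤ L` the pole of `ζ` at `1` makes `1 / ζ` small; for `|y| > L` the trivial bound suffices. -/
lemma exists_norm_riemannZeta_inv_le : ∃ C : ℝ, 0 < C ∧ ∀ L : ℝ, 1 ≤ L → ∀ y : ℝ,
    ‖riemannZeta (1 + (1 + y * I) / L)‖⁻¹ ≤ C * (1 + y ^ 2) / L := by
  obtain ⟨C, hC, hb⟩ := exists_norm_riemannZeta_le
  have hK : IsCompact (Set.Icc (1 : ℝ) 2 ×ℂ Set.Icc (-1 : ℝ) 1) :=
    isCompact_Icc.reProdIm isCompact_Icc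
  obtain ⟨D, hD⟩ := hK.exists_bound_of_continuousOn (f := fun s => (zetaNoPole s)⁻¹)
    (continuous_zetaNoPole.continuousOn.inv₀ fun s hs => zetaNoPole_ne_zero hs.1.1)
  refine ⟨max C D, lt_of_lt_of_le hC (le_max_left _ _), fun L hL y => ?_⟩
  have hL0 : 0 < L := by linarith
  have hre : (1 + (1 + y * I) / (L : ℂ)).re = 1 + 1 / L := by
    simp [Complex.div_ofReal_re]
  have him : (1 + (1 + y * I) / (L : ℂ)).im = y / L := by
    simp [Complex.div_ofReal_im]
  rw [le_div_iff₀ hL0]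
  by_cases hy : |y| ≤ L
  · have hmem : 1 + (1 + y * I) / (L : ℂ) ∈ Set.Icc (1 : ℝ) 2 ×ℂ Set.Icc (-1 : ℝ) 1 := by
      have h1 : 1 / L ≤ 1 := (div_le_one hL0).mpr hL
      have h2 : 0 < 1 / L := by positivity
      refine ⟨⟨?_, ?_⟩, ?_⟩
      · rw [hre]; linarith
      · rw [hre]; linarith
      · show (1 + (1 + y * I) / (L : ℂ)).im ∈ Set.Icc (-1 : ℝ) 1
        rw [him]
        have h3 : |y / L| ≤ 1 := by
          rw [abs_div, abs_of_pos hL0]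
          exact (div_le_one hL0).mpr hy
        exact abs_le.mp h3
    have h1 := hD _ hmem
    have hw0 : (1 + y * I : ℂ) ≠ 0 := fun h => by
      have := congrArg Complex.re h; simp at this
    have hLc : (L : ℂ) ≠ 0 := by exact_mod_cast hL0.ne'
    have hne : 1 + (1 + y * I) / (L : ℂ) ≠ 1 := by
      intro h
      rw [add_eq_left] at h
      exact (div_ne_zero hw0 hLc) h
    rw [zetaNoPole_of_ne_one hne, add_sub_cancel_left, norm_inv, norm_mul, norm_div, norm_real,
      Real.norm_of_nonneg hL0.le, mul_inv, inv_div] at h1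
    have hw : ‖(1 + y * I : ℂ)‖ ≤ 1 + y ^ 2 := by
      have h2 : ‖(1 + y * I : ℂ)‖ ^ 2 = 1 + y ^ 2 := by
        rw [← normSq_eq_norm_sq, normSq_apply]; simp; ring
      nlinarith [norm_nonneg (1 + y * I : ℂ), sq_nonneg y]
    have hwpos : 0 < ‖(1 + y * I : ℂ)‖ := norm_pos_iff.mpr hw0
    rw [div_mul_eq_mul_div, div_le_iff₀ hwpos] at h1
    have hD0 : 0 ≤ max C D := hC.le.trans (le_max_left _ _)
    calc _ = L * ‖riemannZeta (1 + (1 + y * I) / L)‖⁻¹ := mul_comm _ _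
      _ ≤ D * ‖(1 + y * I : ℂ)‖ := h1
      _ ≤ max C D * (1 + y ^ 2) := mul_le_mul (le_max_right _ _) hw (norm_nonneg _) hD0
  · have h1 := (hb L hL _ hre).2
    push Not at hy
    have h2 : L * L ≤ y ^ 2 := by
      rw [← sq_abs y]; nlinarith
    calc _ ≤ C * L * L := by gcongr
      _ ≤ max C D * (1 + y ^ 2) := by
        rw [mul_assoc]
        exact mul_le_mul (le_max_left _ _) (by linarith) (by positivity)
          (hC.le.trans (le_max_left _ _))

end ZetaNearOne

/-! ### A Dirichlet series with two Möbius twists -/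

section EulerProducts
open Complex Filter Topology

/-- The divisor sum `∑_{d ∣ n} μ(d) d ^ (-iu)`. -/
noncomputable def twistedMoebiusSum (u : ℝ) (n : ℕ) : ℂ :=
  ∑ d ∈ n.divisors, (ArithmeticFunction.moebius d : ℂ) * (d : ℂ) ^ (-(u * I))

lemma norm_natCast_cpow_neg_mul_I_le (u : ℝ) (d : ℕ) : ‖(d : ℂ) ^ (-(u * I))‖ ≤ 1 := by
  rcases Nat.eq_zero_or_pos d with rfl | hd
  · by_cases hu : u = 0
    · simp [hu]
    · simp [hu, Complex.zero_cpow]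
  · rw [norm_natCast_cpow_of_pos hd]; simp

lemma norm_twistedMoebiusSum_le (u : ℝ) (n : ℕ) :
    ‖twistedMoebiusSum u n‖ ≤ 2 ^ #n.primeFactors := by
  refine (norm_sum_le _ _).trans ((Finset.sum_le_sum fun d _ => ?_).trans (sum_abs_moebius_le n))
  rw [norm_mul, norm_intCast]
  exact mul_le_of_le_one_right (abs_nonneg _) (norm_natCast_cpow_neg_mul_I_le u d)

lemma twistedMoebiusSum_one (u : ℝ) : twistedMoebiusSum u 1 = 1 := by
  simp [twistedMoebiusSum]

lemma twistedMoebiusSum_mul (u : ℝ) {m n : ℕ} (h : m.Coprime n) :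
    twistedMoebiusSum u (m * n) = twistedMoebiusSum u m * twistedMoebiusSum u n := by
  let F : ArithmeticFunction ℂ :=
    ⟨fun d => (ArithmeticFunction.moebius d : ℂ) * (d : ℂ) ^ (-(u * I)), by simp⟩
  have hF : F.IsMultiplicative := by
    refine ⟨by simp [F], fun {a b} hab => ?_⟩
    simp only [F, ArithmeticFunction.coe_mk]
    rw [ArithmeticFunction.isMultiplicative_moebius.map_mul_of_coprime hab, Nat.cast_mul,
      natCast_mul_natCast_cpow]
    push_cast
    ring
  have hFz := hF.mul (ArithmeticFunction.isMultiplicative_zeta.natCast (R := ℂ))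
  have heq : ∀ k, twistedMoebiusSum u k = (F * (ArithmeticFunction.zeta : ArithmeticFunction ℂ)) k := by
    intro k
    rw [ArithmeticFunction.coe_mul_zeta_apply]
    rfl
  rw [heq, heq, heq, hFz.map_mul_of_coprime h]

lemma twistedMoebiusSum_prime_pow (u : ℝ) {p : ℕ} (hp : p.Prime) (e : ℕ) :
    twistedMoebiusSum u (p ^ (e + 1)) = 1 - (p : ℂ) ^ (-(u * I)) := by
  rw [twistedMoebiusSum, Nat.sum_divisors_prime_pow hp, Finset.sum_range_succ',
    Finset.sum_range_succ', Finset.sum_eq_zero]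
  · simp [ArithmeticFunction.moebius_apply_prime hp]
    ring
  · intro k _
    rw [ArithmeticFunction.moebius_apply_prime_pow hp (by omega), if_neg (by omega)]
    simp

/-- The Dirichlet series of the product of two such divisor sums. -/
noncomputable def twistedSeries (s : ℂ) (u v : ℝ) : ℂ :=
  ∑' n : ℕ, (n : ℂ) ^ (-s) * (twistedMoebiusSum u n * twistedMoebiusSum v n)

lemma summable_rpow_mul_four_pow {σ : ℝ} (hσ : 1 < σ) :
    Summable fun n : ℕ => (n : ℝ) ^ (-σ) * ((2 : ℝ) ^ #n.primeFactors * 2 ^ #n.primeFactors) := by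
  obtain ⟨C, hC, h⟩ := exists_two_pow_card_primeFactors_le (ε := (σ - 1) / 4) (by linarith)
  have h1 : Summable fun n : ℕ => C ^ 2 * (n : ℝ) ^ (-((σ + 1) / 2)) :=
    (Real.summable_nat_rpow.mpr (by linarith)).mul_left _
  refine h1.of_nonneg_of_le (fun n => by positivity) fun n => ?_
  rcases Nat.eq_zero_or_pos n with rfl | hn
  · rw [Nat.cast_zero, Real.zero_rpow (by linarith), Real.zero_rpow (by linarith)]; simp
  · have hn0 : (0 : ℝ) < n := by exact_mod_cast hn
    calc _ ≤ (n : ℝ) ^ (-σ) * (C * (n : ℝ) ^ ((σ - 1) / 4) * (C * (n : ℝ) ^ ((σ - 1) / 4))) := by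
          gcongr <;> exact h n hn.ne'
      _ = C ^ 2 * ((n : ℝ) ^ (-σ) * (n : ℝ) ^ ((σ - 1) / 4) * (n : ℝ) ^ ((σ - 1) / 4)) := by ring
      _ = _ := by
          rw [← Real.rpow_add hn0, ← Real.rpow_add hn0]
          congr 2
          ring

lemma norm_twistedSeries_term_le {s : ℂ} (hs : 1 < s.re) (u v : ℝ) (n : ℕ) :
    ‖(n : ℂ) ^ (-s) * (twistedMoebiusSum u n * twistedMoebiusSum v n)‖ ≤
      (n : ℝ) ^ (-s.re) * ((2 : ℝ) ^ #n.primeFactors * 2 ^ #n.primeFactors) := by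
  rcases Nat.eq_zero_or_pos n with rfl | hn
  · have : s ≠ 0 := fun h => by simp [h] at hs; linarith
    simp [twistedMoebiusSum]
    positivity
  · rw [norm_mul, norm_mul, norm_natCast_cpow_of_pos hn, neg_re]
    gcongr <;> exact norm_twistedMoebiusSum_le _ n

lemma hasProd_twistedSeries {s : ℂ} (hs : 1 < s.re) (u v : ℝ) :
    HasProd (fun p : Nat.Primes => 1 + (1 - (p : ℂ) ^ (-(u * I))) * (1 - (p : ℂ) ^ (-(v * I))) *
      ((p : ℂ) ^ (-s) / (1 - (p : ℂ) ^ (-s)))) (twistedSeries s u v) := by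
  have hs0 : s ≠ 0 := fun h => by simp [h] at hs; linarith
  set f : ℕ → ℂ := fun n => (n : ℂ) ^ (-s) * (twistedMoebiusSum u n * twistedMoebiusSum v n) with hf
  have hsum : Summable (‖f ·‖) := (summable_rpow_mul_four_pow hs).of_nonneg_of_le
    (fun _ => norm_nonneg _) (norm_twistedSeries_term_le hs u v)
  have h := EulerProduct.eulerProduct_hasProd (f := f)
    (by simp [hf, twistedMoebiusSum_one])
    (by
      intro m n hmn
      simp only [hf]
      rw [twistedMoebiusSum_mul u hmn, twistedMoebiusSum_mul v hmn, Nat.cast_mul,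
        natCast_mul_natCast_cpow]
      ring) hsum (by simp [hf, hs0])
  change HasProd _ (∑' n, f n)
  convert h using 1
  funext p
  set x : ℂ := (p : ℂ) ^ (-s) with hx
  have hpp := p.2
  have hx1 : ‖x‖ < 1 := by
    rw [hx, norm_natCast_cpow_of_pos hpp.pos, neg_re]
    exact Real.rpow_lt_one_of_one_lt_of_neg (by exact_mod_cast hpp.one_lt) (by linarith)
  have hpow : ∀ e : ℕ, ((((p : ℕ) ^ e : ℕ) : ℂ)) ^ (-s) = x ^ e := by
    intro e
    induction e with
    | zero => simp
    | succ e ih => rw [pow_succ, Nat.cast_mul, natCast_mul_natCast_cpow, ih, pow_succ]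
  have hsump : Summable fun e : ℕ => f ((p : ℕ) ^ e) :=
    Summable.of_norm (hsum.comp_injective (Nat.pow_right_injective hpp.one_lt))
  rw [hsump.tsum_eq_zero_add]
  have h1 : ∀ e : ℕ, f ((p : ℕ) ^ (e + 1)) =
      (x * ((1 - (p : ℂ) ^ (-(u * I))) * (1 - (p : ℂ) ^ (-(v * I))))) * x ^ e := by
    intro e
    simp only [hf]
    rw [hpow, twistedMoebiusSum_prime_pow u hpp, twistedMoebiusSum_prime_pow v hpp]
    ring
  simp_rw [h1]
  rw [tsum_mul_left, tsum_geometric_of_norm_lt_one hx1]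
  simp [hf, twistedMoebiusSum_one]
  ring

/-- The factor at `p` by which the Euler product of `twistedSeries` differs from that of the
corresponding quotient of zeta values. -/
noncomputable def eulerCorrection (s : ℂ) (u v : ℝ) (p : ℕ) : ℂ :=
  -(((p : ℂ) ^ (-s)) ^ 2 * (p : ℂ) ^ (-(u * I)) * (p : ℂ) ^ (-(v * I)) *
    (1 - (p : ℂ) ^ (-(u * I))) * (1 - (p : ℂ) ^ (-(v * I)))) /
    ((1 - (p : ℂ) ^ (-(u * I)) * (p : ℂ) ^ (-s)) * (1 - (p : ℂ) ^ (-(v * I)) * (p : ℂ) ^ (-s)))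

lemma norm_natCast_cpow_neg_le_inv {s : ℂ} (hs : 1 ≤ s.re) {p : ℕ} (hp : p.Prime) :
    ‖(p : ℂ) ^ (-s)‖ ≤ (p : ℝ)⁻¹ := by
  rw [norm_natCast_cpow_of_pos hp.pos, neg_re, ← Real.rpow_neg_one]
  exact Real.rpow_le_rpow_of_exponent_le (by exact_mod_cast hp.one_lt.le) (by linarith)

lemma half_le_norm_one_sub_cpow_mul {s : ℂ} (hs : 1 ≤ s.re) (u : ℝ) {p : ℕ} (hp : p.Prime) :
    1 / 2 ≤ ‖1 - (p : ℂ) ^ (-(u * I)) * (p : ℂ) ^ (-s)‖ := by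
  have h1 : ‖(p : ℂ) ^ (-(u * I)) * (p : ℂ) ^ (-s)‖ ≤ 1 / 2 := by
    rw [norm_mul]
    have h2 : (p : ℝ)⁻¹ ≤ 1 / 2 := by
      rw [one_div]
      exact inv_anti₀ (by norm_num) (by exact_mod_cast hp.two_le)
    calc _ ≤ 1 * (p : ℝ)⁻¹ := mul_le_mul (norm_natCast_cpow_neg_mul_I_le u p)
          (norm_natCast_cpow_neg_le_inv hs hp) (norm_nonneg _) zero_le_one
      _ ≤ _ := by linarith
  have h2 := norm_sub_norm_le (1 : ℂ) ((p : ℂ) ^ (-(u * I)) * (p : ℂ) ^ (-s))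
  rw [norm_one] at h2
  linarith

lemma norm_eulerCorrection_le {s : ℂ} (hs : 1 ≤ s.re) (u v : ℝ) {p : ℕ} (hp : p.Prime) :
    ‖eulerCorrection s u v p‖ ≤ 16 * ((p : ℝ) ^ 2)⁻¹ := by
  have hsub : ∀ u : ℝ, ‖1 - (p : ℂ) ^ (-(u * I))‖ ≤ 2 := fun u => by
    refine (norm_sub_le _ _).trans ?_
    rw [norm_one]
    linarith [norm_natCast_cpow_neg_mul_I_le u p]
  rw [eulerCorrection, norm_div, norm_neg, norm_mul, norm_mul, norm_mul, norm_mul, norm_mul,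
    norm_pow]
  calc _ ≤ ((p : ℝ)⁻¹ ^ 2 * 1 * 1 * 2 * 2) / ((1 / 2) * (1 / 2)) := by
        gcongr
        · exact norm_natCast_cpow_neg_le_inv hs hp
        · exact norm_natCast_cpow_neg_mul_I_le u p
        · exact norm_natCast_cpow_neg_mul_I_le v p
        · exact hsub u
        · exact hsub v
        · exact half_le_norm_one_sub_cpow_mul hs u hp
        · exact half_le_norm_one_sub_cpow_mul hs v hp
    _ = _ := by rw [inv_pow]; ring

lemma summable_primes_sq_inv : Summable fun p : Nat.Primes => 16 * (((p : ℕ) : ℝ) ^ 2)⁻¹ :=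
  ((Real.summable_nat_pow_inv.mpr (by norm_num : 1 < 2)).comp_injective
    Subtype.val_injective).mul_left 16

lemma multipliable_one_add_eulerCorrection {s : ℂ} (hs : 1 ≤ s.re) (u v : ℝ) :
    Multipliable fun p : Nat.Primes => 1 + eulerCorrection s u v p :=
  multipliable_one_add_of_summable (summable_primes_sq_inv.of_nonneg_of_le
    (fun _ => norm_nonneg _) fun p => norm_eulerCorrection_le hs u v p.2)

/-- Comparison of Euler products: the factors of both sides at `p` agree to first order in `p ^ (-s)`, and
`eulerCorrection` is `O(p ^ (-2))`. -/
theorem twistedSeries_mul_zeta_mul_zeta {s : ℂ} (hs : 1 < s.re) (u v : ℝ) :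
    twistedSeries s u v * (riemannZeta (s + u * I) * riemannZeta (s + v * I)) =
      riemannZeta s * riemannZeta (s + (u * I + v * I)) *
        ∏' p : Nat.Primes, (1 + eulerCorrection s u v p) := by
  have hz : ∀ w : ℂ, w.re = 0 → HasProd (fun p : Nat.Primes => (1 - (p : ℂ) ^ (-(s + w)))⁻¹)
      (riemannZeta (s + w)) := fun w hw => riemannZeta_eulerProduct_hasProd (by simp [hw, hs])
  have h1 := (hasProd_twistedSeries hs u v).mul ((hz (u * I) (by simp)).mul (hz (v * I) (by simp)))
  have h2 := ((riemannZeta_eulerProduct_hasProd hs).mul (hz (u * I + v * I) (by simp))).mul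
    (multipliable_one_add_eulerCorrection hs.le u v).hasProd
  refine h1.unique ?_
  convert h2 using 1
  funext p
  have hp0 : ((p : ℕ) : ℂ) ≠ 0 := by exact_mod_cast p.2.ne_zero
  have hcp : ∀ w : ℂ, (p : ℂ) ^ (-(s + w)) = (p : ℂ) ^ (-w) * (p : ℂ) ^ (-s) := by
    intro w
    rw [← cpow_add _ _ hp0]
    ring_nf
  rw [hcp, hcp, hcp, neg_add (↑u * I), cpow_add _ _ hp0, eulerCorrection]
  have hne : ∀ u : ℝ, 1 - (p : ℂ) ^ (-(u * I)) * (p : ℂ) ^ (-s) ≠ 0 := fun u h => by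
    have := half_le_norm_one_sub_cpow_mul hs.le u p.2
    rw [h, norm_zero] at this
    norm_num at this
  have n1 := hne u
  have n2 := hne v
  have n3 := hne 0
  have n4 := hne (u + v)
  rw [ofReal_add, add_mul, neg_add, cpow_add _ _ hp0] at n4
  simp only [ofReal_zero, zero_mul, neg_zero, cpow_zero, one_mul] at n3
  generalize (p : ℂ) ^ (-(u * I)) = α at *
  generalize (p : ℂ) ^ (-(v * I)) = β at *
  generalize (p : ℂ) ^ (-s) = x at *
  field_simp
  ring

lemma norm_tprod_eulerCorrection_le {s : ℂ} (hs : 1 ≤ s.re) (u v : ℝ) :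
    ‖∏' p : Nat.Primes, (1 + eulerCorrection s u v p)‖ ≤
      Real.exp (∑' p : Nat.Primes, 16 * (((p : ℕ) : ℝ) ^ 2)⁻¹) := by
  have h := (multipliable_one_add_eulerCorrection hs u v).hasProd
  refine le_of_tendsto h.norm (Eventually.of_forall fun A => ?_)
  calc _ = ‖∏ p ∈ A, (1 + eulerCorrection s u v p)‖ := (norm_prod _ _).symm
    _ ≤ ∏ p ∈ A, Real.exp (16 * (((p : ℕ) : ℝ) ^ 2)⁻¹) := by
        rw [norm_prod]
        refine Finset.prod_le_prod (fun _ _ => norm_nonneg _) fun p _ => ?_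
        have h1 := norm_eulerCorrection_le hs u v p.2
        have h2 := Real.add_one_le_exp (16 * (((p : ℕ) : ℝ) ^ 2)⁻¹)
        have h3 := norm_add_le (1 : ℂ) (eulerCorrection s u v p)
        rw [norm_one] at h3
        linarith
    _ = Real.exp (∑ p ∈ A, 16 * (((p : ℕ) : ℝ) ^ 2)⁻¹) := (Real.exp_sum _ _).symm
    _ ≤ _ := Real.exp_le_exp.mpr (summable_primes_sq_inv.sum_le_tsum A fun _ _ => by positivity)

/-- The point `1 + (1 + iy) / L`, which tends to `1` through the half-plane of convergence. -/
noncomputable def nearOne (L y : ℝ) : ℂ := 1 + (1 + y * I) / L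

lemma nearOne_re (L y : ℝ) : (nearOne L y).re = 1 + 1 / L := by
  simp [nearOne, Complex.div_ofReal_re]

lemma nearOne_add (L y z : ℝ) : nearOne L y + ((z / L : ℝ) : ℂ) * I = nearOne L (y + z) := by
  simp only [nearOne]
  push_cast
  ring

lemma one_lt_nearOne_re {L : ℝ} (hL : 0 < L) (y : ℝ) : 1 < (nearOne L y).re := by
  rw [nearOne_re]
  have : 0 < 1 / L := by positivity
  linarith

lemma twistedSeries_nearOne {L : ℝ} (hL : 0 < L) (ξ z z' : ℝ) :
    twistedSeries (nearOne L ξ) (z / L) (z' / L) =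
      riemannZeta (nearOne L ξ) * riemannZeta (nearOne L (ξ + z + z')) *
        (riemannZeta (nearOne L (ξ + z)))⁻¹ * (riemannZeta (nearOne L (ξ + z')))⁻¹ *
        ∏' p : Nat.Primes, (1 + eulerCorrection (nearOne L ξ) (z / L) (z' / L) p) := by
  have h := twistedSeries_mul_zeta_mul_zeta (one_lt_nearOne_re hL ξ) (z / L) (z' / L)
  rw [← add_assoc, nearOne_add, nearOne_add, nearOne_add] at h
  have h1 := riemannZeta_ne_zero_of_one_le_re (one_lt_nearOne_re hL (ξ + z)).le
  have h2 := riemannZeta_ne_zero_of_one_le_re (one_lt_nearOne_re hL (ξ + z')).le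
  field_simp
  linear_combination h

/-- A bound uniform in `L`: the two factors `L` from `ζ` cancel against those from `1 / ζ`. -/
lemma exists_norm_twistedSeries_le : ∃ C : ℝ, 0 < C ∧ ∀ L : ℝ, 1 ≤ L → ∀ ξ z z' : ℝ,
    ‖twistedSeries (nearOne L ξ) (z / L) (z' / L)‖ ≤
      C * ((1 + ξ ^ 2) ^ 2 * (1 + z ^ 2) * (1 + z' ^ 2)) := by
  obtain ⟨C₁, hC₁, h1⟩ := exists_norm_riemannZeta_le
  obtain ⟨C₂, hC₂, h2⟩ := exists_norm_riemannZeta_inv_le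
  set M := Real.exp (∑' p : Nat.Primes, 16 * (((p : ℕ) : ℝ) ^ 2)⁻¹) with hM
  refine ⟨4 * (C₁ ^ 2 * C₂ ^ 2 * M), by positivity, fun L hL ξ z z' => ?_⟩
  have hL0 : 0 < L := by linarith
  rw [twistedSeries_nearOne hL0, norm_mul, norm_mul, norm_mul, norm_mul, norm_inv, norm_inv]
  have hsq : ∀ z : ℝ, 1 + (ξ + z) ^ 2 ≤ 2 * ((1 + ξ ^ 2) * (1 + z ^ 2)) := fun z => by
    nlinarith [sq_nonneg (ξ - z), sq_nonneg (ξ * z)]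
  calc _ ≤ (C₁ * L) * (C₁ * L) * (C₂ * (1 + (ξ + z) ^ 2) / L) * (C₂ * (1 + (ξ + z') ^ 2) / L) * M := by
        gcongr
        · exact (h1 L hL _ (nearOne_re L _)).1
        · exact (h1 L hL _ (nearOne_re L _)).1
        · exact h2 L hL _
        · exact h2 L hL _
        · exact norm_tprod_eulerCorrection_le (one_lt_nearOne_re hL0 ξ).le _ _
    _ = C₁ ^ 2 * C₂ ^ 2 * M * ((1 + (ξ + z) ^ 2) * (1 + (ξ + z') ^ 2)) := by field_simp
    _ ≤ C₁ ^ 2 * C₂ ^ 2 * M * ((2 * ((1 + ξ ^ 2) * (1 + z ^ 2))) * (2 * ((1 + ξ ^ 2) * (1 + z' ^ 2)))) := by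
        gcongr
        · exact hsq z
        · exact hsq z'
    _ = _ := by ring

lemma tendsto_nearOne (y : ℝ) : Tendsto (fun L : ℝ => nearOne L y) atTop (𝓝 1) := by
  have h : Tendsto (fun L : ℝ => ((L⁻¹ : ℝ) : ℂ)) atTop (𝓝 ((0 : ℝ) : ℂ)) :=
    (continuous_ofReal.tendsto 0).comp tendsto_inv_atTop_zero
  have h2 := (h.const_mul (1 + y * I : ℂ)).const_add 1
  simp only [ofReal_zero, mul_zero, add_zero] at h2
  refine h2.congr fun L => ?_
  rw [nearOne, ofReal_inv, div_eq_mul_inv]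

lemma tendsto_tprod_eulerCorrection (ξ z z' : ℝ) :
    Tendsto (fun L : ℝ => ∏' p : Nat.Primes, (1 + eulerCorrection (nearOne L ξ) (z / L) (z' / L) p))
      atTop (𝓝 1) := by
  have hpow : ∀ (w : ℝ) (p : Nat.Primes),
      Tendsto (fun L : ℝ => ((p : ℕ) : ℂ) ^ (-(((w / L : ℝ) : ℂ) * I))) atTop (𝓝 1) := by
    intro w p
    have hp0 : ((p : ℕ) : ℂ) ≠ 0 := by exact_mod_cast p.2.ne_zero
    have h1 : Tendsto (fun L : ℝ => w / L) atTop (𝓝 0) := tendsto_const_nhds.div_atTop tendsto_id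
    have h2 : Continuous fun t : ℝ => ((p : ℕ) : ℂ) ^ (-((t : ℂ) * I)) :=
      Continuous.const_cpow (by fun_prop) (Or.inl hp0)
    have h3 : Tendsto (fun L : ℝ => ((p : ℕ) : ℂ) ^ (-(((w / L : ℝ) : ℂ) * I))) atTop
        (𝓝 (((p : ℕ) : ℂ) ^ (-(((0 : ℝ) : ℂ) * I)))) := (h2.tendsto 0).comp h1
    simpa using h3
  have h := tendsto_tprod_one_add_of_dominated_convergence (𝓕 := atTop)
    (f := fun (L : ℝ) (p : Nat.Primes) => eulerCorrection (nearOne L ξ) (z / L) (z' / L) p)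
    (g := 0) summable_primes_sq_inv ?_ ?_
  · simpa using h
  · intro p
    have hp0 : ((p : ℕ) : ℂ) ≠ 0 := by exact_mod_cast p.2.ne_zero
    have hx : Tendsto (fun L : ℝ => ((p : ℕ) : ℂ) ^ (-(nearOne L ξ))) atTop
        (𝓝 (((p : ℕ) : ℂ) ^ (-(1 : ℂ)))) := by
      have h2 : Continuous fun t : ℂ => ((p : ℕ) : ℂ) ^ (-t) :=
        Continuous.const_cpow (by fun_prop) (Or.inl hp0)
      exact (h2.tendsto 1).comp (tendsto_nearOne ξ)
    have ha := hpow z p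
    have hb := hpow z' p
    have hden : (1 : ℂ) - 1 * ((p : ℕ) : ℂ) ^ (-(1 : ℂ)) ≠ 0 := fun h => by
      have := half_le_norm_one_sub_cpow_mul (s := 1) (by simp) 0 p.2
      simp only [ofReal_zero, zero_mul, neg_zero, cpow_zero] at this
      rw [h, norm_zero] at this
      norm_num at this
    have h3 := (((((hx.pow 2).mul ha).mul hb).mul (ha.const_sub 1)).mul (hb.const_sub 1)).neg.div
      (((ha.mul hx).const_sub 1).mul ((hb.mul hx).const_sub 1)) (mul_ne_zero hden hden)
    have h4 := h3.congr (f₂ := fun L : ℝ => eulerCorrection (nearOne L ξ) (z / L) (z' / L) p)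
      fun L => rfl
    simpa using h4
  · filter_upwards [eventually_gt_atTop 0] with L hL p
    exact norm_eulerCorrection_le (one_lt_nearOne_re hL ξ).le _ _ p.2

/-- Near `s = 1` only the poles of the zeta factors survive. -/
theorem tendsto_twistedSeries (ξ z z' : ℝ) :
    Tendsto (fun L : ℝ => twistedSeries (nearOne L ξ) (z / L) (z' / L)) atTop
      (𝓝 ((1 + ((ξ + z : ℝ) : ℂ) * I) * (1 + ((ξ + z' : ℝ) : ℂ) * I) /
        ((1 + (ξ : ℂ) * I) * (1 + ((ξ + z + z' : ℝ) : ℂ) * I)))) := by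
  have hne : ∀ y : ℝ, (1 : ℂ) + (y : ℂ) * I ≠ 0 := fun y h => by
    have := congrArg Complex.re h
    simp at this
  have hZ : ∀ y : ℝ, Tendsto (fun L : ℝ => zetaNoPole (nearOne L y)) atTop (𝓝 1) := fun y => by
    have := (continuous_zetaNoPole.tendsto 1).comp (tendsto_nearOne y)
    rwa [zetaNoPole_one] at this
  have h := ((((hZ ξ).mul (hZ (ξ + z + z'))).mul ((hZ (ξ + z)).inv₀ one_ne_zero)).mul
    ((hZ (ξ + z')).inv₀ one_ne_zero)).mul (tendsto_tprod_eulerCorrection ξ z z')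
  have h2 := h.mul_const ((1 + ((ξ + z : ℝ) : ℂ) * I) * (1 + ((ξ + z' : ℝ) : ℂ) * I) /
        ((1 + (ξ : ℂ) * I) * (1 + ((ξ + z + z' : ℝ) : ℂ) * I)))
  simp only [mul_one, inv_one, one_mul] at h2
  refine h2.congr' ?_
  filter_upwards [eventually_gt_atTop 0] with L hL
  have hLc : (L : ℂ) ≠ 0 := by exact_mod_cast hL.ne'
  have hz : ∀ y : ℝ, zetaNoPole (nearOne L y) = (1 + (y : ℂ) * I) / L * riemannZeta (nearOne L y) := by
    intro y
    rw [zetaNoPole_of_ne_one, nearOne, add_sub_cancel_left]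
    intro h
    have := one_lt_nearOne_re hL y
    rw [h] at this
    simp at this
  rw [twistedSeries_nearOne hL, hz, hz, hz, hz]
  have n1 := riemannZeta_ne_zero_of_one_le_re (one_lt_nearOne_re hL (ξ + z)).le
  have n2 := riemannZeta_ne_zero_of_one_le_re (one_lt_nearOne_re hL (ξ + z')).le
  have m1 := hne ξ
  have m2 := hne (ξ + z)
  have m3 := hne (ξ + z')
  have m4 := hne (ξ + z + z')
  generalize (1 : ℂ) + (ξ : ℂ) * I = w₁ at *
  generalize (1 : ℂ) + ((ξ + z : ℝ) : ℂ) * I = w₂ at *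
  generalize (1 : ℂ) + ((ξ + z' : ℝ) : ℂ) * I = w₃ at *
  generalize (1 : ℂ) + ((ξ + z + z' : ℝ) : ℂ) * I = w₄ at *
  field_simp

end EulerProducts

/-! ### The Barban–Vehov asymptotic formula -/

section BarbanVehov
open Complex Filter Topology MeasureTheory
open scoped FourierTransform ContDiff

/-- A smooth compactly supported function as a superposition of the exponentials `exp (-itz)`, with
a rapidly decreasing density. -/
lemma exists_fourier_density {f : ℝ → ℝ} (hf : ContDiff ℝ ∞ f) (hs : HasCompactSupport f) :
    ∃ p : ℝ → ℂ, Continuous p ∧ (∀ k : ℕ, Integrable fun z : ℝ => |z| ^ k * ‖p z‖) ∧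
      (∀ t : ℝ, (f t : ℂ) = ∫ z : ℝ, p z * cexp (-(t * z) * I)) ∧
      (∀ t : ℝ, ((deriv f t : ℝ) : ℂ) = ∫ z : ℝ, -(z * I) * p z * cexp (-(t * z) * I)) := by
  have hfc : ContDiff ℝ ∞ fun t => (f t : ℂ) := ofRealCLM.contDiff.comp hf
  have hsc : HasCompactSupport fun t => (f t : ℂ) := hs.comp_left (g := fun x : ℝ => (x : ℂ)) (by simp)
  set S : SchwartzMap ℝ ℂ := hsc.toSchwartzMap hfc with hS
  set c : ℝ := -(2 * Real.pi)⁻¹ with hc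
  have hpi := Real.pi_pos
  have hc0 : c ≠ 0 := by rw [hc]; exact neg_ne_zero.mpr (by positivity)
  have hcabs : |c⁻¹| = 2 * Real.pi := by
    rw [hc, inv_neg, inv_inv, abs_neg, abs_of_pos (by positivity)]
  set p : ℝ → ℂ := fun z => ((2 * Real.pi)⁻¹ : ℝ) * (𝓕 S) (c * z) with hp
  have hpc : Continuous p := by
    have := (𝓕 S).continuous
    fun_prop
  have hint : ∀ k : ℕ, Integrable fun z : ℝ => |z| ^ k * ‖p z‖ := by
    intro k
    have h1 := ((𝓕 S).integrable_pow_mul volume k).comp_mul_left' hc0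
    refine (h1.const_mul ((2 * Real.pi)⁻¹ * (|c| ^ k)⁻¹)).congr (Eventually.of_forall fun z => ?_)
    simp only [hp, norm_mul, Real.norm_eq_abs, norm_real, mul_pow]
    rw [abs_of_pos (by positivity : (0 : ℝ) < (2 * Real.pi)⁻¹)]
    have : |c| ^ k ≠ 0 := pow_ne_zero _ (abs_ne_zero.mpr hc0)
    field_simp
  have hrep : ∀ t : ℝ, (f t : ℂ) = ∫ z : ℝ, p z * cexp (-(t * z) * I) := by
    intro t
    have h1 : 𝓕⁻ (𝓕 S) = S := FourierTransform.fourierInv_fourier_eq S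
    have h2 : (f t : ℂ) = 𝓕⁻ (𝓕 S) t := by rw [h1]; rfl
    rw [h2, SchwartzMap.fourierInv_coe, Real.fourierInv_eq']
    have h3 := Measure.integral_comp_mul_left
      (fun v : ℝ => cexp ((2 * Real.pi * inner ℝ v t : ℝ) * I) • (𝓕 S) v) c
    rw [hcabs] at h3
    have h4 : ∀ z : ℝ, p z * cexp (-(t * z) * I) = ((2 * Real.pi)⁻¹ : ℝ) •
        (cexp ((2 * Real.pi * inner ℝ (c * z) t : ℝ) * I) • (𝓕 S) (c * z)) := by
      intro z
      have h5 : (2 * Real.pi * inner ℝ (c * z) t : ℝ) = -(t * z) := by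
        simp only [hc, RCLike.inner_apply, conj_trivial]
        field_simp
      rw [h5]
      simp only [hp, smul_eq_mul, real_smul]
      push_cast
      ring
    simp_rw [h4]
    rw [integral_smul, h3, smul_smul, inv_mul_cancel₀ (by positivity), one_smul]
  refine ⟨p, hpc, hint, hrep, fun t => ?_⟩
  have hexp : ∀ t z : ℝ, ‖cexp (-(t * z) * I)‖ = 1 := by
    intro t z
    have : -((t : ℂ) * z) * I = ((-(t * z) : ℝ) : ℂ) * I := by push_cast; ring
    rw [this, norm_exp_ofReal_mul_I]
  have hd := hasDerivAt_integral_of_dominated_loc_of_deriv_le (μ := volume) (𝕜 := ℝ)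
    (F := fun (t : ℝ) (z : ℝ) => p z * cexp (-(t * z) * I))
    (F' := fun (t : ℝ) (z : ℝ) => -(z * I) * p z * cexp (-(t * z) * I))
    (x₀ := t) (s := Set.univ) (bound := fun z => |z| ^ 1 * ‖p z‖) Filter.univ_mem
    (Eventually.of_forall fun t => by
      exact (by fun_prop : Continuous fun z : ℝ => p z * cexp (-(t * z) * I)).aestronglyMeasurable)
    (by
      refine (hint 0).mono' (by
        exact (by fun_prop : Continuous fun z : ℝ => p z * cexp (-(t * z) * I)).aestronglyMeasurable)
        (Eventually.of_forall fun z => ?_)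
      rw [norm_mul, hexp]; simp)
    (by
      exact (by fun_prop : Continuous fun z : ℝ =>
        -(z * I) * p z * cexp (-(t * z) * I)).aestronglyMeasurable)
    (Eventually.of_forall fun z t _ => by
      rw [norm_mul, hexp, norm_mul, norm_neg, norm_mul, norm_real, norm_I]; simp)
    (hint 1)
    (Eventually.of_forall fun z t _ => by
      have h1 : HasDerivAt (fun t : ℝ => -((t : ℂ) * z) * I) (-(z : ℂ) * I) t := by
        have := (((ofRealCLM.hasDerivAt (x := t)).mul_const (z : ℂ)).neg).mul_const I
        simpa using this
      exact (h1.cexp.const_mul (p z)).congr_deriv (by ring))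
  have h1 := hd.2
  have h2 : HasDerivAt (fun t => (f t : ℂ)) ((deriv f t : ℝ) : ℂ) t :=
    ((hf.differentiable (by simp)).differentiableAt.hasDerivAt).ofReal_comp
  simp_rw [← hrep] at h1
  exact h2.unique h1

/-- The truncated divisor sum `∑_{d ∣ n} μ(d) P(log d / L)`. -/
noncomputable def barbanVehov (P : ℝ → ℝ) (L : ℝ) (n : ℕ) : ℝ :=
  ∑ d ∈ n.divisors, (ArithmeticFunction.moebius d : ℝ) * P (Real.log d / L)

lemma natCast_cpow_neg_mul_I_eq_exp {d : ℕ} (hd : d ≠ 0) (L z : ℝ) :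
    (d : ℂ) ^ (-(((z / L : ℝ) : ℂ) * I)) = cexp (-(((Real.log d / L : ℝ) : ℂ) * z) * I) := by
  rw [cpow_def_of_ne_zero (by exact_mod_cast hd), ← natCast_log]
  congr 1
  push_cast
  ring

lemma continuous_twistedMoebiusSum_div (L : ℝ) (n : ℕ) :
    Continuous fun z : ℝ => twistedMoebiusSum (z / L) n := by
  unfold twistedMoebiusSum
  refine continuous_finsetSum _ fun d hd => ?_
  have hd0 : (d : ℂ) ≠ 0 := by exact_mod_cast (Nat.pos_of_mem_divisors hd).ne'
  exact continuous_const.mul (Continuous.const_cpow (by fun_prop) (Or.inl hd0))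

/-- The weights `P(log d / L)` as a superposition of the powers `d ^ (-iz / L)`. -/
lemma barbanVehov_eq_integral {P : ℝ → ℝ} {p : ℝ → ℂ} (hp : Continuous p)
    (hpi : ∀ k : ℕ, Integrable fun z : ℝ => |z| ^ k * ‖p z‖)
    (hrep : ∀ t : ℝ, (P t : ℂ) = ∫ z : ℝ, p z * cexp (-(t * z) * I)) (L : ℝ) (n : ℕ) :
    (barbanVehov P L n : ℂ) = ∫ z : ℝ, p z * twistedMoebiusSum (z / L) n := by
  unfold twistedMoebiusSum barbanVehov
  simp_rw [Finset.mul_sum]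
  rw [integral_finsetSum]
  · rw [ofReal_sum]
    refine Finset.sum_congr rfl fun d hd => ?_
    have hd0 := (Nat.pos_of_mem_divisors hd).ne'
    rw [ofReal_mul, ofReal_intCast, hrep, ← integral_const_mul]
    refine integral_congr_ae (Eventually.of_forall fun z => ?_)
    simp only
    rw [natCast_cpow_neg_mul_I_eq_exp hd0]
    ring
  · intro d hd
    have hd0 : (d : ℂ) ≠ 0 := by exact_mod_cast (Nat.pos_of_mem_divisors hd).ne'
    have hc : Continuous fun z : ℝ => (d : ℂ) ^ (-(((z / L : ℝ) : ℂ) * I)) :=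
      Continuous.const_cpow (by fun_prop) (Or.inl hd0)
    refine ((hpi 0)).mono' (hp.mul (continuous_const.mul hc)).aestronglyMeasurable
      (Eventually.of_forall fun z => ?_)
    rw [norm_mul, norm_mul, norm_intCast, pow_zero, one_mul]
    refine mul_le_of_le_one_right (norm_nonneg _) (mul_le_one₀ ?_ (norm_nonneg _)
      (norm_natCast_cpow_neg_mul_I_le _ d))
    exact_mod_cast ArithmeticFunction.abs_moebius_le_one

lemma continuous_natCast_cpow_neg_nearOne (L : ℝ) {n : ℕ} (hn : n ≠ 0) :
    Continuous fun ξ : ℝ => (n : ℂ) ^ (-nearOne L ξ) := by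
  unfold nearOne
  exact Continuous.const_cpow (by fun_prop) (Or.inl (by exact_mod_cast hn))

/-- The density `k` is that of `exp t * K t`, so that the powers `n ^ (-s)` which arise have `Re s > 1`. -/
lemma cutoff_eq_integral {K : ℝ → ℝ} {k : ℝ → ℂ}
    (hrep : ∀ t : ℝ, ((Real.exp t * K t : ℝ) : ℂ) = ∫ z : ℝ, k z * cexp (-(t * z) * I))
    (L : ℝ) {n : ℕ} (hn : n ≠ 0) :
    ((K (Real.log n / L) / n : ℝ) : ℂ) = ∫ ξ : ℝ, k ξ * (n : ℂ) ^ (-nearOne L ξ) := by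
  have hn0 : (n : ℂ) ≠ 0 := by exact_mod_cast hn
  have h1 : ∀ ξ : ℝ, k ξ * (n : ℂ) ^ (-nearOne L ξ) =
      (Real.exp (-(Real.log n / L)) / n : ℝ) * (k ξ * cexp (-(((Real.log n / L : ℝ) : ℂ) * ξ) * I)) := by
    intro ξ
    have h2 : -nearOne L ξ = -1 + (-((L : ℂ)⁻¹) + (-(((ξ / L : ℝ) : ℂ) * I))) := by
      rw [nearOne]; push_cast; ring
    rw [h2, cpow_add _ _ hn0, cpow_add _ _ hn0, natCast_cpow_neg_mul_I_eq_exp hn, cpow_neg_one]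
    have h3 : (n : ℂ) ^ (-((L : ℂ)⁻¹)) = (Real.exp (-(Real.log n / L)) : ℝ) := by
      rw [cpow_def_of_ne_zero hn0, ← natCast_log]
      push_cast
      congr 1
      ring
    rw [h3]
    push_cast
    ring
  simp_rw [h1]
  rw [integral_const_mul, ← hrep, ← ofReal_mul]
  congr 1
  rw [Real.exp_neg]
  have := Real.exp_pos (Real.log n / L)
  field_simp

lemma norm_cpow_neg_nearOne {L : ℝ} (ξ : ℝ) {n : ℕ} (hn : n ≠ 0) :
    ‖(n : ℂ) ^ (-nearOne L ξ)‖ = (n : ℝ) ^ (-(1 + 1 / L)) := by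
  rw [norm_natCast_cpow_of_pos (Nat.pos_of_ne_zero hn), neg_re, nearOne_re]

lemma continuous_twistedSeries {L : ℝ} (hL : 0 < L) :
    Continuous fun w : ℝ × ℝ × ℝ => twistedSeries (nearOne L w.1) (w.2.1 / L) (w.2.2 / L) := by
  unfold twistedSeries
  have hσ : 1 < 1 + 1 / L := by have : 0 < 1 / L := by positivity
                                linarith
  refine continuous_tsum (fun n => ?_) (summable_rpow_mul_four_pow hσ) fun n w => ?_
  · rcases Nat.eq_zero_or_pos n with rfl | hn
    · simpa [twistedMoebiusSum] using continuous_const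
    · refine ((continuous_natCast_cpow_neg_nearOne L hn.ne').comp continuous_fst).mul
        (((continuous_twistedMoebiusSum_div L n).comp (by fun_prop)).mul
          ((continuous_twistedMoebiusSum_div L n).comp (by fun_prop)))
  · have h := norm_twistedSeries_term_le (one_lt_nearOne_re hL w.1) (w.2.1 / L) (w.2.2 / L) n
    rwa [nearOne_re] at h

/-- For fixed `L`, insert the Fourier representations of the weight and of the cutoff, and sum over
`n` under the integral. -/
lemma tsum_barbanVehov_eq_integral {P K : ℝ → ℝ} {p k : ℝ → ℂ} (hp : Continuous p)
    (hk : Continuous k) (hpi : ∀ j : ℕ, Integrable fun z : ℝ => |z| ^ j * ‖p z‖)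
    (hki : ∀ j : ℕ, Integrable fun z : ℝ => |z| ^ j * ‖k z‖)
    (hprep : ∀ t : ℝ, (P t : ℂ) = ∫ z : ℝ, p z * cexp (-(t * z) * I))
    (hkrep : ∀ t : ℝ, ((Real.exp t * K t : ℝ) : ℂ) = ∫ z : ℝ, k z * cexp (-(t * z) * I))
    {L : ℝ} (hL : 0 < L) :
    ((∑' n : ℕ, barbanVehov P L n ^ 2 * (K (Real.log n / L) / n) : ℝ) : ℂ) =
      ∫ w : ℝ × ℝ × ℝ, k w.1 * (p w.2.1 * p w.2.2) *
        twistedSeries (nearOne L w.1) (w.2.1 / L) (w.2.2 / L)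
          ∂((volume : Measure ℝ).prod ((volume : Measure ℝ).prod (volume : Measure ℝ))) := by
  have hp0 : Integrable fun z => ‖p z‖ := by simpa using hpi 0
  have hk0 : Integrable fun z => ‖k z‖ := by simpa using hki 0
  have hσ : 1 < 1 + 1 / L := by have : 0 < 1 / L := by positivity
                                linarith
  set f : ℕ → ℝ × ℝ × ℝ → ℂ := fun n w => (k w.1 * (n : ℂ) ^ (-nearOne L w.1)) *
    ((p w.2.1 * twistedMoebiusSum (w.2.1 / L) n) *
      (p w.2.2 * twistedMoebiusSum (w.2.2 / L) n)) with hf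
  have hf0 : ∀ w, f 0 w = 0 := fun w => by simp [hf, twistedMoebiusSum]
  have hpA : ∀ n, Integrable fun z : ℝ => p z * twistedMoebiusSum (z / L) n := fun n =>
    (hp0.mul_const (2 ^ #n.primeFactors)).mono'
      (hp.mul (continuous_twistedMoebiusSum_div L n)).aestronglyMeasurable
      (Eventually.of_forall fun z => by
        rw [norm_mul]
        exact mul_le_mul_of_nonneg_left (norm_twistedMoebiusSum_le _ n) (norm_nonneg _))
  have hkn : ∀ n : ℕ, n ≠ 0 → Integrable fun ξ : ℝ => k ξ * (n : ℂ) ^ (-nearOne L ξ) :=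
    fun n hn => (hk0.mul_const ((n : ℝ) ^ (-(1 + 1 / L)))).mono'
      (hk.mul (continuous_natCast_cpow_neg_nearOne L hn)).aestronglyMeasurable
      (Eventually.of_forall fun ξ => by rw [norm_mul, norm_cpow_neg_nearOne ξ hn])
  have hint : ∀ n, Integrable (f n)
      ((volume : Measure ℝ).prod ((volume : Measure ℝ).prod (volume : Measure ℝ))) := by
    intro n
    by_cases hn : n = 0
    · subst hn
      exact (integrable_zero _ _ _).congr (Eventually.of_forall fun w => (hf0 w).symm)
    · exact (hkn n hn).mul_prod ((hpA n).mul_prod (hpA n))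
  have hbound : Integrable (fun w : ℝ × ℝ × ℝ => ‖k w.1‖ * (‖p w.2.1‖ * ‖p w.2.2‖))
      ((volume : Measure ℝ).prod ((volume : Measure ℝ).prod (volume : Measure ℝ))) :=
    hk0.mul_prod (hp0.mul_prod hp0)
  have hnorm : ∀ n w, ‖f n w‖ ≤ ((n : ℝ) ^ (-(1 + 1 / L)) *
      ((2 : ℝ) ^ #n.primeFactors * 2 ^ #n.primeFactors)) *
      (‖k w.1‖ * (‖p w.2.1‖ * ‖p w.2.2‖)) := by
    intro n w
    have h := norm_twistedSeries_term_le (one_lt_nearOne_re hL w.1) (w.2.1 / L) (w.2.2 / L) n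
    rw [nearOne_re] at h
    have h2 : f n w = ((n : ℂ) ^ (-nearOne L w.1) * (twistedMoebiusSum (w.2.1 / L) n *
        twistedMoebiusSum (w.2.2 / L) n)) * (k w.1 * (p w.2.1 * p w.2.2)) := by
      rw [hf]; ring
    rw [h2, norm_mul, norm_mul (k w.1), norm_mul (p w.2.1)]
    exact mul_le_mul_of_nonneg_right h (by positivity)
  have hsum : Summable fun n => ∫ w, ‖f n w‖
      ∂((volume : Measure ℝ).prod ((volume : Measure ℝ).prod (volume : Measure ℝ))) := by
    refine ((summable_rpow_mul_four_pow hσ).mul_right (∫ w : ℝ × ℝ × ℝ,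
      ‖k w.1‖ * (‖p w.2.1‖ * ‖p w.2.2‖) ∂((volume : Measure ℝ).prod
        ((volume : Measure ℝ).prod (volume : Measure ℝ))))).of_nonneg_of_le
      (fun n => integral_nonneg fun w => norm_nonneg _) fun n => ?_
    rw [← integral_const_mul]
    exact integral_mono (hint n).norm (hbound.const_mul _) (hnorm n)
  have hHas := hasSum_integral_of_summable_integral_norm hint hsum
  have hval : ∀ n, ∫ w, f n w ∂((volume : Measure ℝ).prod ((volume : Measure ℝ).prod
      (volume : Measure ℝ))) = ((barbanVehov P L n ^ 2 * (K (Real.log n / L) / n) : ℝ) : ℂ) := by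
    intro n
    by_cases hn : n = 0
    · subst hn
      simp [hf0, barbanVehov]
    · have h1 := integral_prod_mul (μ := (volume : Measure ℝ))
        (ν := (volume : Measure ℝ).prod (volume : Measure ℝ))
        (fun ξ : ℝ => k ξ * (n : ℂ) ^ (-nearOne L ξ))
        (fun z : ℝ × ℝ => (p z.1 * twistedMoebiusSum (z.1 / L) n) *
          (p z.2 * twistedMoebiusSum (z.2 / L) n))
      have h2 := integral_prod_mul (μ := (volume : Measure ℝ)) (ν := (volume : Measure ℝ))
        (fun z : ℝ => p z * twistedMoebiusSum (z / L) n)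
        (fun z : ℝ => p z * twistedMoebiusSum (z / L) n)
      rw [h2, ← barbanVehov_eq_integral hp hpi hprep, ← cutoff_eq_integral hkrep L hn] at h1
      rw [hf]
      refine h1.trans ?_
      push_cast
      ring
  simp_rw [hval] at hHas
  rw [ofReal_tsum, hHas.tsum_eq]
  refine integral_congr_ae (Eventually.of_forall fun w => ?_)
  simp only
  rw [twistedSeries, ← tsum_mul_left]
  refine tsum_congr fun n => ?_
  rw [hf]
  ring

/-- The integral of the limiting Euler product against the Fourier densities: the factors
`1 / (1 + iξ)` and `1 / (1 + i(ξ + z + z'))` are Laplace transforms, and undoing them gives an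
integral over the quadrant. -/
lemma integral_limit_eq {P K : ℝ → ℝ} {p k : ℝ → ℂ} (hp : Continuous p)
    (hk : Continuous k) (hpi : ∀ j : ℕ, Integrable fun z : ℝ => |z| ^ j * ‖p z‖)
    (hki : ∀ j : ℕ, Integrable fun z : ℝ => |z| ^ j * ‖k z‖)
    (hpd : ∀ t : ℝ, ((deriv P t : ℝ) : ℂ) = ∫ z : ℝ, -(z * I) * p z * cexp (-(t * z) * I))
    (hkrep : ∀ t : ℝ, ((Real.exp t * K t : ℝ) : ℂ) = ∫ z : ℝ, k z * cexp (-(t * z) * I))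
    (hK0 : K 0 = 0) :
    ∫ w : ℝ × ℝ × ℝ, k w.1 * (p w.2.1 * p w.2.2) *
        ((1 + ((w.1 + w.2.1 : ℝ) : ℂ) * I) * (1 + ((w.1 + w.2.2 : ℝ) : ℂ) * I) /
          ((1 + (w.1 : ℂ) * I) * (1 + ((w.1 + w.2.1 + w.2.2 : ℝ) : ℂ) * I)))
        ∂((volume : Measure ℝ).prod ((volume : Measure ℝ).prod (volume : Measure ℝ))) =
      ((∫ T : ℝ × ℝ, K (T.1 + T.2) * deriv P T.2 ^ 2
        ∂((volume.restrict (Set.Ioi (0 : ℝ))).prod (volume.restrict (Set.Ioi (0 : ℝ)))) : ℝ) : ℂ) := by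
  set ν : Measure (ℝ × ℝ × ℝ) :=
    (volume : Measure ℝ).prod ((volume : Measure ℝ).prod (volume : Measure ℝ)) with hν
  set ρ : Measure (ℝ × ℝ) :=
    (volume.restrict (Set.Ioi (0 : ℝ))).prod (volume.restrict (Set.Ioi (0 : ℝ))) with hρ
  have hp0 : Integrable p := by
    have := hpi 0
    simp only [pow_zero, one_mul] at this
    exact (integrable_norm_iff hp.aestronglyMeasurable).mp this
  have hk0 : Integrable k := by
    have := hki 0
    simp only [pow_zero, one_mul] at this
    exact (integrable_norm_iff hk.aestronglyMeasurable).mp this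
  have hp1 : Integrable fun z : ℝ => -(z * I) * p z := by
    have hm : Continuous fun z : ℝ => -((z : ℂ) * I) * p z := by fun_prop
    refine (hpi 1).mono' hm.aestronglyMeasurable (Eventually.of_forall fun z => ?_)
    rw [norm_mul, norm_neg, norm_mul, norm_real, norm_I]
    simp
  have hne : ∀ y : ℝ, (1 : ℂ) + (y : ℂ) * I ≠ 0 := fun y h => by
    have := congrArg Complex.re h
    simp at this
  have hLap : ∀ y : ℝ, ∫ τ in Set.Ioi (0 : ℝ), cexp (-(1 + (y : ℂ) * I) * τ) =
      1 / (1 + (y : ℂ) * I) := by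
    intro y
    rw [integral_exp_mul_complex_Ioi (by simp)]
    rw [ofReal_zero, mul_zero, Complex.exp_zero, neg_div_neg_eq]
  set F : ℝ × ℝ × ℝ → ℝ × ℝ → ℂ := fun w T =>
    (k w.1 * ((-(w.2.1 * I) * p w.2.1) * (-(w.2.2 * I) * p w.2.2))) *
      (cexp (-(1 + (w.1 : ℂ) * I) * T.1) *
        cexp (-(1 + ((w.1 + w.2.1 + w.2.2 : ℝ) : ℂ) * I) * T.2)) with hF
  have hG0 : Integrable (fun w : ℝ × ℝ × ℝ => k w.1 * (p w.2.1 * p w.2.2)) ν :=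
    hk0.mul_prod (hp0.mul_prod hp0)
  have hG1 : Integrable (fun w : ℝ × ℝ × ℝ =>
      k w.1 * ((-(w.2.1 * I) * p w.2.1) * (-(w.2.2 * I) * p w.2.2))) ν :=
    hk0.mul_prod (hp1.mul_prod hp1)
  have hexp : Integrable (fun T : ℝ × ℝ => Real.exp (-T.1) * Real.exp (-T.2)) ρ := by
    have h1 : Integrable (fun t : ℝ => Real.exp (-t)) (volume.restrict (Set.Ioi (0 : ℝ))) := by
      have := exp_neg_integrableOn_Ioi 0 one_pos
      simp only [neg_mul, one_mul] at this
      exact this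
    exact h1.mul_prod h1
  have hFint : Integrable (Function.uncurry F) (ν.prod ρ) := by
    have hcont : Continuous (Function.uncurry F) := by
      simp only [hF, Function.uncurry_def]
      fun_prop
    refine (hG1.norm.mul_prod hexp).mono' hcont.aestronglyMeasurable
      (Eventually.of_forall fun x => ?_)
    simp only [hF, Function.uncurry_def]
    rw [norm_mul _ (_ * _), norm_mul (cexp _), norm_exp, norm_exp]
    refine mul_le_mul_of_nonneg_left (le_of_eq ?_) (norm_nonneg _)
    simp
  -- integrating out `T` first
  have hFT : ∀ w, ∫ T, F w T ∂ρ = k w.1 * ((-(w.2.1 * I) * p w.2.1) * (-(w.2.2 * I) * p w.2.2)) *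
      (1 / (1 + (w.1 : ℂ) * I) * (1 / (1 + ((w.1 + w.2.1 + w.2.2 : ℝ) : ℂ) * I))) := by
    intro w
    simp only [hF]
    rw [integral_const_mul, ← hLap, ← hLap]
    congr 1
    exact integral_prod_mul (fun τ : ℝ => cexp (-(1 + (w.1 : ℂ) * I) * τ))
      (fun t : ℝ => cexp (-(1 + ((w.1 + w.2.1 + w.2.2 : ℝ) : ℂ) * I) * t))
  -- integrating out `w` first
  have hFw : ∀ T : ℝ × ℝ, ∫ w, F w T ∂ν = ((K (T.1 + T.2) * deriv P T.2 ^ 2 : ℝ) : ℂ) := by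
    intro T
    have h1 : ∀ w : ℝ × ℝ × ℝ, F w T = ((Real.exp (-(T.1 + T.2)) : ℝ) : ℂ) *
        ((k w.1 * cexp (-(((T.1 + T.2 : ℝ) : ℂ) * w.1) * I)) *
        ((-(w.2.1 * I) * p w.2.1 * cexp (-((T.2 : ℂ) * w.2.1) * I)) *
          (-(w.2.2 * I) * p w.2.2 * cexp (-((T.2 : ℂ) * w.2.2) * I)))) := by
      intro w
      simp only [hF]
      have h2 : cexp (-(1 + (w.1 : ℂ) * I) * T.1) *
          cexp (-(1 + ((w.1 + w.2.1 + w.2.2 : ℝ) : ℂ) * I) * T.2) =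
          ((Real.exp (-(T.1 + T.2)) : ℝ) : ℂ) * (cexp (-(((T.1 + T.2 : ℝ) : ℂ) * w.1) * I) *
          (cexp (-((T.2 : ℂ) * w.2.1) * I) * cexp (-((T.2 : ℂ) * w.2.2) * I))) := by
        rw [ofReal_exp, ← Complex.exp_add, ← Complex.exp_add, ← Complex.exp_add, ← Complex.exp_add]
        congr 1
        push_cast
        ring
      rw [h2]
      ring
    simp_rw [h1]
    rw [integral_const_mul]
    have h2 := integral_prod_mul (μ := (volume : Measure ℝ))
      (ν := (volume : Measure ℝ).prod (volume : Measure ℝ))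
      (fun ξ : ℝ => k ξ * cexp (-(((T.1 + T.2 : ℝ) : ℂ) * ξ) * I))
      (fun z : ℝ × ℝ => (-(z.1 * I) * p z.1 * cexp (-((T.2 : ℂ) * z.1) * I)) *
          (-(z.2 * I) * p z.2 * cexp (-((T.2 : ℂ) * z.2) * I)))
    have h3 := integral_prod_mul (μ := (volume : Measure ℝ)) (ν := (volume : Measure ℝ))
      (fun z : ℝ => -(z * I) * p z * cexp (-((T.2 : ℂ) * z) * I))
      (fun z : ℝ => -(z * I) * p z * cexp (-((T.2 : ℂ) * z) * I))
    rw [h3, ← hpd, ← hkrep] at h2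
    rw [hν, h2, ← ofReal_mul, ← ofReal_mul, ← ofReal_mul]
    congr 1
    rw [Real.exp_neg]
    have := Real.exp_pos (T.1 + T.2)
    field_simp
  -- the constant term of the limit contributes `K 0 * P 0 ^ 2 = 0`
  have hG0val : ∫ w, k w.1 * (p w.2.1 * p w.2.2) ∂ν = 0 := by
    have h1 := integral_prod_mul (μ := (volume : Measure ℝ))
      (ν := (volume : Measure ℝ).prod (volume : Measure ℝ)) k (fun z : ℝ × ℝ => p z.1 * p z.2)
    have h2 := hkrep 0
    simp only [hK0, mul_zero, ofReal_zero, zero_mul, neg_zero, Complex.exp_zero, mul_one] at h2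
    rw [← h2, zero_mul] at h1
    exact h1
  have hsplit : ∀ w : ℝ × ℝ × ℝ, k w.1 * (p w.2.1 * p w.2.2) *
        ((1 + ((w.1 + w.2.1 : ℝ) : ℂ) * I) * (1 + ((w.1 + w.2.2 : ℝ) : ℂ) * I) /
          ((1 + (w.1 : ℂ) * I) * (1 + ((w.1 + w.2.1 + w.2.2 : ℝ) : ℂ) * I))) =
      k w.1 * (p w.2.1 * p w.2.2) + ∫ T, F w T ∂ρ := by
    intro w
    rw [hFT]
    have h1 := hne w.1
    have h2 := hne (w.1 + w.2.1 + w.2.2)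
    have h3 : (1 + ((w.1 + w.2.1 : ℝ) : ℂ) * I) * (1 + ((w.1 + w.2.2 : ℝ) : ℂ) * I) =
        (1 + (w.1 : ℂ) * I) * (1 + ((w.1 + w.2.1 + w.2.2 : ℝ) : ℂ) * I) +
          (w.2.1 * I) * (w.2.2 * I) := by
      push_cast; ring
    rw [h3]
    generalize (1 : ℂ) + (w.1 : ℂ) * I = a at *
    generalize (1 : ℂ) + ((w.1 + w.2.1 + w.2.2 : ℝ) : ℂ) * I = b at *
    field_simp
  simp_rw [hsplit]
  have hFi : Integrable (fun w => ∫ T, F w T ∂ρ) ν := hFint.integral_prod_left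
  rw [integral_add hG0 hFi, hG0val, zero_add, integral_integral_swap hFint]
  simp_rw [hFw]
  exact integral_ofReal

/-- **Mean value of the truncated divisor sums of Barban and Vehov.** On the logarithmic scale the
squares of `∑_{d ∣ n} μ(d) P(log d / L)`, weighted by `1 / n`, have at `y > 0` the density
`∫₀^y P'(t)² dt`. -/
theorem tendsto_tsum_barbanVehov_sq {P K : ℝ → ℝ} (hP : ContDiff ℝ ∞ P)
    (hPc : HasCompactSupport P) (hK : ContDiff ℝ ∞ K) (hKc : HasCompactSupport K) (hK0 : K 0 = 0) :
    Tendsto (fun L : ℝ => ∑' n : ℕ, barbanVehov P L n ^ 2 * (K (Real.log n / L) / n)) atTop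
      (𝓝 (∫ T : ℝ × ℝ, K (T.1 + T.2) * deriv P T.2 ^ 2
        ∂((volume.restrict (Set.Ioi (0 : ℝ))).prod (volume.restrict (Set.Ioi (0 : ℝ)))))) := by
  obtain ⟨p, hp, hpi, hprep, hpd⟩ := exists_fourier_density hP hPc
  obtain ⟨k, hk, hki, hkrep, -⟩ := exists_fourier_density (f := fun t => Real.exp t * K t)
    (Real.contDiff_exp.mul hK) hKc.mul_left
  obtain ⟨C, hC, hbd⟩ := exists_norm_twistedSeries_le
  suffices h : Tendsto (fun L : ℝ =>
      ((∑' n : ℕ, barbanVehov P L n ^ 2 * (K (Real.log n / L) / n) : ℝ) : ℂ)) atTop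
      (𝓝 ((∫ T : ℝ × ℝ, K (T.1 + T.2) * deriv P T.2 ^ 2
        ∂((volume.restrict (Set.Ioi (0 : ℝ))).prod (volume.restrict (Set.Ioi (0 : ℝ)))) : ℝ) : ℂ)) from
    (continuous_re.tendsto _).comp h
  rw [← integral_limit_eq hp hk hpi hki hpd hkrep hK0]
  have hp2 : Integrable fun z : ℝ => ‖p z‖ * (1 + z ^ 2) := by
    refine ((hpi 0).add (hpi 2)).congr (Eventually.of_forall fun z => ?_)
    simp only [Pi.add_apply, pow_zero, sq_abs]; ring
  have hk4 : Integrable fun z : ℝ => ‖k z‖ * (1 + z ^ 2) ^ 2 := by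
    refine (((hki 0).add ((hki 2).const_mul 2)).add (hki 4)).congr
      (Eventually.of_forall fun z => ?_)
    have : |z| ^ 4 = z ^ 4 := by rw [show 4 = 2 * 2 from rfl, pow_mul, sq_abs, ← pow_mul]
    simp only [Pi.add_apply, pow_zero, sq_abs, this]; ring
  have hlim := tendsto_integral_filter_of_dominated_convergence
    (μ := (volume : Measure ℝ).prod ((volume : Measure ℝ).prod (volume : Measure ℝ)))
    (l := (atTop : Filter ℝ))
    (F := fun (L : ℝ) (w : ℝ × ℝ × ℝ) => k w.1 * (p w.2.1 * p w.2.2) *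
      twistedSeries (nearOne L w.1) (w.2.1 / L) (w.2.2 / L))
    (f := fun w : ℝ × ℝ × ℝ => k w.1 * (p w.2.1 * p w.2.2) *
        ((1 + ((w.1 + w.2.1 : ℝ) : ℂ) * I) * (1 + ((w.1 + w.2.2 : ℝ) : ℂ) * I) /
          ((1 + (w.1 : ℂ) * I) * (1 + ((w.1 + w.2.1 + w.2.2 : ℝ) : ℂ) * I))))
    (fun w : ℝ × ℝ × ℝ => C * (‖k w.1‖ * (1 + w.1 ^ 2) ^ 2 *
      (‖p w.2.1‖ * (1 + w.2.1 ^ 2) * (‖p w.2.2‖ * (1 + w.2.2 ^ 2)))))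
    (by
      filter_upwards [eventually_gt_atTop 0] with L hL
      have hc : Continuous fun w : ℝ × ℝ × ℝ => k w.1 * (p w.2.1 * p w.2.2) := by fun_prop
      exact (hc.mul (continuous_twistedSeries hL)).aestronglyMeasurable)
    (by
      filter_upwards [eventually_ge_atTop 1] with L hL
      refine Eventually.of_forall fun w => ?_
      rw [norm_mul, norm_mul, norm_mul]
      calc _ ≤ ‖k w.1‖ * (‖p w.2.1‖ * ‖p w.2.2‖) *
            (C * ((1 + w.1 ^ 2) ^ 2 * (1 + w.2.1 ^ 2) * (1 + w.2.2 ^ 2))) :=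
            mul_le_mul_of_nonneg_left (hbd L hL _ _ _) (by positivity)
        _ = _ := by ring)
    ((hk4.mul_prod (hp2.mul_prod hp2)).const_mul C)
    (Eventually.of_forall fun w => (tendsto_twistedSeries w.1 w.2.1 w.2.2).const_mul _)
  refine hlim.congr' ?_
  filter_upwards [eventually_gt_atTop 0] with L hL
  exact (tsum_barbanVehov_eq_integral hp hk hpi hki hprep hkrep hL).symm

end BarbanVehov

/-! ### The choice of the cutoff functions -/

section Cutoff
open Filter Topology MeasureTheory Set
open scoped ContDiff

/-- A smooth even cutoff, equal to `1` on `[-a, a]` and to `0` off `[-(a + b), a + b]`, whose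
derivative on the positive axis is `-g`, where `g` is a probability density which is symmetric
about `a + b / 2` and is nearly bounded by `1 / b`. -/
lemma exists_smooth_cutoff {a b η : ℝ} (ha : 0 < a) (hb : 0 < b) (hη : 0 < η) :
    ∃ P : ℝ → ℝ, ContDiff ℝ ∞ P ∧ HasCompactSupport P ∧ (∀ t, |t| ≤ a → P t = 1) ∧
      (∀ t, a + b ≤ |t| → P t = 0) ∧ (∀ t, |P t| ≤ 1) ∧
      ∃ g : ℝ → ℝ, Continuous g ∧ (∀ t, 0 ≤ g t) ∧ (∀ t, g t ≤ (1 + η) / b) ∧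
        (∀ t, g (-t) = g t) ∧ (∀ t, b / 2 ≤ |t| → g t = 0) ∧ ∫ t, g t = 1 ∧
        ∀ t, 0 < t → deriv P t = -g (t - (a + b / 2)) := by
  let φ : ContDiffBump (0 : ℝ) :=
    { rIn := b / 2 / (1 + η)
      rOut := b / 2
      rIn_pos := by positivity
      rIn_lt_rOut := by
        rw [div_lt_iff₀ (by positivity)]
        nlinarith }
  set g : ℝ → ℝ := φ.normed volume with hg
  have hgc : Continuous g := φ.continuous_normed
  have hgd : ContDiff ℝ ∞ g := φ.contDiff_normed
  have hg0 : ∀ t, 0 ≤ g t := fun t => φ.nonneg_normed t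
  have hgi : Integrable g := φ.integrable_normed
  have hg1 : ∫ t, g t = 1 := φ.integral_normed
  have hgs : ∀ t, b / 2 ≤ |t| → g t = 0 := by
    intro t ht
    rw [hg, ContDiffBump.normed, φ.zero_of_le_dist (by simpa using ht), zero_div]
  have hgb : ∀ t, g t ≤ (1 + η) / b := by
    intro t
    refine (φ.normed_le_div_measure_closedBall_rIn volume t).trans_eq ?_
    have : φ.rIn = b / 2 / (1 + η) := rfl
    rw [measureReal_def, Real.volume_closedBall, this, ENNReal.toReal_ofReal (by positivity)]
    field_simp
  -- `P t` is the integral of `g` over `[t - m, t + m]`, where `m = a + b / 2`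
  set G : ℝ → ℝ := fun t => ∫ y in (0 : ℝ)..t, g y with hG
  have hGd : ∀ t, HasDerivAt G (g t) t := fun t =>
    intervalIntegral.integral_hasDerivAt_right (hgc.intervalIntegrable _ _)
      (hgc.stronglyMeasurableAtFilter _ _) hgc.continuousAt
  have hGs : ContDiff ℝ ∞ G := by
    rw [contDiff_infty_iff_deriv]
    refine ⟨fun t => (hGd t).differentiableAt, ?_⟩
    rw [show deriv G = g from funext fun t => (hGd t).deriv]
    exact hgd
  set m : ℝ := a + b / 2 with hm
  set P : ℝ → ℝ := fun t => G (t + m) - G (t - m) with hP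
  have hPint : ∀ t, P t = ∫ y in (t - m)..(t + m), g y := by
    intro t
    rw [hP, hG]
    simp only
    rw [intervalIntegral.integral_interval_sub_left (hgc.intervalIntegrable _ _)
      (hgc.intervalIntegrable _ _)]
  have hP0 : ∀ t, a + b ≤ |t| → P t = 0 := by
    intro t ht
    rw [hPint, intervalIntegral.integral_congr (g := fun _ => (0 : ℝ)), intervalIntegral.integral_zero]
    intro y hy
    rw [Set.uIcc_of_le (by rw [hm]; linarith)] at hy
    apply hgs
    rcases le_abs.mp ht with h | h
    · exact (by rw [hm] at hy; linarith [hy.1] : b / 2 ≤ y).trans (le_abs_self y)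
    · exact (by rw [hm] at hy; linarith [hy.2] : b / 2 ≤ -y).trans (neg_le_abs y)
  refine ⟨P, ?_, ?_, ?_, hP0, ?_, g, hgc, hg0, hgb, fun t => φ.normed_neg t, hgs, hg1, ?_⟩
  · exact (hGs.comp (contDiff_id.add contDiff_const)).sub (hGs.comp (contDiff_id.sub contDiff_const))
  · refine HasCompactSupport.intro (isCompact_Icc (a := -(a + b)) (b := a + b)) fun t ht => hP0 t ?_
    rw [Set.mem_Icc, ← abs_le] at ht
    exact (not_le.mp ht).le
  · intro t ht
    rw [abs_le] at ht
    rw [hPint, intervalIntegral.integral_of_le (by rw [hm]; linarith), ← hg1]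
    refine setIntegral_eq_integral_of_forall_compl_eq_zero fun y hy => hgs y ?_
    rw [Set.mem_Ioc, not_and_or, not_lt, not_le] at hy
    rcases hy with h | h
    · exact (by rw [hm] at h; linarith [ht.2] : b / 2 ≤ -y).trans (neg_le_abs y)
    · exact (by rw [hm] at h; linarith [ht.1] : b / 2 ≤ y).trans (le_abs_self y)
  · intro t
    rw [hPint, intervalIntegral.integral_of_le (by rw [hm]; linarith),
      abs_of_nonneg (setIntegral_nonneg measurableSet_Ioc fun y _ => hg0 y), ← hg1]
    exact setIntegral_le_integral hgi (Eventually.of_forall hg0)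
  · intro t ht
    have h1 : HasDerivAt P (g (t + m) - g (t - m)) t :=
      ((hGd (t + m)).comp_add_const t m).sub ((hGd (t - m)).comp_sub_const t m)
    rw [h1.deriv, hgs (t + m) ((by rw [hm]; linarith : b / 2 ≤ t + m).trans (le_abs_self _)), zero_sub]

/-- The double integral which governs the Barban–Vehov sum: its inner integral is at most `y - t`,
and the symmetry of `g` replaces `t` by its mean value `m`. -/
lemma integral_cutoff_le {P K g : ℝ → ℝ} {m r M y : ℝ} (hP : ContDiff ℝ ∞ P)
    (hPc : HasCompactSupport P) (hK : Continuous K) (hKc : HasCompactSupport K)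
    (hK1 : ∀ t, K t ≤ 1) (hKy : ∀ t, y ≤ t → K t = 0)
    (hg : Continuous g) (hg0 : ∀ t, 0 ≤ g t) (hgM : ∀ t, g t ≤ M) (hge : ∀ t, g (-t) = g t)
    (hgs : ∀ t, r ≤ |t| → g t = 0) (hg1 : ∫ t, g t = 1) (hmy : m + r ≤ y)
    (hd : ∀ t, 0 < t → deriv P t = -g (t - m)) :
    ∫ T : ℝ × ℝ, K (T.1 + T.2) * deriv P T.2 ^ 2
      ∂((volume.restrict (Ioi 0)).prod (volume.restrict (Ioi 0))) ≤ M * (y - m) := by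
  have hM : 0 ≤ M := (hg0 0).trans (hgM 0)
  have hdP : Continuous (deriv P) := hP.continuous_deriv (by simp)
  have hgc : HasCompactSupport g := by
    refine HasCompactSupport.intro (isCompact_Icc (a := -r) (b := r)) fun t ht => hgs t ?_
    rw [Set.mem_Icc, ← abs_le] at ht
    exact (not_le.mp ht).le
  have hint : Integrable (fun T : ℝ × ℝ => K (T.1 + T.2) * deriv P T.2 ^ 2)
      ((volume.restrict (Ioi 0)).prod (volume.restrict (Ioi 0))) := by
    rw [Measure.prod_restrict]
    refine Integrable.restrict ?_
    refine Continuous.integrable_of_hasCompactSupport (by fun_prop) ?_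
    obtain ⟨A, hA⟩ := hKc.isCompact.isBounded.subset_closedBall 0
    obtain ⟨B, hB⟩ := hPc.deriv.isCompact.isBounded.subset_closedBall 0
    refine HasCompactSupport.intro ((isCompact_closedBall (0 : ℝ) (A + B)).prod
      (isCompact_closedBall (0 : ℝ) B)) fun T hT => ?_
    by_contra hne
    have h1 : K (T.1 + T.2) ≠ 0 := left_ne_zero_of_mul hne
    have h2 : deriv P T.2 ≠ 0 := fun h => hne (by rw [h]; simp)
    have h3 := hA (subset_tsupport _ h1)
    have h4 := hB (subset_tsupport _ h2)
    rw [mem_closedBall_zero_iff, Real.norm_eq_abs] at h3 h4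
    refine hT ⟨?_, ?_⟩
    · rw [mem_closedBall_zero_iff, Real.norm_eq_abs]
      calc |T.1| = |(T.1 + T.2) - T.2| := by ring_nf
        _ ≤ |T.1 + T.2| + |T.2| := abs_sub _ _
        _ ≤ A + B := add_le_add h3 h4
    · rwa [mem_closedBall_zero_iff, Real.norm_eq_abs]
  rw [integral_prod_symm _ hint]
  have hinner : ∀ t ∈ Ioi (0 : ℝ), ∫ τ in Ioi (0 : ℝ), K (τ + t) * deriv P t ^ 2 ≤
      M * (g (t - m) * (y - t)) := by
    intro t ht
    rw [integral_mul_const, hd t ht, neg_sq]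
    by_cases hty : r ≤ |t - m|
    · rw [hgs _ hty]; simp
    have hty' : t ≤ y := by
      have := (le_abs_self (t - m)).trans (not_le.mp hty).le
      linarith
    have h1 : ∫ τ in Ioi (0 : ℝ), K (τ + t) ≤ y - t := by
      have h2 : ∫ τ in Ioi (0 : ℝ), K (τ + t) ≤ ∫ τ in Ioi (0 : ℝ), (Ioc 0 (y - t)).indicator 1 τ := by
        refine setIntegral_mono_on ?_ ?_ measurableSet_Ioi fun τ hτ => ?_
        · exact ((hK.integrable_of_hasCompactSupport hKc).comp_add_right t).restrict
        · exact ((integrable_indicator_iff measurableSet_Ioc).mpr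
            (integrableOn_const (by simp))).restrict
        · by_cases h : τ ≤ y - t
          · rw [indicator_of_mem (show τ ∈ Ioc 0 (y - t) from ⟨hτ, h⟩)]; exact hK1 _
          · rw [hKy _ (by linarith [not_le.mp h])]
            exact indicator_nonneg (fun _ _ => zero_le_one) _
      refine h2.trans_eq ?_
      have hsub : Ioc 0 (y - t) ⊆ Ioi (0 : ℝ) := fun τ hτ => hτ.1
      rw [setIntegral_indicator measurableSet_Ioc, inter_eq_self_of_subset_right hsub]
      simp [hty']
    calc (∫ τ in Ioi (0 : ℝ), K (τ + t)) * g (t - m) ^ 2 ≤ (y - t) * (M * g (t - m)) := by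
          refine mul_le_mul h1 ?_ (sq_nonneg _) (by linarith)
          rw [sq]
          exact mul_le_mul_of_nonneg_right (hgM _) (hg0 _)
      _ = _ := by ring
  have hgy : Integrable fun t => g (t - m) * (y - t) := by
    refine Continuous.integrable_of_hasCompactSupport (by fun_prop) ?_
    exact (hgc.comp_homeomorph (Homeomorph.subRight m)).mul_right
  have hodd : ∫ s, g s * s = 0 := by
    have h := integral_neg_eq_self (fun s => g s * s) volume
    simp only [hge, mul_neg] at h
    rw [integral_neg] at h
    linarith
  have hi1 : Integrable fun s => g s * (y - m) :=
    (hg.integrable_of_hasCompactSupport hgc).mul_const _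
  have hi2 : Integrable fun s => g s * s :=
    Continuous.integrable_of_hasCompactSupport (by fun_prop) hgc.mul_right
  calc ∫ t in Ioi (0 : ℝ), ∫ τ in Ioi (0 : ℝ), K (τ + t) * deriv P t ^ 2
      ≤ ∫ t in Ioi (0 : ℝ), M * (g (t - m) * (y - t)) :=
        setIntegral_mono_on hint.integral_prod_right (hgy.const_mul M).restrict measurableSet_Ioi hinner
    _ ≤ ∫ t, M * (g (t - m) * (y - t)) := by
        refine setIntegral_le_integral (hgy.const_mul M) (Eventually.of_forall fun t => ?_)
        by_cases hty : r ≤ |t - m|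
        · simp [hgs _ hty]
        have := (le_abs_self (t - m)).trans (not_le.mp hty).le
        exact mul_nonneg hM (mul_nonneg (hg0 _) (by linarith))
    _ = M * ∫ s, (g s * (y - m) - g s * s) := by
        rw [integral_const_mul, ← integral_sub_right_eq_self (fun s => g s * (y - m) - g s * s) m]
        congr 2
        ext t
        ring
    _ = M * (y - m) := by
        rw [integral_sub hi1 hi2, hodd, integral_mul_const, hg1]
        ring

/-- The difference of two triangles: `0` at the origin, rising to `1 - U / X` at `U`, and falling to
`0` at `X`. -/
noncomputable def trapezoid (U X t : ℝ) : ℝ := max (1 - t / X) 0 - max (1 - t / U) 0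

lemma trapezoid_of_le {U X t : ℝ} (hU : 0 < U) (hUX : U ≤ X) (htU : t ≤ U) :
    trapezoid U X t = t / U - t / X := by
  have h1 : t / U ≤ 1 := (div_le_one hU).mpr htU
  have h2 : t / X ≤ 1 := (div_le_one (hU.trans_le hUX)).mpr (htU.trans hUX)
  rw [trapezoid, max_eq_left (by linarith), max_eq_left (by linarith)]
  ring

lemma trapezoid_of_ge {U X t : ℝ} (hU : 0 < U) (htU : U ≤ t) :
    trapezoid U X t = max (1 - t / X) 0 := by
  have h1 : 1 ≤ t / U := (one_le_div hU).mpr htU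
  rw [trapezoid, max_eq_right (b := 0) (a := 1 - t / U) (by linarith), sub_zero]

lemma trapezoid_nonneg {U X t : ℝ} (hU : 0 < U) (hUX : U ≤ X) (ht : 0 ≤ t) :
    0 ≤ trapezoid U X t := by
  rw [trapezoid, sub_nonneg]
  exact max_le_max (by gcongr) le_rfl

lemma trapezoid_le_one {U X t : ℝ} (hX : 0 < X) (ht : 0 ≤ t) : trapezoid U X t ≤ 1 := by
  have h1 : max (1 - t / X) 0 ≤ 1 := max_le (by linarith [div_nonneg ht hX.le]) zero_le_one
  have h2 : 0 ≤ max (1 - t / U) 0 := le_max_right _ _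
  rw [trapezoid]; linarith

lemma barbanVehov_one {P : ℝ → ℝ} (hP : P 0 = 1) (L : ℝ) : barbanVehov P L 1 = 1 := by
  simp [barbanVehov, hP]

/-- Below `e ^ (a * L)` the truncation is not felt, and the full sum of `μ` over the divisors vanishes. -/
lemma barbanVehov_eq_zero {P : ℝ → ℝ} {a L : ℝ} (hP : ∀ t, |t| ≤ a → P t = 1) (hL : 0 < L)
    {n : ℕ} (hn : 1 < n) (hna : (n : ℝ) ≤ Real.exp (a * L)) : barbanVehov P L n = 0 := by
  have h : ∀ d ∈ n.divisors, (ArithmeticFunction.moebius d : ℝ) * P (Real.log d / L) =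
      (ArithmeticFunction.moebius d : ℝ) := by
    intro d hd
    have hd0 : 0 < d := Nat.pos_of_mem_divisors hd
    have hdn : (d : ℝ) ≤ n := by exact_mod_cast Nat.divisor_le hd
    rw [hP, mul_one]
    rw [abs_of_nonneg (div_nonneg (Real.log_natCast_nonneg d) hL.le), div_le_iff₀ hL,
      Real.log_le_iff_le_exp (by positivity)]
    exact hdn.trans hna
  rw [barbanVehov, Finset.sum_congr rfl h, sum_divisors_moebius, if_neg hn.ne']

/-- The quadratic mean of the Barban–Vehov weights over `[U, X]`, `U = e ^ (a * L)`,
`X = e ^ (x * L)`. -/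
theorem exists_cutoff_sum_barbanVehov_sq_le {a b x ε : ℝ} (ha : 0 < a) (hb : 0 < b)
    (hx : a + b ≤ x) (hε : 0 < ε) :
    ∃ P : ℝ → ℝ, (∀ t, |t| ≤ a → P t = 1) ∧ (∀ t, a + b ≤ |t| → P t = 0) ∧ (∀ t, |P t| ≤ 1) ∧
      ∀ᶠ L : ℝ in atTop, ∑ n ∈ Finset.Icc 1 ⌊Real.exp (x * L)⌋₊, barbanVehov P L n ^ 2 *
        (trapezoid (Real.exp (a * L)) (Real.exp (x * L)) n / n) ≤ (x - a - b / 2) / b + ε := by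
  obtain ⟨η, hη, hηa, hηε⟩ : ∃ η : ℝ, 0 < η ∧ η < a ∧
      (1 + η) / b * (x + η - (a + b / 2)) < (x - a - b / 2) / b + ε / 3 := by
    have h1 : Tendsto (fun η : ℝ => (1 + η) / b * (x + η - (a + b / 2))) (𝓝[>] 0)
        (𝓝 ((1 + 0) / b * (x + 0 - (a + b / 2)))) := by
      refine Tendsto.mono_left (Continuous.tendsto ?_ 0) nhdsWithin_le_nhds
      fun_prop
    have h2 := h1.eventually_lt_const (u := (x - a - b / 2) / b + ε / 3) (by
      rw [show (1 + 0) / b * (x + 0 - (a + b / 2)) = (x - a - b / 2) / b by ring]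
      linarith)
    obtain ⟨η, h3, h4, h5⟩ := (h2.and ((eventually_mem_nhdsWithin (a := (0 : ℝ)) (s := Ioi 0)).and
      (mem_nhdsWithin_of_mem_nhds (Iio_mem_nhds ha)))).exists
    exact ⟨η, h4, h5, h3⟩
  obtain ⟨P, hP, hPc, hP1, hP0, hPb, g, hg, hg0, hgM, hge, hgs, hg1, hd⟩ :=
    exists_smooth_cutoff ha hb hη
  -- `φ` majorises the indicator function of `[a, x]`, and vanishes at `0` since `η < a`
  let φ : ContDiffBump ((a + x) / 2 : ℝ) :=
    { rIn := (x - a) / 2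
      rOut := (x - a) / 2 + η
      rIn_pos := by linarith
      rIn_lt_rOut := by linarith }
  have hφ0 : φ 0 = 0 := φ.zero_of_le_dist (by
    change (x - a) / 2 + η ≤ _
    rw [Real.dist_eq]
    exact (by linarith : (x - a) / 2 + η ≤ -(0 - (a + x) / 2)).trans (neg_le_abs _))
  have hlim := tendsto_tsum_barbanVehov_sq hP hPc φ.contDiff φ.hasCompactSupport hφ0
  have hI := integral_cutoff_le (m := a + b / 2) (r := b / 2) (M := (1 + η) / b) (y := x + η) hP hPc
    φ.continuous φ.hasCompactSupport (fun _ => φ.le_one)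
    (fun t ht => φ.zero_of_le_dist (by
      change (x - a) / 2 + η ≤ _
      rw [Real.dist_eq]
      exact (by linarith : (x - a) / 2 + η ≤ t - (a + x) / 2).trans (le_abs_self _)))
    hg hg0 hgM hge hgs hg1 (by linarith) hd
  refine ⟨P, hP1, hP0, hPb, ?_⟩
  have hsmall : ∀ᶠ L : ℝ in atTop, (Real.exp (a * L))⁻¹ < ε / 3 := by
    have : Tendsto (fun L : ℝ => (Real.exp (a * L))⁻¹) atTop (𝓝 0) :=
      (Real.tendsto_exp_atTop.comp (tendsto_id.const_mul_atTop ha)).inv_tendsto_atTop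
    exact this.eventually_lt_const (by linarith)
  filter_upwards [hlim.eventually_lt_const (u := (x - a - b / 2) / b + ε / 3 + ε / 3)
    (by linarith), hsmall, eventually_gt_atTop 0] with L h1 h2 hL
  set U := Real.exp (a * L) with hU
  set X := Real.exp (x * L) with hX
  have hU0 : 0 < U := Real.exp_pos _
  have hX0 : 0 < X := Real.exp_pos _
  have hUX : U ≤ X := Real.exp_le_exp.mpr (by gcongr; linarith)
  have hU1 : 1 ≤ U := Real.one_le_exp (by positivity)
  set f : ℕ → ℝ := fun n => barbanVehov P L n ^ 2 * (φ (Real.log n / L) / n) with hf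
  have hf0 : ∀ n, 0 ≤ f n := fun n =>
    mul_nonneg (sq_nonneg _) (div_nonneg φ.nonneg (Nat.cast_nonneg n))
  have hfs : Summable f := by
    refine summable_of_ne_finset_zero (s := Finset.range (⌊Real.exp ((x + η) * L)⌋₊ + 1)) fun n hn => ?_
    rw [Finset.mem_range, not_lt, Nat.succ_le_iff, Nat.floor_lt (Real.exp_pos _).le] at hn
    have h3 : x + η ≤ Real.log n / L := by
      rw [le_div_iff₀ hL, Real.le_log_iff_exp_le ((Real.exp_pos _).trans hn)]
      exact hn.le
    have h4 : φ (Real.log n / L) = 0 := φ.zero_of_le_dist (by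
      change (x - a) / 2 + η ≤ _
      rw [Real.dist_eq]
      exact (by linarith : (x - a) / 2 + η ≤ Real.log n / L - (a + x) / 2).trans (le_abs_self _))
    simp [hf, h4]
  have hterm : ∀ n ∈ Finset.Icc 1 ⌊X⌋₊, barbanVehov P L n ^ 2 * (trapezoid U X n / n) ≤
      f n + if n = 1 then U⁻¹ else 0 := by
    intro n hn
    rw [Finset.mem_Icc, Nat.le_floor_iff hX0.le] at hn
    have hn0 : (0 : ℝ) < n := by exact_mod_cast hn.1
    by_cases hn1 : n = 1
    · subst hn1
      rw [if_pos rfl, barbanVehov_one (hP1 0 (by simpa using ha.le)), Nat.cast_one,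
        trapezoid_of_le hU0 hUX hU1]
      have := hf0 1
      have h3 : 0 ≤ 1 / X := by positivity
      rw [one_div U]
      linarith
    · rw [if_neg hn1, add_zero]
      rcases le_total (n : ℝ) U with hnU | hnU
      · rw [barbanVehov_eq_zero hP1 hL (by omega) hnU]
        simpa using hf0 n
      · have h3 : a ≤ Real.log n / L := by
          rw [le_div_iff₀ hL, Real.le_log_iff_exp_le hn0]; exact hnU
        have h4 : Real.log n / L ≤ x := by
          rw [div_le_iff₀ hL, Real.log_le_iff_le_exp hn0]; exact hn.2
        have h5 : φ (Real.log n / L) = 1 := φ.one_of_mem_closedBall (by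
          change dist _ _ ≤ (x - a) / 2
          rw [Real.dist_eq, abs_le]
          constructor <;> linarith)
        rw [hf]
        simp only [h5]
        gcongr
        exact trapezoid_le_one hX0 hn0.le
  calc _ ≤ ∑ n ∈ Finset.Icc 1 ⌊X⌋₊, (f n + if n = 1 then U⁻¹ else 0) := Finset.sum_le_sum hterm
    _ ≤ ∑' n, f n + U⁻¹ := by
        rw [Finset.sum_add_distrib]
        refine add_le_add (hfs.sum_le_tsum _ fun n _ => hf0 n) ?_
        rw [Finset.sum_ite_eq']
        split_ifs
        · rfl
        · positivity
    _ ≤ _ := by linarith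
end Cutoff

/-! ### Sums over divisors and least common multiples -/

section DivisorSums

lemma sum_Icc_filter_dvd {𝕜 : Type*} [AddCommMonoid 𝕜] (F : ℕ → 𝕜) (N : ℕ) {D : ℕ} (hD : 0 < D) :
    ∑ n ∈ Icc 1 N with D ∣ n, F n = ∑ m ∈ Icc 1 (N / D), F (m * D) := by
  symm
  refine Finset.sum_nbij (fun m => m * D) ?_ ?_ ?_ fun _ _ => rfl
  · intro m hm
    rw [mem_Icc, Nat.le_div_iff_mul_le hD] at hm
    rw [mem_filter, mem_Icc]
    exact ⟨⟨Nat.mul_pos hm.1 hD, hm.2⟩, dvd_mul_left D m⟩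
  · intro m _ m' _ h
    exact Nat.eq_of_mul_eq_mul_right hD h
  · rintro n hn
    rw [mem_coe, mem_filter, mem_Icc] at hn
    obtain ⟨⟨h1, h2⟩, k, rfl⟩ := hn
    refine ⟨k, ?_, mul_comm _ _⟩
    rw [mem_coe, mem_Icc, Nat.le_div_iff_mul_le hD, mul_comm k]
    exact ⟨Nat.pos_of_mul_pos_left h1, h2⟩

lemma sum_divisors_eq_sum_Icc {𝕜 : Type*} [AddCommMonoid 𝕜] {α : ℕ → 𝕜} {A : ℕ}
    (hα : ∀ d, α d ≠ 0 → d ∈ Icc 1 A) {n : ℕ} (hn : n ≠ 0) :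
    ∑ d ∈ n.divisors, α d = ∑ d ∈ Icc 1 A, if d ∣ n then α d else 0 := by
  rw [← sum_filter]
  symm
  refine sum_subset (fun d hd => ?_) fun d hd hd' => ?_
  · exact Nat.mem_divisors.mpr ⟨(mem_filter.mp hd).2, hn⟩
  · by_contra h
    exact hd' (mem_filter.mpr ⟨hα d h, Nat.dvd_of_mem_divisors hd⟩)

lemma sum_mul_sum_divisors {𝕜 : Type*} [CommSemiring 𝕜] {α β : ℕ → 𝕜} {A B : ℕ}
    (hα : ∀ d, α d ≠ 0 → d ∈ Icc 1 A) (hβ : ∀ e, β e ≠ 0 → e ∈ Icc 1 B) (N : ℕ) (F : ℕ → 𝕜) :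
    ∑ n ∈ Icc 1 N, (∑ d ∈ n.divisors, α d) * (∑ e ∈ n.divisors, β e) * F n =
      ∑ d ∈ Icc 1 A, ∑ e ∈ Icc 1 B, α d * β e * ∑ m ∈ Icc 1 (N / d.lcm e), F (m * d.lcm e) := by
  have h1 : ∀ n ∈ Icc 1 N, (∑ d ∈ n.divisors, α d) * (∑ e ∈ n.divisors, β e) * F n =
      ∑ d ∈ Icc 1 A, ∑ e ∈ Icc 1 B, α d * β e * if d.lcm e ∣ n then F n else 0 := by
    intro n hn
    have hn0 : n ≠ 0 := by have := (mem_Icc.mp hn).1; omega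
    rw [sum_divisors_eq_sum_Icc hα hn0, sum_divisors_eq_sum_Icc hβ hn0, sum_mul_sum, sum_mul]
    refine sum_congr rfl fun d _ => ?_
    rw [sum_mul]
    refine sum_congr rfl fun e _ => ?_
    by_cases hd : d ∣ n <;> by_cases he : e ∣ n <;> simp [hd, he, Nat.lcm_dvd_iff]
  rw [sum_congr rfl h1, sum_comm]
  refine sum_congr rfl fun d hd => ?_
  rw [sum_comm]
  refine sum_congr rfl fun e he => ?_
  rw [← mul_sum, ← sum_filter, sum_Icc_filter_dvd]
  exact Nat.lcm_pos (mem_Icc.mp hd).1 (mem_Icc.mp he).1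

lemma sum_Icc_rpow_neg_half_le (A : ℕ) :
    ∑ d ∈ Icc 1 A, (d : ℝ) ^ (-(1 / 2) : ℝ) ≤ 2 * (A : ℝ) ^ (1 / 2 : ℝ) := by
  simp_rw [Real.rpow_neg (Nat.cast_nonneg _), ← Real.sqrt_eq_rpow]
  induction A with
  | zero => simp
  | succ n ih =>
    rw [sum_Icc_succ_top (by omega)]
    have h1 : 0 < √((n + 1 : ℕ) : ℝ) := Real.sqrt_pos.mpr (by positivity)
    have h2 : √((n + 1 : ℕ) : ℝ) ^ 2 = (n : ℝ) + 1 := by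
      rw [Real.sq_sqrt (by positivity)]; push_cast; ring
    have h3 : √(n : ℝ) ^ 2 = n := Real.sq_sqrt (by positivity)
    have h4 : 0 ≤ √(n : ℝ) := Real.sqrt_nonneg _
    have h5 : (√((n + 1 : ℕ) : ℝ))⁻¹ ≤ 2 * √((n + 1 : ℕ) : ℝ) - 2 * √(n : ℝ) := by
      rw [inv_le_iff_one_le_mul₀ h1]
      nlinarith [sq_nonneg (√((n + 1 : ℕ) : ℝ) - √(n : ℝ))]
    linarith

lemma sum_Icc_filter_dvd_rpow_le (A : ℕ) {g : ℕ} (hg : 0 < g) :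
    ∑ d ∈ Icc 1 A with g ∣ d, (d : ℝ) ^ (-(1 / 2) : ℝ) ≤ 2 * (A : ℝ) ^ (1 / 2 : ℝ) * (g : ℝ)⁻¹ := by
  have hg0 : (0 : ℝ) < g := by exact_mod_cast hg
  rw [sum_Icc_filter_dvd _ _ hg]
  simp_rw [Nat.cast_mul, Real.mul_rpow (Nat.cast_nonneg _) (Nat.cast_nonneg _)]
  rw [← sum_mul]
  have h1 : ((A / g : ℕ) : ℝ) ^ (1 / 2 : ℝ) ≤ (A : ℝ) ^ (1 / 2 : ℝ) * (g : ℝ) ^ (-(1 / 2) : ℝ) := by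
    rw [Real.rpow_neg hg0.le, ← div_eq_mul_inv, ← Real.div_rpow (by positivity) hg0.le]
    exact Real.rpow_le_rpow (by positivity) Nat.cast_div_le (by norm_num)
  have h2 : (g : ℝ) ^ (-(1 / 2) : ℝ) * (g : ℝ) ^ (-(1 / 2) : ℝ) = (g : ℝ)⁻¹ := by
    rw [← Real.rpow_add hg0, ← Real.rpow_neg_one]; norm_num
  calc _ ≤ 2 * ((A : ℝ) ^ (1 / 2 : ℝ) * (g : ℝ) ^ (-(1 / 2) : ℝ)) * (g : ℝ) ^ (-(1 / 2) : ℝ) := by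
        gcongr
        exact (sum_Icc_rpow_neg_half_le _).trans (by gcongr)
    _ = 2 * (A : ℝ) ^ (1 / 2 : ℝ) * ((g : ℝ) ^ (-(1 / 2) : ℝ) * (g : ℝ) ^ (-(1 / 2) : ℝ)) := by ring
    _ = _ := by rw [h2]

/-- The factor `(d, e) ^ (1 / 2)` is bounded by a sum over the common divisors of `d` and `e`. -/
lemma exists_sum_lcm_rpow_le : ∃ C : ℝ, 0 < C ∧ ∀ A B : ℕ,
    ∑ d ∈ Icc 1 A, ∑ e ∈ Icc 1 B, (d.lcm e : ℝ) ^ (-(1 / 2) : ℝ) ≤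
      C * ((A : ℝ) ^ (1 / 2 : ℝ) * (B : ℝ) ^ (1 / 2 : ℝ)) := by
  have hs : Summable fun g : ℕ => (g : ℝ) ^ (-(3 / 2) : ℝ) := Real.summable_nat_rpow.mpr (by norm_num)
  have hs0 : ∀ g : ℕ, 0 ≤ (g : ℝ) ^ (-(3 / 2) : ℝ) := fun g => by positivity
  refine ⟨4 * ∑' g : ℕ, (g : ℝ) ^ (-(3 / 2) : ℝ), ?_, fun A B => ?_⟩
  · have := hs.le_tsum 1 fun g _ => hs0 g
    rw [Nat.cast_one, Real.one_rpow] at this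
    linarith
  have h1 : ∀ d ∈ Icc 1 A, ∀ e ∈ Icc 1 B, (d.lcm e : ℝ) ^ (-(1 / 2) : ℝ) ≤
      ∑ g ∈ Icc 1 A, (g : ℝ) ^ (1 / 2 : ℝ) * ((if g ∣ d then (d : ℝ) ^ (-(1 / 2) : ℝ) else 0) *
        (if g ∣ e then (e : ℝ) ^ (-(1 / 2) : ℝ) else 0)) := by
    intro d hd e he
    rw [mem_Icc] at hd he
    have hg : 0 < d.gcd e := Nat.gcd_pos_of_pos_left _ hd.1
    have hgA : d.gcd e ∈ Icc 1 A := mem_Icc.mpr ⟨hg, (Nat.gcd_le_left _ hd.1).trans hd.2⟩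
    have h2 : (d.lcm e : ℝ) ^ (-(1 / 2) : ℝ) = ((d.gcd e : ℕ) : ℝ) ^ (1 / 2 : ℝ) *
        ((d : ℝ) ^ (-(1 / 2) : ℝ) * (e : ℝ) ^ (-(1 / 2) : ℝ)) := by
      have h3 : ((d.gcd e : ℕ) : ℝ) * (d.lcm e : ℝ) = d * e := by exact_mod_cast Nat.gcd_mul_lcm d e
      have hg0 : (0 : ℝ) < (d.gcd e : ℕ) := by exact_mod_cast hg
      rw [← Real.mul_rpow (by positivity) (by positivity), ← h3, Real.mul_rpow hg0.le (by positivity),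
        ← mul_assoc, ← Real.rpow_add hg0]
      norm_num
    rw [h2]
    have h4 := single_le_sum (f := fun g : ℕ => (g : ℝ) ^ (1 / 2 : ℝ) *
      ((if g ∣ d then (d : ℝ) ^ (-(1 / 2) : ℝ) else 0) *
        (if g ∣ e then (e : ℝ) ^ (-(1 / 2) : ℝ) else 0))) (fun g _ => by positivity) hgA
    simpa [Nat.gcd_dvd_left, Nat.gcd_dvd_right] using h4
  calc _ ≤ ∑ d ∈ Icc 1 A, ∑ e ∈ Icc 1 B, ∑ g ∈ Icc 1 A, (g : ℝ) ^ (1 / 2 : ℝ) *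
        ((if g ∣ d then (d : ℝ) ^ (-(1 / 2) : ℝ) else 0) *
          (if g ∣ e then (e : ℝ) ^ (-(1 / 2) : ℝ) else 0)) :=
        sum_le_sum fun d hd => sum_le_sum fun e he => h1 d hd e he
    _ = ∑ g ∈ Icc 1 A, (g : ℝ) ^ (1 / 2 : ℝ) *
        ((∑ d ∈ Icc 1 A with g ∣ d, (d : ℝ) ^ (-(1 / 2) : ℝ)) *
          ∑ e ∈ Icc 1 B with g ∣ e, (e : ℝ) ^ (-(1 / 2) : ℝ)) := by
        simp_rw [sum_filter, sum_mul_sum, mul_sum]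
        rw [sum_congr rfl fun d _ => sum_comm, sum_comm]
    _ ≤ ∑ g ∈ Icc 1 A, 4 * ((A : ℝ) ^ (1 / 2 : ℝ) * (B : ℝ) ^ (1 / 2 : ℝ)) *
          (g : ℝ) ^ (-(3 / 2) : ℝ) := by
        refine sum_le_sum fun g hg => ?_
        have hg1 : 0 < g := (mem_Icc.mp hg).1
        have hg0 : (0 : ℝ) < g := by exact_mod_cast hg1
        have h5 : (g : ℝ) ^ (-(3 / 2) : ℝ) = (g : ℝ) ^ (1 / 2 : ℝ) * ((g : ℝ)⁻¹ * (g : ℝ)⁻¹) := by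
          rw [← Real.rpow_neg_one, ← Real.rpow_add hg0, ← Real.rpow_add hg0]; norm_num
        calc _ ≤ (g : ℝ) ^ (1 / 2 : ℝ) * ((2 * (A : ℝ) ^ (1 / 2 : ℝ) * (g : ℝ)⁻¹) *
              (2 * (B : ℝ) ^ (1 / 2 : ℝ) * (g : ℝ)⁻¹)) := by
              gcongr
              · exact sum_Icc_filter_dvd_rpow_le A hg1
              · exact sum_Icc_filter_dvd_rpow_le B hg1
          _ = _ := by rw [h5]; ring
    _ ≤ _ := by
        rw [← mul_sum]
        have := hs.sum_le_tsum (Icc 1 A) fun g _ => hs0 g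
        calc _ ≤ 4 * ((A : ℝ) ^ (1 / 2 : ℝ) * (B : ℝ) ^ (1 / 2 : ℝ)) *
              ∑' g : ℕ, (g : ℝ) ^ (-(3 / 2) : ℝ) := by gcongr
          _ = _ := by ring
end DivisorSums

/-! ### Character sums weighted by divisor sums -/

section CharacterSums
open Complex

/-- A character sum twisted by two divisor sums, compared with its main term: the sum over the
multiples of `[d, e]` is a smoothed sum of length `Y / [d, e]`, which `ℓ` approximates. -/
lemma norm_sum_divisors_smooth_sub_le {q : ℕ} (χ : DirichletCharacter ℂ q) {s ℓ : ℂ} {M C Y V R : ℝ}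
    (hC : ∀ A B : ℕ, ∑ d ∈ Icc 1 A, ∑ e ∈ Icc 1 B, (d.lcm e : ℝ) ^ (-(1 / 2) : ℝ) ≤
      C * ((A : ℝ) ^ (1 / 2 : ℝ) * (B : ℝ) ^ (1 / 2 : ℝ))) (hC0 : 0 ≤ C) (hM : 0 ≤ M)
    (hχ : ∀ Y : ℝ, 1 ≤ Y → ‖smoothSum χ s Y - ℓ‖ ≤ M * Y ^ (1 / 2 - s.re))
    {α β : ℕ → ℝ} (hα : ∀ d, α d ≠ 0 → d ∈ Icc 1 ⌊V⌋₊) (hβ : ∀ d, β d ≠ 0 → d ∈ Icc 1 ⌊R⌋₊)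
    (hα1 : ∀ d, |α d| ≤ 1) (hβ1 : ∀ d, |β d| ≤ 1) (hV : 0 ≤ V) (hR : 0 ≤ R) (hVR : V * R ≤ Y)
    (hY : 0 < Y) {N : ℕ} (hN : ⌊Y⌋₊ ≤ N) :
    ‖∑ n ∈ Icc 1 N, ((∑ d ∈ n.divisors, α d : ℝ) : ℂ) * ((∑ e ∈ n.divisors, β e : ℝ) : ℂ) *
        (χ n * (n : ℂ) ^ (-s) * ((max (1 - n / Y) 0 : ℝ) : ℂ)) -
      (∑ d ∈ Icc 1 ⌊V⌋₊, ∑ e ∈ Icc 1 ⌊R⌋₊, (α d : ℂ) * β e *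
        (χ (d.lcm e : ℕ) * ((d.lcm e : ℕ) : ℂ) ^ (-s))) * ℓ‖ ≤
      M * C * Y ^ (1 / 2 - s.re) * (V * R) ^ (1 / 2 : ℝ) := by
  have h1 := sum_mul_sum_divisors (𝕜 := ℂ) (α := fun d => (α d : ℂ)) (β := fun d => (β d : ℂ))
    (A := ⌊V⌋₊) (B := ⌊R⌋₊) (fun d h => hα d (by simpa using h)) (fun d h => hβ d (by simpa using h))
    N (fun n => χ n * (n : ℂ) ^ (-s) * ((max (1 - n / Y) 0 : ℝ) : ℂ))
  simp_rw [ofReal_sum]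
  rw [h1, sum_mul, ← sum_sub_distrib]
  have hlcm : ∀ d ∈ Icc 1 ⌊V⌋₊, ∀ e ∈ Icc 1 ⌊R⌋₊, 0 < d.lcm e := fun d hd e he =>
    Nat.lcm_pos (mem_Icc.mp hd).1 (mem_Icc.mp he).1
  have hinner : ∀ D : ℕ, 0 < D →
      ∑ m ∈ Icc 1 (N / D), χ (m * D : ℕ) * ((m * D : ℕ) : ℂ) ^ (-s) *
        ((max (1 - (m * D : ℕ) / Y) 0 : ℝ) : ℂ) =
      χ D * (D : ℂ) ^ (-s) * smoothSum χ s (Y / D) := by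
    intro D hD
    have hD0 : (0 : ℝ) < D := by exact_mod_cast hD
    rw [smoothSum_eq_sum_max χ s (div_pos hY hD0) (M := N / D) (by
      rw [Nat.floor_div_natCast]; exact Nat.div_le_div_right hN), mul_sum]
    refine sum_congr rfl fun m _ => ?_
    have h2 : (m * D : ℕ) / Y = (m : ℝ) / (Y / D) := by push_cast; field_simp
    rw [h2, Nat.cast_mul, Nat.cast_mul, map_mul, natCast_mul_natCast_cpow]
    ring
  calc _ ≤ ∑ d ∈ Icc 1 ⌊V⌋₊, ∑ e ∈ Icc 1 ⌊R⌋₊,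
        M * Y ^ (1 / 2 - s.re) * (d.lcm e : ℝ) ^ (-(1 / 2) : ℝ) := by
        refine (norm_sum_le _ _).trans (sum_le_sum fun d hd => ?_)
        rw [sum_mul, ← sum_sub_distrib]
        refine (norm_sum_le _ _).trans (sum_le_sum fun e he => ?_)
        have hD := hlcm d hd e he
        have hD0 : (0 : ℝ) < (d.lcm e : ℕ) := by exact_mod_cast hD
        have hDY : 1 ≤ Y / (d.lcm e : ℕ) := by
          rw [one_le_div hD0]
          refine le_trans ?_ hVR
          have h3 : ((d.lcm e : ℕ) : ℝ) ≤ d * e := by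
            exact_mod_cast Nat.le_of_dvd (Nat.mul_pos (mem_Icc.mp hd).1 (mem_Icc.mp he).1)
              (Nat.lcm_dvd_mul d e)
          refine h3.trans ?_
          gcongr
          · exact (Nat.le_floor_iff hV).mp (mem_Icc.mp hd).2
          · exact (Nat.le_floor_iff hR).mp (mem_Icc.mp he).2
        rw [hinner _ hD]
        calc _ = ‖(α d : ℂ)‖ * ‖(β e : ℂ)‖ * (‖χ (d.lcm e : ℕ)‖ * ‖((d.lcm e : ℕ) : ℂ) ^ (-s)‖) *
              ‖smoothSum χ s (Y / (d.lcm e : ℕ)) - ℓ‖ := by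
              rw [← norm_mul, ← norm_mul, ← norm_mul, ← norm_mul]
              congr 1; ring
          _ ≤ 1 * 1 * (1 * ((d.lcm e : ℕ) : ℝ) ^ (-s.re)) *
              (M * (Y / (d.lcm e : ℕ)) ^ (1 / 2 - s.re)) := by
              gcongr
              · rw [norm_real]; exact hα1 d
              · rw [norm_real]; exact hβ1 e
              · exact χ.norm_le_one _
              · rw [norm_natCast_cpow_of_pos hD, neg_re]
              · exact hχ _ hDY
          _ = _ := by
              rw [Real.div_rpow hY.le hD0.le, one_mul, one_mul, one_mul, div_eq_mul_inv,
                ← Real.rpow_neg hD0.le]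
              have h4 : ((d.lcm e : ℕ) : ℝ) ^ (-(1 / 2) : ℝ) =
                  ((d.lcm e : ℕ) : ℝ) ^ (-s.re) * ((d.lcm e : ℕ) : ℝ) ^ (-(1 / 2 - s.re)) := by
                rw [← Real.rpow_add hD0]; ring_nf
              rw [h4]; ring
    _ = M * Y ^ (1 / 2 - s.re) * ∑ d ∈ Icc 1 ⌊V⌋₊, ∑ e ∈ Icc 1 ⌊R⌋₊,
        (d.lcm e : ℝ) ^ (-(1 / 2) : ℝ) := by simp_rw [mul_sum]
    _ ≤ M * Y ^ (1 / 2 - s.re) * (C * ((V : ℝ) ^ (1 / 2 : ℝ) * (R : ℝ) ^ (1 / 2 : ℝ))) := by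
        gcongr
        refine (hC _ _).trans ?_
        gcongr
        · exact Nat.floor_le hV
        · exact Nat.floor_le hR
    _ = _ := by rw [Real.mul_rpow hV hR]; ring
end CharacterSums

/-! ### The mollified sum at a zero and the off-diagonal terms -/

section UnderGLH
open Complex Filter Topology

lemma tendsto_log_natCast_atTop : Tendsto (fun q : ℕ => Real.log q) atTop atTop :=
  Real.tendsto_log_atTop.comp tendsto_natCast_atTop_atTop

lemma eventually_mul_exp_log_sub_le (C y : ℝ) {κ η : ℝ} (hκ : 0 < κ) (hη : 0 < η) :
    ∀ᶠ L : ℝ in atTop, C * Real.exp (y * Real.log L - κ * L) ≤ η := by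
  have h := (tendsto_rpow_mul_exp_neg_mul_atTop_nhds_zero y κ hκ).const_mul C
  rw [mul_zero] at h
  filter_upwards [h.eventually_le_const hη, eventually_gt_atTop 0] with L h1 hL
  rw [sub_eq_add_neg, Real.exp_add, mul_comm y, ← Real.rpow_def_of_pos hL, ← neg_mul]
  exact h1

lemma eventually_log_le_mul {c : ℝ} (hc : 0 < c) : ∀ᶠ L : ℝ in atTop, Real.log L ≤ c * L := by
  have h := Real.isLittleO_log_id_atTop.def hc
  filter_upwards [h, eventually_gt_atTop 0] with L h1 hL
  rw [id, Real.norm_eq_abs, Real.norm_eq_abs, abs_of_pos hL] at h1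
  exact (le_abs_self _).trans h1

lemma natCast_rpow_eq_exp {q : ℕ} (hq : q ≠ 0) (y : ℝ) :
    (q : ℝ) ^ y = Real.exp (y * Real.log q) := by
  rw [Real.rpow_def_of_pos (by positivity), mul_comm]

lemma exp_mul_rpow (y L t : ℝ) : Real.exp (y * L) ^ t = Real.exp (t * y * L) := by
  rw [← Real.exp_mul]; ring_nf

/-- At a zero of `L(s, χ)` near `1` the part of the mollified sum of length `X` is negligible, and the
part of length `U` consists of the term `n = 1` alone. -/
theorem GLH.eventually_norm_mollifiedSum_add_one_le (hGLH : GLH) {a b r x η : ℝ} (ha : 0 < a)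
    (hb : 0 < b) (hra : r < a / 2) (hx : x = a + b + a / 2) (hη : 0 < η) {P : ℝ → ℝ}
    (hP1 : ∀ t, |t| ≤ a → P t = 1) (hP0 : ∀ t, a + b ≤ |t| → P t = 0) (hPb : ∀ t, |P t| ≤ 1) :
    ∀ᶠ q : ℕ in atTop, ∀ [NeZero q] (χ : DirichletCharacter ℂ q) (ρ : ℂ) (w : ℕ → ℝ), χ ≠ 1 →
      χ.LFunction ρ = 0 → ρ.re ≤ 1 → |ρ.im| ≤ 1 → zeroDepth q ρ ≤ Real.log (Real.log q) →
      w 1 = 1 → (∀ d, |w d| ≤ 1) → (∀ d, w d ≠ 0 → d ∈ Icc 1 ⌊Real.exp (r * Real.log q)⌋₊) →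
      ‖∑ n ∈ Icc 1 ⌊Real.exp (x * Real.log q)⌋₊, (barbanVehov P (Real.log q) n : ℂ) *
        ((∑ e ∈ n.divisors, w e : ℝ) : ℂ) * (χ n * (n : ℂ) ^ (-ρ) *
          (trapezoid (Real.exp (a * Real.log q)) (Real.exp (x * Real.log q)) n : ℂ)) + 1‖ ≤ η := by
  obtain ⟨C₀, hC₀, hC⟩ := exists_sum_lcm_rpow_le
  set κ : ℝ := (a / 2 - r) / 4 with hκ
  have hκ0 : 0 < κ := by rw [hκ]; linarith
  obtain ⟨C₁, hC₁, hsm⟩ := hGLH.norm_smoothSum_sub_le hκ0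
  have hE := tendsto_log_natCast_atTop.eventually ((eventually_mul_exp_log_sub_le (C₁ * C₀) x
    hκ0 (half_pos hη)).and ((eventually_log_le_mul (c := 1 / 4) (by norm_num)).and
    ((eventually_mul_exp_log_sub_le 1 0 ha (half_pos hη)).and (eventually_gt_atTop 0))))
  filter_upwards [hE] with q hq _ χ ρ w hχ hρ hρ1 hρi hdepth hw1 hwb hws
  obtain ⟨h1, h2, h3, hL⟩ := hq
  have hq0 : q ≠ 0 := NeZero.ne q
  set L := Real.log q with hLdef
  set U := Real.exp (a * L) with hU
  set X := Real.exp (x * L) with hX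
  set R := Real.exp (r * L) with hR
  set V := Real.exp ((a + b) * L) with hV
  have hx0 : 0 < x := by rw [hx]; positivity
  have hU0 : 0 < U := Real.exp_pos _
  have hX0 : 0 < X := Real.exp_pos _
  have hU1 : 1 ≤ U := Real.one_le_exp (by positivity)
  have hUX : U ≤ X := Real.exp_le_exp.mpr (by gcongr; rw [hx]; linarith)
  have hX1 : 1 ≤ ⌊X⌋₊ := by
    rw [Nat.one_le_floor_iff]; exact hU1.trans hUX
  set α : ℕ → ℝ := fun d => (ArithmeticFunction.moebius d : ℝ) * P (Real.log d / L) with hα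
  have hαs : ∀ d, α d ≠ 0 → d ∈ Icc 1 ⌊V⌋₊ := by
    intro d hd
    have hd0 : d ≠ 0 := by rintro rfl; simp [hα] at hd
    have hd1 : (1 : ℝ) ≤ d := by exact_mod_cast Nat.one_le_iff_ne_zero.mpr hd0
    rw [mem_Icc, Nat.le_floor_iff (Real.exp_pos _).le]
    refine ⟨Nat.one_le_iff_ne_zero.mpr hd0, ?_⟩
    by_contra hlt
    refine hd ?_
    rw [hα]
    simp only
    rw [hP0, mul_zero]
    rw [abs_of_nonneg (div_nonneg (Real.log_nonneg hd1) hL.le), le_div_iff₀ hL,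
      Real.le_log_iff_exp_le (by positivity)]
    exact (not_le.mp hlt).le
  have hαb : ∀ d, |α d| ≤ 1 := by
    intro d
    rw [hα]
    simp only
    rw [abs_mul]
    have h4 : |(ArithmeticFunction.moebius d : ℝ)| ≤ 1 := by
      exact_mod_cast ArithmeticFunction.abs_moebius_le_one
    exact mul_le_one₀ h4 (abs_nonneg _) (hPb _)
  have hdepth' : (1 - ρ.re) * L ≤ Real.log L := hdepth
  have hre : 3 / 4 ≤ ρ.re := by
    have : (1 - ρ.re) * L ≤ 1 / 4 * L := hdepth'.trans h2
    have := le_of_mul_le_mul_right this hL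
    linarith
  have hVR : V * R ≤ X := by
    rw [hV, hR, hX, ← Real.exp_add, ← add_mul]
    refine Real.exp_le_exp.mpr ?_
    gcongr
    rw [hx]; linarith
  have key := norm_sum_divisors_smooth_sub_le χ (s := ρ) (ℓ := 0) (M := C₁ * (q : ℝ) ^ κ) (Y := X)
    hC hC₀.le (by positivity) (fun Y hY => by
      have := hsm q χ hχ ρ Y hre hρ1 (by linarith) hY
      rwa [hρ] at this) hαs hws hαb hwb (Real.exp_pos _).le (Real.exp_pos _).le hVR hX0 le_rfl
  rw [mul_zero, sub_zero] at key
  -- `V R = X q ^ (-4 κ)` and `X ^ (1 - Re ρ) ≤ (log q) ^ x`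
  have hbound : C₁ * (q : ℝ) ^ κ * C₀ * X ^ (1 / 2 - ρ.re) * (V * R) ^ (1 / 2 : ℝ) ≤ η / 2 := by
    refine le_trans ?_ h1
    rw [natCast_rpow_eq_exp hq0, hX, hV, hR, ← Real.exp_add, ← add_mul, exp_mul_rpow, exp_mul_rpow]
    have h4 : Real.exp (κ * L) * (Real.exp ((1 / 2 - ρ.re) * x * L) *
        Real.exp (1 / 2 * (a + b + r) * L)) ≤ Real.exp (x * Real.log L - κ * L) := by
      rw [← Real.exp_add, ← Real.exp_add]
      refine Real.exp_le_exp.mpr ?_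
      have h5 := mul_le_mul_of_nonneg_left hdepth' hx0.le
      have h6 : κ * L + ((1 / 2 - ρ.re) * x * L + 1 / 2 * (a + b + r) * L) =
          x * ((1 - ρ.re) * L) - κ * L := by
        rw [hκ, hx]; ring
      linarith
    calc _ = C₁ * C₀ * (Real.exp (κ * L) * (Real.exp ((1 / 2 - ρ.re) * x * L) *
        Real.exp (1 / 2 * (a + b + r) * L))) := by ring
      _ ≤ _ := by gcongr
  -- the weights vanish for `1 < n ≤ U`
  have hUpart : ∑ n ∈ Icc 1 ⌊X⌋₊, (barbanVehov P L n : ℂ) * ((∑ e ∈ n.divisors, w e : ℝ) : ℂ) *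
      (χ n * (n : ℂ) ^ (-ρ) * ((max (1 - n / U) 0 : ℝ) : ℂ)) = 1 - (U : ℂ)⁻¹ := by
    rw [sum_eq_single_of_mem 1 (mem_Icc.mpr ⟨le_rfl, hX1⟩)]
    · have h5 : 0 ≤ 1 - 1 / U := by rw [sub_nonneg, div_le_one hU0]; exact hU1
      rw [barbanVehov_one (hP1 0 (by simpa using ha.le))]
      simp [hw1, max_eq_left (by simpa using h5 : 0 ≤ 1 - U⁻¹)]
    · intro n hn hn1
      have hn' : 1 < n := by have := (mem_Icc.mp hn).1; omega
      rcases le_total (n : ℝ) U with hnU | hnU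
      · rw [barbanVehov_eq_zero hP1 hL hn' hnU]; simp
      · rw [max_eq_right (b := 0) (a := 1 - n / U) (by linarith [(one_le_div hU0).mpr hnU])]; simp
  have hsplit : ∑ n ∈ Icc 1 ⌊X⌋₊, (barbanVehov P L n : ℂ) * ((∑ e ∈ n.divisors, w e : ℝ) : ℂ) *
      (χ n * (n : ℂ) ^ (-ρ) * (trapezoid U X n : ℂ)) =
      ∑ n ∈ Icc 1 ⌊X⌋₊, (barbanVehov P L n : ℂ) * ((∑ e ∈ n.divisors, w e : ℝ) : ℂ) *
        (χ n * (n : ℂ) ^ (-ρ) * ((max (1 - n / X) 0 : ℝ) : ℂ)) - (1 - (U : ℂ)⁻¹) := by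
    rw [← hUpart, ← sum_sub_distrib]
    refine sum_congr rfl fun n _ => ?_
    rw [trapezoid, ofReal_sub]
    ring
  have hUinv : ‖(U : ℂ)⁻¹‖ ≤ η / 2 := by
    rw [norm_inv, norm_real, Real.norm_eq_abs, abs_of_pos hU0, hU, ← Real.exp_neg]
    simpa [neg_mul] using h3
  rw [hsplit, sub_add_eq_add_sub, show ∀ z : ℂ, z + 1 - (1 - (U : ℂ)⁻¹) = z + (U : ℂ)⁻¹ by
    intro z; ring]
  calc _ ≤ _ := norm_add_le _ _
    _ ≤ η / 2 + η / 2 := add_le_add (key.trans hbound) hUinv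
    _ = η := add_halves η

/-- The off-diagonal terms: for a nonprincipal character the main terms of the sums of lengths `X`
and `U` cancel, and the errors are small since `R ^ 2 < U`. -/
theorem GLH.eventually_norm_offDiagonal_le (hGLH : GLH) {a r x η : ℝ} (hr : 0 < r)
    (hra : r < a / 2) (hx : a ≤ x) (hη : 0 < η) :
    ∀ᶠ q : ℕ in atTop, ∀ [NeZero q] (χ : DirichletCharacter ℂ q) (s : ℂ) (w : ℕ → ℝ), χ ≠ 1 →
      s.re ≤ 1 → |s.im| ≤ 2 → (1 - s.re) * Real.log q ≤ 2 * Real.log (Real.log q) →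
      (∀ d, |w d| ≤ 1) → (∀ d, w d ≠ 0 → d ∈ Icc 1 ⌊Real.exp (r * Real.log q)⌋₊) →
      ‖∑ n ∈ Icc 1 ⌊Real.exp (x * Real.log q)⌋₊, ((∑ e ∈ n.divisors, w e : ℝ) : ℂ) *
        ((∑ e ∈ n.divisors, w e : ℝ) : ℂ) * (χ n * (n : ℂ) ^ (-s) *
          (trapezoid (Real.exp (a * Real.log q)) (Real.exp (x * Real.log q)) n : ℂ))‖ ≤ η := by
  obtain ⟨C₀, hC₀, hC⟩ := exists_sum_lcm_rpow_le
  set κ : ℝ := (a / 2 - r) / 2 with hκ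
  have hκ0 : 0 < κ := by rw [hκ]; linarith
  obtain ⟨C₁, hC₁, hsm⟩ := hGLH.norm_smoothSum_sub_le hκ0
  have hE := tendsto_log_natCast_atTop.eventually ((eventually_mul_exp_log_sub_le (C₁ * C₀) (2 * x)
    hκ0 (half_pos hη)).and ((eventually_log_le_mul (c := 1 / 8) (by norm_num)).and
    (eventually_ge_atTop 1)))
  filter_upwards [hE] with q hq _ χ s w hχ hs1 hsi hdepth hwb hws
  obtain ⟨h1, h2, hL1⟩ := hq
  have hq0 : q ≠ 0 := NeZero.ne q
  set L := Real.log q with hLdef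
  have hL : 0 < L := by linarith
  have hlogL : 0 ≤ Real.log L := Real.log_nonneg hL1
  set R := Real.exp (r * L) with hR
  have hre : 3 / 4 ≤ s.re := by
    have : (1 - s.re) * L ≤ 1 / 4 * L := hdepth.trans (by linarith)
    have := le_of_mul_le_mul_right this hL
    linarith
  have part : ∀ y : ℝ, a ≤ y → y ≤ x →
      ‖∑ n ∈ Icc 1 ⌊Real.exp (x * L)⌋₊, ((∑ e ∈ n.divisors, w e : ℝ) : ℂ) *
        ((∑ e ∈ n.divisors, w e : ℝ) : ℂ) *
          (χ n * (n : ℂ) ^ (-s) * ((max (1 - n / Real.exp (y * L)) 0 : ℝ) : ℂ)) -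
        (∑ d ∈ Icc 1 ⌊R⌋₊, ∑ e ∈ Icc 1 ⌊R⌋₊, (w d : ℂ) * w e *
          (χ (d.lcm e : ℕ) * ((d.lcm e : ℕ) : ℂ) ^ (-s))) * χ.LFunction s‖ ≤ η / 2 := by
    intro y hay hyx
    have hy0 : 0 ≤ y := by linarith
    refine (norm_sum_divisors_smooth_sub_le χ (s := s) (M := C₁ * (q : ℝ) ^ κ)
      hC hC₀.le (by positivity) (fun Y hY => hsm q χ hχ s Y hre hs1 hsi hY) hws hws hwb hwb
      (Real.exp_pos _).le (Real.exp_pos _).le ?_ (Real.exp_pos _) ?_).trans (le_trans ?_ h1)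
    · rw [hR, ← Real.exp_add, ← add_mul]
      refine Real.exp_le_exp.mpr ?_
      gcongr
      linarith
    · exact Nat.floor_le_floor (Real.exp_le_exp.mpr (by gcongr))
    · rw [natCast_rpow_eq_exp hq0, hR, ← Real.exp_add, ← add_mul, exp_mul_rpow, exp_mul_rpow]
      have h4 : Real.exp (κ * L) * (Real.exp ((1 / 2 - s.re) * y * L) *
          Real.exp (1 / 2 * (r + r) * L)) ≤ Real.exp (2 * x * Real.log L - κ * L) := by
        rw [← Real.exp_add, ← Real.exp_add]
        refine Real.exp_le_exp.mpr ?_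
        have h5 := mul_le_mul_of_nonneg_left hdepth hy0
        have h6 : κ * L + ((1 / 2 - s.re) * y * L + 1 / 2 * (r + r) * L) =
            y * ((1 - s.re) * L) - κ * L - (y - a) / 2 * L := by
          rw [hκ]; ring
        have h7 : 0 ≤ (y - a) / 2 * L := mul_nonneg (by linarith) hL.le
        have h8 : y * (2 * Real.log L) ≤ x * (2 * Real.log L) := by gcongr
        linarith
      calc _ = C₁ * C₀ * (Real.exp (κ * L) * (Real.exp ((1 / 2 - s.re) * y * L) *
          Real.exp (1 / 2 * (r + r) * L))) := by ring
        _ ≤ _ := by gcongr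
  have hsplit : ∀ Z : ℂ, ∑ n ∈ Icc 1 ⌊Real.exp (x * L)⌋₊, ((∑ e ∈ n.divisors, w e : ℝ) : ℂ) *
      ((∑ e ∈ n.divisors, w e : ℝ) : ℂ) *
        (χ n * (n : ℂ) ^ (-s) * (trapezoid (Real.exp (a * L)) (Real.exp (x * L)) n : ℂ)) =
      (∑ n ∈ Icc 1 ⌊Real.exp (x * L)⌋₊, ((∑ e ∈ n.divisors, w e : ℝ) : ℂ) *
        ((∑ e ∈ n.divisors, w e : ℝ) : ℂ) *
          (χ n * (n : ℂ) ^ (-s) * ((max (1 - n / Real.exp (x * L)) 0 : ℝ) : ℂ)) - Z) -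
      (∑ n ∈ Icc 1 ⌊Real.exp (x * L)⌋₊, ((∑ e ∈ n.divisors, w e : ℝ) : ℂ) *
        ((∑ e ∈ n.divisors, w e : ℝ) : ℂ) *
          (χ n * (n : ℂ) ^ (-s) * ((max (1 - n / Real.exp (a * L)) 0 : ℝ) : ℂ)) - Z) := by
    intro Z
    rw [sub_sub_sub_cancel_right, ← sum_sub_distrib]
    refine sum_congr rfl fun n _ => ?_
    rw [trapezoid, ofReal_sub]
    ring
  rw [hsplit ((∑ d ∈ Icc 1 ⌊R⌋₊, ∑ e ∈ Icc 1 ⌊R⌋₊, (w d : ℂ) * w e *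
    (χ (d.lcm e : ℕ) * ((d.lcm e : ℕ) : ℂ) ^ (-s))) * χ.LFunction s)]
  calc _ ≤ _ := norm_sub_le _ _
    _ ≤ η / 2 + η / 2 := add_le_add (part x hx le_rfl) (part a le_rfl hx)
    _ = η := add_halves η
end UnderGLH

/-! ### Sums over integers coprime to the modulus -/

section CoprimeSums
open MeasureTheory Set

/-- For a unimodal function the sum over integers and the integral differ by at most the maximum. -/
lemma abs_sum_Icc_sub_integral_le {G : ℝ → ℝ} {c : ℝ} (hc : 0 ≤ c)
    (hmono : MonotoneOn G (Set.Icc 0 c)) (hanti : AntitoneOn G (Ici c)) (h0 : G 0 = 0)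
    (hG : ∀ t, 0 ≤ t → 0 ≤ G t) (M : ℕ) :
    |∑ m ∈ Finset.Icc 1 M, G m - ∫ t in (0 : ℝ)..M, G t| ≤ G c := by
  -- split `G` into a monotone and an antitone function
  set G₁ : ℝ → ℝ := fun t => G (min t c) with hG₁
  set G₂ : ℝ → ℝ := fun t => G (max t c) with hG₂
  have hsum : ∀ t, G t = G₁ t + G₂ t - G c := by
    intro t
    rcases le_total t c with h | h <;> simp [hG₁, hG₂, h]
  have hm : MonotoneOn G₁ (Set.Icc (0 : ℝ) (0 + M)) := fun s hs t ht hst =>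
    hmono ⟨le_min hs.1 hc, min_le_right _ _⟩ ⟨le_min ht.1 hc, min_le_right _ _⟩ (min_le_min_right c hst)
  have ha : AntitoneOn G₂ (Set.Icc (0 : ℝ) (0 + M)) := fun s _ t _ hst =>
    hanti (le_max_right s c) (le_max_right t c) (max_le_max_right c hst)
  have hi1 : IntervalIntegrable G₁ volume 0 M := by
    apply MonotoneOn.intervalIntegrable
    rw [Set.uIcc_of_le (Nat.cast_nonneg M)]
    simpa using hm
  have hi2 : IntervalIntegrable G₂ volume 0 M := by
    apply AntitoneOn.intervalIntegrable
    rw [Set.uIcc_of_le (Nat.cast_nonneg M)]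
    simpa using ha
  have hIcc : ∀ F : ℝ → ℝ, ∑ m ∈ Finset.Icc 1 M, F m = ∑ i ∈ range M, F (0 + ((i + 1 : ℕ) : ℝ)) := by
    intro F
    rw [Finset.range_eq_Ico, Finset.sum_Ico_add' (fun m : ℕ => F (0 + (m : ℝ)))]
    simp [Finset.Ico_add_one_right_eq_Icc]
  have htel : ∀ F : ℝ → ℝ, ∑ i ∈ range M, F (0 + ((i + 1 : ℕ) : ℝ)) =
      ∑ i ∈ range M, F (0 + (i : ℝ)) + F M - F 0 := by
    intro F
    have h2 := Finset.sum_range_succ' (fun i : ℕ => F i) M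
    have h3 := Finset.sum_range_succ (fun i : ℕ => F i) M
    simp only [zero_add, Nat.cast_zero] at *
    linarith
  have e1 := hm.integral_le_sum
  have e2 := hm.sum_le_integral
  have e3 := ha.integral_le_sum
  have e4 := ha.sum_le_integral
  have t1 := htel G₁
  have t2 := htel G₂
  rw [← hIcc, zero_add] at e1 e4
  rw [zero_add] at e2 e3
  rw [← hIcc] at t1 t2
  have hM0 : (0 : ℝ) ≤ M := Nat.cast_nonneg M
  have v1 : G₁ 0 = 0 := by simp [hG₁, hc, h0]
  have v2 : G₁ M ≤ G c := by
    simp only [hG₁]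
    exact hmono ⟨le_min hM0 hc, min_le_right _ _⟩ ⟨hc, le_rfl⟩ (min_le_right _ _)
  have v3 : G₂ 0 = G c := by simp [hG₂, hc]
  have v4 : 0 ≤ G₂ M := hG _ (le_max_of_le_left hM0)
  have hS : ∑ m ∈ Finset.Icc 1 M, G m = ∑ m ∈ Finset.Icc 1 M, G₁ m + ∑ m ∈ Finset.Icc 1 M, G₂ m -
      M * G c := by
    rw [sum_congr rfl fun (m : ℕ) _ => hsum m, sum_sub_distrib, sum_add_distrib]
    simp
  have hI : ∫ t in (0 : ℝ)..M, G t = (∫ t in (0 : ℝ)..M, G₁ t) + (∫ t in (0 : ℝ)..M, G₂ t) -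
      M * G c := by
    rw [intervalIntegral.integral_congr fun t _ => hsum t, intervalIntegral.integral_sub
      (hi1.add hi2) intervalIntegrable_const, intervalIntegral.integral_add hi1 hi2]
    simp
  rw [hS, hI, abs_le]
  constructor <;> linarith

lemma sum_filter_coprime_eq (G : ℕ → ℝ) {q : ℕ} (hq : q ≠ 0) (M : ℕ) :
    ∑ m ∈ Finset.Icc 1 M with m.Coprime q, G m =
      ∑ f ∈ q.divisors, (ArithmeticFunction.moebius f : ℝ) * ∑ m ∈ Finset.Icc 1 (M / f), G (m * f) := by
  have h1 : ∀ m ∈ Finset.Icc 1 M, (if m.Coprime q then G m else 0) =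
      ∑ f ∈ q.divisors, (ArithmeticFunction.moebius f : ℝ) * if f ∣ m then G m else 0 := by
    intro m hm
    have hm0 : m ≠ 0 := by have := (Finset.mem_Icc.mp hm).1; omega
    have h2 : q.divisors.filter (· ∣ m) = (m.gcd q).divisors := by
      ext f
      simp only [mem_filter, Nat.mem_divisors, Nat.dvd_gcd_iff]
      have : m.gcd q ≠ 0 := Nat.gcd_ne_zero_left hm0
      tauto
    simp_rw [mul_ite, mul_zero]
    rw [← sum_filter, h2, ← sum_mul, sum_divisors_moebius, ite_mul, one_mul, zero_mul]
  rw [sum_filter, sum_congr rfl h1, sum_comm]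
  refine sum_congr rfl fun f hf => ?_
  rw [← mul_sum, ← sum_filter, sum_Icc_filter_dvd _ _ (Nat.pos_of_mem_divisors hf)]

lemma sum_moebius_div_eq_totient_div {q : ℕ} (hq : q ≠ 0) :
    ∑ f ∈ q.divisors, (ArithmeticFunction.moebius f : ℝ) * (f : ℝ)⁻¹ = (q.totient : ℝ) / q := by
  have h := (ArithmeticFunction.sum_eq_iff_sum_mul_moebius_eq (R := ℝ) (f := fun n => (n.totient : ℝ))
    (g := fun n => (n : ℝ))).mp (fun n _ => by exact_mod_cast Nat.sum_totient n) q
      (Nat.pos_of_ne_zero hq)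
  have hq0 : (q : ℝ) ≠ 0 := by exact_mod_cast hq
  rw [← h, Nat.sum_divisorsAntidiagonal (fun f e => (ArithmeticFunction.moebius f : ℝ) * (e : ℝ)),
    sum_div]
  refine sum_congr rfl fun f hf => ?_
  have hf0 : (f : ℝ) ≠ 0 := by exact_mod_cast (Nat.pos_of_mem_divisors hf).ne'
  rw [Nat.cast_div (Nat.dvd_of_mem_divisors hf) hf0]
  field_simp

/-- Sums of a unimodal function supported on `[0, X]` over the multiples of `D` which are, up to the
factor `D`, coprime to `q`. -/
lemma abs_sum_coprime_sub_le {F : ℝ → ℝ} {U X : ℝ} (hU : 0 ≤ U) (hUX : U ≤ X)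
    (hmono : MonotoneOn F (Set.Icc 0 U)) (hanti : AntitoneOn F (Ici U)) (h0 : F 0 = 0)
    (hF : ∀ t, 0 ≤ t → 0 ≤ F t) (hFX : ∀ t, X ≤ t → F t = 0) {q D : ℕ} (hq : q ≠ 0) (hD : 0 < D) :
    |∑ m ∈ Finset.Icc 1 (⌊X⌋₊ / D) with m.Coprime q, F (m * D : ℕ) -
      (q.totient : ℝ) / q * ((D : ℝ)⁻¹ * ∫ t in (0 : ℝ)..X, F t)| ≤ 2 ^ #q.primeFactors * F U := by
  have hX : 0 ≤ X := hU.trans hUX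
  have hone : ∀ h : ℕ, 0 < h → |∑ m ∈ Finset.Icc 1 (⌊X⌋₊ / h), F (m * h : ℕ) -
      (h : ℝ)⁻¹ * ∫ t in (0 : ℝ)..X, F t| ≤ F U := by
    intro h hh
    have hh0 : (0 : ℝ) < h := by exact_mod_cast hh
    set K := ⌊X⌋₊ / h with hK
    have hXK : X ≤ ((K + 1 : ℕ) : ℝ) * h := by
      have h1 : ⌊X⌋₊ < (K + 1) * h := by
        rw [hK, mul_comm]; exact Nat.lt_mul_div_succ _ hh
      exact_mod_cast ((Nat.lt_of_floor_lt h1).le)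
    have key := abs_sum_Icc_sub_integral_le (G := fun t => F (t * h)) (c := U / h) (by positivity)
      (fun s hs t ht hst => hmono
        ⟨mul_nonneg hs.1 hh0.le, (le_div_iff₀ hh0).mp hs.2⟩
        ⟨mul_nonneg ht.1 hh0.le, (le_div_iff₀ hh0).mp ht.2⟩ (by gcongr))
      (fun s hs t ht hst => hanti ((div_le_iff₀ hh0).mp hs) ((div_le_iff₀ hh0).mp ht) (by gcongr))
      (by simpa using h0) (fun t ht => hF _ (by positivity)) (K + 1)
    rw [sum_Icc_succ_top (Nat.le_add_left 1 K), hFX _ hXK, add_zero, intervalIntegral.integral_comp_mul_right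
      (f := F) hh0.ne', zero_mul, div_mul_cancel₀ _ hh0.ne', smul_eq_mul] at key
    have hext : ∫ t in (0 : ℝ)..((K + 1 : ℕ) : ℝ) * h, F t = ∫ t in (0 : ℝ)..X, F t := by
      have h2 : ∀ A, X ≤ A → ∫ t in (0 : ℝ)..A, F t = ∫ t in Ioi (0 : ℝ), F t := by
        intro A hA
        rw [intervalIntegral.integral_of_le (hX.trans hA)]
        refine (setIntegral_eq_of_subset_of_forall_sdiff_eq_zero measurableSet_Ioi
          Ioc_subset_Ioi_self fun t ht => hFX t ?_).symm
        rw [Set.mem_sdiff, Set.mem_Ioc, not_and, not_le] at ht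
        exact hA.trans (ht.2 ht.1).le
      rw [h2 _ hXK, h2 X le_rfl]
    rw [hext] at key
    simpa [Nat.cast_mul] using key
  rw [sum_filter_coprime_eq _ hq, ← sum_moebius_div_eq_totient_div hq, sum_mul, ← sum_sub_distrib]
  calc _ ≤ ∑ f ∈ q.divisors, |(ArithmeticFunction.moebius f : ℝ)| * F U := by
        refine (abs_sum_le_sum_abs _ _).trans (sum_le_sum fun f hf => ?_)
        have hf0 := Nat.pos_of_mem_divisors hf
        have h3 := hone (D * f) (Nat.mul_pos hD hf0)
        rw [mul_assoc, ← mul_sub, abs_mul]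
        gcongr
        rw [Nat.div_div_eq_div_mul]
        refine le_trans (le_of_eq ?_) h3
        push_cast
        rw [mul_inv]
        congr 1
        congr 1
        · refine sum_congr rfl fun m _ => ?_
          congr 1; ring
        · ring
    _ ≤ _ := by
        rw [← sum_mul]
        gcongr
        · exact hF U hU
        · exact sum_abs_moebius_le q
end CoprimeSums

/-! ### The diagonal terms -/

section Diagonal
open MeasureTheory Set Filter Topology

lemma trapezoid_mul_rpow_of_le {U X t ν : ℝ} (hU : 0 < U) (hUX : U ≤ X) (ht : 0 ≤ t) (htU : t ≤ U)
    (hν : 0 < ν) : trapezoid U X t * t ^ (ν - 1) = t ^ ν * (1 / U - 1 / X) := by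
  rw [trapezoid_of_le hU hUX htU]
  rcases ht.eq_or_lt with rfl | ht
  · simp [Real.zero_rpow hν.ne']
  · rw [Real.rpow_sub_one ht.ne']
    field_simp

lemma monotoneOn_trapezoid_mul_rpow {U X ν : ℝ} (hU : 0 < U) (hUX : U ≤ X) (hν : 0 < ν) :
    MonotoneOn (fun t => trapezoid U X t * t ^ (ν - 1)) (Set.Icc 0 U) := by
  intro s hs t ht hst
  simp only
  rw [trapezoid_mul_rpow_of_le hU hUX hs.1 hs.2 hν, trapezoid_mul_rpow_of_le hU hUX ht.1 ht.2 hν]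
  have h1 : 0 ≤ 1 / U - 1 / X := sub_nonneg.mpr (one_div_le_one_div_of_le hU hUX)
  have h2 := Real.rpow_le_rpow hs.1 hst hν.le
  exact mul_le_mul_of_nonneg_right h2 h1

lemma antitoneOn_trapezoid_mul_rpow {U X ν : ℝ} (hU : 0 < U) (hUX : U ≤ X) (hν : ν ≤ 1) :
    AntitoneOn (fun t => trapezoid U X t * t ^ (ν - 1)) (Ici U) := by
  intro s hs t ht hst
  have hs0 : 0 < s := hU.trans_le hs
  have hX : 0 < X := hU.trans_le hUX
  simp only
  rw [trapezoid_of_ge hU hs, trapezoid_of_ge hU ht]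
  have h1 : max (1 - t / X) 0 ≤ max (1 - s / X) 0 := max_le_max (by gcongr) le_rfl
  exact mul_le_mul h1 (Real.rpow_le_rpow_of_nonpos hs0 hst (by linarith))
    (by have := hs0.le.trans hst; positivity) (le_max_right _ _)

lemma integral_trapezoid_mul_rpow_le {U X ν : ℝ} (hU : 0 < U) (hUX : U ≤ X) (hν : 0 < ν)
    (hν1 : ν ≤ 1) :
    ∫ t in (0 : ℝ)..X, trapezoid U X t * t ^ (ν - 1) ≤ U ^ ν + (X ^ ν - U ^ ν) / ν := by
  have hX : 0 < X := hU.trans_le hUX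
  have hi1 : IntervalIntegrable (fun t => trapezoid U X t * t ^ (ν - 1)) volume 0 U := by
    apply MonotoneOn.intervalIntegrable
    rw [Set.uIcc_of_le hU.le]
    exact monotoneOn_trapezoid_mul_rpow hU hUX hν
  have hi2 : IntervalIntegrable (fun t => trapezoid U X t * t ^ (ν - 1)) volume U X := by
    apply AntitoneOn.intervalIntegrable
    rw [Set.uIcc_of_le hUX]
    exact (antitoneOn_trapezoid_mul_rpow hU hUX hν1).mono Icc_subset_Ici_self
  rw [← intervalIntegral.integral_add_adjacent_intervals hi1 hi2]
  refine add_le_add ?_ ?_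
  · calc _ ≤ ∫ _ in (0 : ℝ)..U, U ^ ν * (1 / U) := by
          refine intervalIntegral.integral_mono_on hU.le hi1 intervalIntegrable_const fun t ht => ?_
          rw [trapezoid_mul_rpow_of_le hU hUX ht.1 ht.2 hν]
          have h1 : 0 < 1 / X := by positivity
          have h2 : 0 ≤ 1 / U - 1 / X := sub_nonneg.mpr (one_div_le_one_div_of_le hU hUX)
          exact mul_le_mul (Real.rpow_le_rpow ht.1 ht.2 hν.le) (by linarith) h2 (by positivity)
      _ = U ^ ν := by
          rw [intervalIntegral.integral_const, smul_eq_mul]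
          field_simp
          ring
  · calc _ ≤ ∫ t in U..X, t ^ (ν - 1) := by
          refine intervalIntegral.integral_mono_on hUX hi2
            (intervalIntegral.intervalIntegrable_rpow' (by linarith)) fun t ht => ?_
          have ht0 : 0 < t := hU.trans_le ht.1
          exact mul_le_of_le_one_left (by positivity) (trapezoid_le_one hX ht0.le)
      _ = _ := by
          rw [integral_rpow (Or.inl (by linarith)), sub_add_cancel]

/-- Sieve weights turn the sum over all integers coprime to `q` into an integral divided by
`log R`. -/
lemma sum_coprime_sieve_sq_le {q : ℕ} (hq : q ≠ 0) {R T U X ν : ℝ} {w : ℕ → ℝ} (hR : 0 ≤ R)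
    (hw1 : ∀ d, |w d| ≤ 1) (hws : ∀ d, w d ≠ 0 → d ∈ Finset.Icc 1 ⌊R⌋₊ ∧ d.Coprime q)
    (hT : ((q.totient : ℝ) / q) * ∑ d ∈ Finset.Icc 1 ⌊R⌋₊, ∑ e ∈ Finset.Icc 1 ⌊R⌋₊,
      w d * w e / (d.lcm e : ℝ) ≤ T) (hT0 : 0 ≤ T)
    (hU : 0 < U) (hUX : U ≤ X) (hν : 0 < ν) (hν1 : ν ≤ 1) :
    ∑ n ∈ Finset.Icc 1 ⌊X⌋₊ with n.Coprime q, (∑ e ∈ n.divisors, w e) ^ 2 *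
        (trapezoid U X n * (n : ℝ) ^ (ν - 1)) ≤
      T * (U ^ ν + (X ^ ν - U ^ ν) / ν) + R ^ 2 * 2 ^ #q.primeFactors * U ^ (ν - 1) := by
  have hX : 0 < X := hU.trans_le hUX
  set F : ℝ → ℝ := fun t => trapezoid U X t * t ^ (ν - 1) with hF
  have hF0 : ∀ t, 0 ≤ t → 0 ≤ F t := fun t ht =>
    mul_nonneg (trapezoid_nonneg hU hUX ht) (by positivity)
  have hFU : F U ≤ U ^ (ν - 1) :=
    mul_le_of_le_one_left (by positivity) (trapezoid_le_one hX hU.le)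
  set I : ℝ := ∫ t in (0 : ℝ)..X, F t with hI
  have hI0 : 0 ≤ I := intervalIntegral.integral_nonneg hX.le fun t ht => hF0 t ht.1
  have hI1 : I ≤ U ^ ν + (X ^ ν - U ^ ν) / ν := integral_trapezoid_mul_rpow_le hU hUX hν hν1
  set Q : ℝ := (q.totient : ℝ) / q with hQ
  set E : ℝ := 2 ^ #q.primeFactors * F U with hE
  have hE0 : 0 ≤ E := mul_nonneg (by positivity) (hF0 U hU.le)
  have h1 := sum_mul_sum_divisors (α := w) (β := w) (fun d h => (hws d h).1) (fun d h => (hws d h).1)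
    ⌊X⌋₊ (fun n => if n.Coprime q then F n else 0)
  have h2 : ∑ n ∈ Finset.Icc 1 ⌊X⌋₊ with n.Coprime q, (∑ e ∈ n.divisors, w e) ^ 2 * F n =
      ∑ n ∈ Finset.Icc 1 ⌊X⌋₊, (∑ e ∈ n.divisors, w e) * (∑ e ∈ n.divisors, w e) *
        (if n.Coprime q then F n else 0) := by
    rw [sum_filter]
    refine sum_congr rfl fun n _ => ?_
    split_ifs <;> ring
  rw [h2, h1]
  have hterm : ∀ d ∈ Finset.Icc 1 ⌊R⌋₊, ∀ e ∈ Finset.Icc 1 ⌊R⌋₊,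
      w d * w e * ∑ m ∈ Finset.Icc 1 (⌊X⌋₊ / d.lcm e),
        (if (m * d.lcm e).Coprime q then F (m * d.lcm e : ℕ) else 0) ≤
      Q * I * (w d * w e / (d.lcm e : ℝ)) + E := by
    intro d hd e he
    by_cases hd0 : w d = 0
    · simpa [hd0] using hE0
    by_cases he0 : w e = 0
    · simpa [he0] using hE0
    have hD : 0 < d.lcm e := Nat.lcm_pos (Finset.mem_Icc.mp hd).1 (Finset.mem_Icc.mp he).1
    have hDq : (d.lcm e).Coprime q :=
      Nat.Coprime.coprime_dvd_left (Nat.lcm_dvd_mul d e) ((hws d hd0).2.mul_left (hws e he0).2)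
    have h3 := abs_sum_coprime_sub_le hU.le hUX (monotoneOn_trapezoid_mul_rpow hU hUX hν)
      (antitoneOn_trapezoid_mul_rpow hU hUX hν1)
      (by simp [trapezoid]) hF0 (fun t ht => by
        have h4 : 1 ≤ t / X := (one_le_div hX).mpr ht
        rw [trapezoid_of_ge hU (hUX.trans ht), max_eq_right (b := 0) (a := 1 - t / X) (by linarith), zero_mul])
      hq hD
    have h5 : ∑ m ∈ Finset.Icc 1 (⌊X⌋₊ / d.lcm e),
        (if (m * d.lcm e).Coprime q then F (m * d.lcm e : ℕ) else 0) =
        ∑ m ∈ Finset.Icc 1 (⌊X⌋₊ / d.lcm e) with m.Coprime q, F (m * d.lcm e : ℕ) := by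
      rw [sum_filter]
      refine sum_congr rfl fun m _ => if_congr ?_ rfl rfl
      rw [Nat.coprime_mul_iff_left, and_iff_left hDq]
    rw [h5]
    set S := ∑ m ∈ Finset.Icc 1 (⌊X⌋₊ / d.lcm e) with m.Coprime q, F (m * d.lcm e : ℕ) with hS
    have h6 : w d * w e * (S - Q * (((d.lcm e : ℕ) : ℝ)⁻¹ * I)) ≤ E := by
      refine (le_abs_self _).trans ?_
      rw [abs_mul, abs_mul]
      calc _ ≤ 1 * 1 * E := by
            gcongr
            · exact hw1 d
            · exact hw1 e
        _ = E := by ring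
    have h7 : w d * w e * (Q * (((d.lcm e : ℕ) : ℝ)⁻¹ * I)) = Q * I * (w d * w e / (d.lcm e : ℝ)) := by
      rw [div_eq_mul_inv]; ring
    rw [mul_sub, h7] at h6
    linarith
  have hcard : ((⌊R⌋₊ : ℕ) : ℝ) ≤ R := Nat.floor_le hR
  calc _ ≤ ∑ d ∈ Finset.Icc 1 ⌊R⌋₊, ∑ e ∈ Finset.Icc 1 ⌊R⌋₊,
        (Q * I * (w d * w e / (d.lcm e : ℝ)) + E) :=
        sum_le_sum fun d hd => sum_le_sum fun e he => hterm d hd e he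
    _ = I * (Q * ∑ d ∈ Finset.Icc 1 ⌊R⌋₊, ∑ e ∈ Finset.Icc 1 ⌊R⌋₊, w d * w e / (d.lcm e : ℝ)) +
        (⌊R⌋₊ : ℝ) ^ 2 * E := by
        simp_rw [sum_add_distrib, ← mul_sum]
        simp only [sum_const, Nat.card_Icc, Nat.add_sub_cancel, nsmul_eq_mul]
        ring
    _ ≤ I * T + R ^ 2 * (2 ^ #q.primeFactors * U ^ (ν - 1)) := by
        gcongr
        exact mul_le_mul_of_nonneg_left hFU (by positivity)
    _ ≤ _ := by
        have := mul_le_mul_of_nonneg_left hI1 hT0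
        linarith

lemma exp_mul_le_exp_sub_div {p s v : ℝ} (hps : s < p) (hv : 0 < v) :
    Real.exp (s * v) ≤ (Real.exp (p * v) - Real.exp (s * v)) / v / (p - s) := by
  have h0 : 0 < p - s := by linarith
  rw [div_div, le_div_iff₀ (by positivity)]
  have h1 : Real.exp (p * v) = Real.exp (s * v) * Real.exp ((p - s) * v) := by
    rw [← Real.exp_add]; ring_nf
  have h2 := Real.add_one_le_exp ((p - s) * v)
  have h3 := mul_le_mul_of_nonneg_left h2 (Real.exp_pos (s * v)).le
  rw [h1]
  linarith

/-- The diagonal terms; here `v = (1 - Re ρ) log q`, so that the exponent `2 * v / log q - 1` of `n`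
is `1 - 2 * Re ρ`. The error term is negligible since `R ^ 2` is smaller than `U` by a power of `q`. -/
theorem eventually_diagonal_le {a r x η : ℝ} (hr : 0 < r) (hra : r < a / 2)
    (hx : a < x) (hη : 0 < η) :
    ∀ᶠ q : ℕ in atTop, ∀ (v : ℝ) (w : ℕ → ℝ), 0 < v → v ≤ Real.log (Real.log q) →
      (∀ d, |w d| ≤ 1) →
      (∀ d, w d ≠ 0 → d ∈ Finset.Icc 1 ⌊Real.exp (r * Real.log q)⌋₊ ∧ d.Coprime q) →
      ((q.totient : ℝ) / q) * ∑ d ∈ Finset.Icc 1 ⌊Real.exp (r * Real.log q)⌋₊,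
        ∑ e ∈ Finset.Icc 1 ⌊Real.exp (r * Real.log q)⌋₊, w d * w e / (d.lcm e : ℝ) ≤
          1 / Real.log (Real.exp (r * Real.log q)) →
      ∑ n ∈ Finset.Icc 1 ⌊Real.exp (x * Real.log q)⌋₊ with n.Coprime q,
        (∑ e ∈ n.divisors, w e) ^ 2 *
          (trapezoid (Real.exp (a * Real.log q)) (Real.exp (x * Real.log q)) n *
            (n : ℝ) ^ (2 * v / Real.log q - 1)) ≤
        (1 / (2 * r) + η) * ((Real.exp (2 * x * v) - Real.exp (2 * a * v)) / v) := by
  set κ : ℝ := (a - 2 * r) / 2 with hκ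
  have hκ0 : 0 < κ := by rw [hκ]; linarith
  obtain ⟨C, hC, hdiv⟩ := exists_two_pow_card_primeFactors_le hκ0
  have hη' : 0 < η / 2 * (2 * x - 2 * a) := mul_pos (half_pos hη) (by linarith)
  have hE := tendsto_log_natCast_atTop.eventually ((eventually_mul_exp_log_sub_le C 0
    hκ0 hη').and ((eventually_log_le_mul (c := 1 / 2) (by norm_num)).and
    ((eventually_ge_atTop (1 / (r * (η / 2 * (2 * x - 2 * a))))).and (eventually_gt_atTop 0))))
  filter_upwards [hE] with q hq v w hv hvl hw1 hws hT
  obtain ⟨h1, h2, h3, hL⟩ := hq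
  set L := Real.log q with hLdef
  have hq0 : q ≠ 0 := by rintro rfl; simp [hLdef] at hL
  have hUX : Real.exp (a * L) ≤ Real.exp (x * L) := Real.exp_le_exp.mpr (by gcongr)
  rw [Real.log_exp] at hT
  have key := sum_coprime_sieve_sq_le hq0 (Real.exp_pos _).le hw1 hws hT (by positivity)
    (Real.exp_pos _) hUX (ν := 2 * v / L) (by positivity) (by
      rw [div_le_one hL]; linarith)
  refine key.trans ?_
  set W := (Real.exp (2 * x * v) - Real.exp (2 * a * v)) / v with hW
  have hsW : Real.exp (2 * a * v) ≤ W / (2 * x - 2 * a) :=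
    exp_mul_le_exp_sub_div (by linarith) hv
  have hxa : 0 < 2 * x - 2 * a := by linarith
  have hW0 : 0 < W := by
    have := (Real.exp_pos (2 * a * v)).trans_le hsW
    rwa [lt_div_iff₀ hxa, zero_mul] at this
  have e1 : ∀ y : ℝ, Real.exp (y * L) ^ (2 * v / L) = Real.exp (2 * y * v) := by
    intro y
    rw [exp_mul_rpow]
    congr 1
    field_simp
  have e2 : Real.exp (a * L) ^ (2 * v / L - 1) = Real.exp (2 * a * v) * Real.exp (-(a * L)) := by
    rw [Real.rpow_sub_one (Real.exp_pos _).ne', e1, Real.exp_neg, div_eq_mul_inv]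
  rw [e1, e1, e2]
  have e3 : (Real.exp (2 * x * v) - Real.exp (2 * a * v)) / (2 * v / L) = L / 2 * W := by
    rw [hW]; field_simp
  rw [e3]
  have hfirst : 1 / (r * L) * (Real.exp (2 * a * v) + L / 2 * W) ≤ (1 / (2 * r) + η / 2) * W := by
    have h4 : 1 / (r * L) * (L / 2 * W) = 1 / (2 * r) * W := by field_simp
    have h5 : 1 / (r * L) * Real.exp (2 * a * v) ≤ η / 2 * W := by
      calc _ ≤ 1 / (r * L) * (W / (2 * x - 2 * a)) := by gcongr
        _ ≤ η / 2 * W := by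
          rw [div_le_iff₀ (by positivity)] at h3
          rw [div_mul_div_comm, one_mul, div_le_iff₀ (by positivity)]
          nlinarith
    rw [mul_add, h4]
    linarith
  have hsecond : Real.exp (r * L) ^ 2 * 2 ^ #q.primeFactors *
      (Real.exp (2 * a * v) * Real.exp (-(a * L))) ≤ η / 2 * W := by
    have h6 := hdiv q hq0
    rw [natCast_rpow_eq_exp hq0] at h6
    calc _ ≤ Real.exp (r * L) ^ 2 * (C * Real.exp (κ * L)) *
          (W / (2 * x - 2 * a) * Real.exp (-(a * L))) := by gcongr
      _ = C * (Real.exp (r * L) * Real.exp (r * L) * Real.exp (κ * L) * Real.exp (-(a * L))) *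
          (W / (2 * x - 2 * a)) := by ring
      _ = C * Real.exp (0 * Real.log L - κ * L) * (W / (2 * x - 2 * a)) := by
          rw [← Real.exp_add, ← Real.exp_add, ← Real.exp_add]
          congr 3
          rw [hκ]; ring
      _ ≤ η / 2 * (2 * x - 2 * a) * (W / (2 * x - 2 * a)) := by gcongr
      _ = η / 2 * W := by rw [mul_assoc, mul_div_cancel₀ _ hxa.ne']
  linarith
end Diagonal

/-! ### Location of the zeros -/

section Zeros
open Complex Filter Topology

lemma IsLZero.re_lt_one {q : ℕ} [NeZero q] {χ : DirichletCharacter ℂ q} {ρ : ℂ} (h : IsLZero χ ρ) :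
    ρ.re < 1 := by
  by_contra hre
  exact χ.LFunction_ne_zero_of_one_le_re h.1 (not_lt.mp hre) h.2

/-- The zeros of the principal character in `Re s > 0` are those of `ζ`, of which only finitely many
lie near the segment `Re s = 1`, `|Im s| ≤ 1`. -/
lemma eventually_ne_one_of_isLZeroNearOne : ∀ᶠ q : ℕ in atTop, ∀ [NeZero q] (lam : ℝ),
    lam ≤ Real.log (Real.log q) → ∀ (χ : DirichletCharacter ℂ q) (ρ : ℂ),
      IsLZeroNearOne lam χ ρ → χ ≠ 1 := by
  set K : Set ℂ := Set.Icc (0 : ℝ) 1 ×ℂ Set.Icc (-1 : ℝ) 1 with hK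
  have hKc : IsCompact K := isCompact_Icc.reProdIm isCompact_Icc
  have hfin := hKc.inter_riemannZetaZeros_finite
  have hlim : Tendsto (fun q : ℕ => 1 - Real.log (Real.log q) / Real.log q) atTop (𝓝 (1 - 0)) :=
    (Real.isLittleO_log_id_atTop.tendsto_div_nhds_zero.comp
      tendsto_log_natCast_atTop).const_sub 1
  rw [sub_zero] at hlim
  have h1 : ∀ᶠ q : ℕ in atTop, ∀ z ∈ K ∩ riemannZetaZeros,
      z.re < 1 - Real.log (Real.log q) / Real.log q := by
    refine (eventually_all_finite hfin).mpr fun z hz => hlim.eventually_const_lt ?_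
    by_contra hre
    exact riemannZeta_ne_zero_of_one_le_re (not_lt.mp hre) hz.2
  filter_upwards [h1, hlim.eventually_const_lt one_pos,
    tendsto_log_natCast_atTop.eventually_gt_atTop 0] with q h2 h3 hL _ lam hlam χ ρ hρ hχ
  obtain ⟨hz, hre, him⟩ := hρ
  have hre1 := hz.re_lt_one
  have hle : 1 - Real.log (Real.log q) / Real.log q ≤ ρ.re := by
    refine le_trans ?_ hre
    gcongr
  have hne : ρ ≠ 1 := fun h => by rw [h] at hre1; simp at hre1
  subst hχ
  have h4 := hz.2
  rw [show (1 : DirichletCharacter ℂ q).LFunction ρ = DirichletCharacter.LFunctionTrivChar q ρ from rfl,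
    DirichletCharacter.LFunctionTrivChar_eq_mul_riemannZeta hne, mul_eq_zero, prod_eq_zero_iff] at h4
  rcases h4 with ⟨p, hp, h5⟩ | h4
  · have hp1 : 1 < p := (Nat.prime_of_mem_primeFactors hp).one_lt
    have h6 : ‖(p : ℂ) ^ (-ρ)‖ < 1 := by
      rw [norm_natCast_cpow_of_pos (by omega), neg_re]
      exact Real.rpow_lt_one_of_one_lt_of_neg (by exact_mod_cast hp1) (by linarith)
    rw [← sub_eq_zero.mp h5, norm_one] at h6
    exact h6.false
  · refine absurd (h2 ρ ⟨⟨⟨?_, hre1.le⟩, abs_le.mp him⟩, h4⟩) (not_lt.mpr hle)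
    exact (h3.le.trans hle)
end Zeros

/-! ### Duality -/

section Duality
open Complex

/-- The dual large-sieve inequality: if every `f k` has mollified sum close to `-1` and the
`f k` are nearly orthogonal, then the weights `c k` cannot be large. -/
lemma sq_sum_le_of_nearly_orthogonal {ι : Type*} [DecidableEq ι] {S : Finset ι} {I : Finset ℕ}
    {c B : ι → ℝ} {f : ι → ℕ → ℂ} {ψ θ J : ℕ → ℝ} {A η₁ η₂ : ℝ} (hI : ∀ n ∈ I, 0 < n)
    (hc : ∀ k ∈ S, 0 ≤ c k) (hJ : ∀ n ∈ I, 0 ≤ J n) (hη₁ : η₁ ≤ 1) (hη₂ : 0 ≤ η₂)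
    (hA : ∑ n ∈ I, ψ n ^ 2 * (J n / n) ≤ A)
    (hone : ∀ k ∈ S, ‖∑ n ∈ I, (ψ n : ℂ) * θ n * (f k n * J n) + 1‖ ≤ η₁)
    (hoff : ∀ j ∈ S, ∀ k ∈ S, j ≠ k →
      ‖∑ n ∈ I, (θ n : ℂ) * θ n * (n * (f j n * (starRingEnd ℂ) (f k n)) * J n)‖ ≤ η₂)
    (hdiag : ∀ k ∈ S, ∑ n ∈ I, θ n ^ 2 * (n * ‖f k n‖ ^ 2 * J n) ≤ B k) :
    ((1 - η₁) * ∑ k ∈ S, c k) ^ 2 ≤ A * (∑ k ∈ S, c k ^ 2 * B k + η₂ * (∑ k ∈ S, c k) ^ 2) := by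
  set g : ℕ → ℂ := fun n => ∑ k ∈ S, (c k : ℂ) * f k n with hg
  set T : ℂ := ∑ n ∈ I, (ψ n : ℂ) * θ n * (g n * J n) with hT
  set Q : ℝ := ∑ n ∈ I, θ n ^ 2 * (n * ‖g n‖ ^ 2 * J n) with hQ
  have hc0 : 0 ≤ ∑ k ∈ S, c k := sum_nonneg hc
  have h1 : (1 - η₁) * ∑ k ∈ S, c k ≤ ‖T‖ := by
    have h2 : T + (∑ k ∈ S, c k : ℝ) =
        ∑ k ∈ S, (c k : ℂ) * (∑ n ∈ I, (ψ n : ℂ) * θ n * (f k n * J n) + 1) := by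
      simp_rw [mul_add, mul_one, sum_add_distrib, hT, hg, mul_sum, sum_mul, mul_sum, ofReal_sum]
      rw [sum_comm]
      congr 1
      refine sum_congr rfl fun k _ => sum_congr rfl fun n _ => ?_
      ring
    have h3 : ‖T + (∑ k ∈ S, c k : ℝ)‖ ≤ η₁ * ∑ k ∈ S, c k := by
      rw [h2, mul_sum]
      refine (norm_sum_le _ _).trans (sum_le_sum fun k hk => ?_)
      rw [norm_mul, norm_real, Real.norm_eq_abs, abs_of_nonneg (hc k hk), mul_comm]
      exact mul_le_mul_of_nonneg_right (hone k hk) (hc k hk)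
    have h4 : ‖((∑ k ∈ S, c k : ℝ) : ℂ)‖ = ∑ k ∈ S, c k := by
      rw [norm_real, Real.norm_eq_abs, abs_of_nonneg hc0]
    have h5 := norm_sub_le (T + (∑ k ∈ S, c k : ℝ)) T
    rw [add_sub_cancel_left, h4] at h5
    linarith
  have h2 : ‖T‖ ^ 2 ≤ (∑ n ∈ I, ψ n ^ 2 * (J n / n)) * Q := by
    calc ‖T‖ ^ 2 ≤ (∑ n ∈ I, |ψ n| * |θ n| * (‖g n‖ * J n)) ^ 2 := by
          gcongr
          refine (norm_sum_le _ _).trans_eq (sum_congr rfl fun n hn => ?_)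
          rw [norm_mul, norm_mul, norm_mul, norm_real, norm_real, norm_real, Real.norm_eq_abs,
            Real.norm_eq_abs, Real.norm_eq_abs, abs_of_nonneg (hJ n hn)]
      _ ≤ _ := by
          refine sum_sq_le_sum_mul_sum_of_sq_le_mul I (fun n hn => ?_) (fun n hn => ?_)
            fun n hn => ?_
          · have := hJ n hn
            positivity
          · have := hJ n hn
            positivity
          · have hn0 : (n : ℝ) ≠ 0 := by exact_mod_cast (hI n hn).ne'
            rw [mul_pow, mul_pow, sq_abs, sq_abs]
            refine le_of_eq ?_
            field_simp
  have hQ1 : Q ≤ ∑ k ∈ S, c k ^ 2 * B k + η₂ * (∑ k ∈ S, c k) ^ 2 := by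
    have h3 : (Q : ℂ) = ∑ j ∈ S, ∑ k ∈ S, ((c j * c k : ℝ) : ℂ) *
        ∑ n ∈ I, (θ n : ℂ) * θ n * (n * (f j n * (starRingEnd ℂ) (f k n)) * J n) := by
      have h4 : ∀ n, ((‖g n‖ ^ 2 : ℝ) : ℂ) = ∑ j ∈ S, ∑ k ∈ S, ((c j * c k : ℝ) : ℂ) *
          (f j n * (starRingEnd ℂ) (f k n)) := by
        intro n
        rw [ofReal_pow, ← mul_conj', hg, map_sum, sum_mul_sum]
        refine sum_congr rfl fun j _ => sum_congr rfl fun k _ => ?_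
        rw [map_mul, conj_ofReal]
        push_cast
        ring
      rw [hQ, ofReal_sum]
      simp_rw [ofReal_mul, h4, mul_sum, sum_mul, mul_sum]
      rw [sum_comm]
      refine sum_congr rfl fun j _ => ?_
      rw [sum_comm]
      refine sum_congr rfl fun k _ => sum_congr rfl fun n _ => ?_
      push_cast
      ring
    have h5 := congrArg re h3
    rw [ofReal_re, re_sum] at h5
    rw [h5]
    have h6 : ∀ j ∈ S, ∀ k ∈ S, (((c j * c k : ℝ) : ℂ) *
        ∑ n ∈ I, (θ n : ℂ) * θ n * (n * (f j n * (starRingEnd ℂ) (f k n)) * J n)).re ≤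
        (if k = j then c j ^ 2 * B j else 0) + c j * c k * η₂ := by
      intro j hj k hk
      have hjk : 0 ≤ c j * c k := mul_nonneg (hc j hj) (hc k hk)
      rw [re_ofReal_mul]
      split_ifs with h
      · subst h
        have h7 : ∑ n ∈ I, (θ n : ℂ) * θ n * (n * (f k n * (starRingEnd ℂ) (f k n)) * J n) =
            ((∑ n ∈ I, θ n ^ 2 * (n * ‖f k n‖ ^ 2 * J n) : ℝ) : ℂ) := by
          rw [ofReal_sum]
          refine sum_congr rfl fun n _ => ?_
          rw [mul_conj']
          push_cast
          ring
        rw [h7, ofReal_re, ← sq]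
        have h8 := mul_le_mul_of_nonneg_left (hdiag k hk) (sq_nonneg (c k))
        have h9 := mul_nonneg (sq_nonneg (c k)) hη₂
        linarith
      · rw [zero_add]
        exact mul_le_mul_of_nonneg_left ((re_le_norm _).trans (hoff j hj k hk (Ne.symm h))) hjk
    calc _ ≤ ∑ j ∈ S, ∑ k ∈ S, ((if k = j then c j ^ 2 * B j else 0) + c j * c k * η₂) := by
          refine sum_le_sum fun j hj => ?_
          rw [re_sum]
          exact sum_le_sum fun k hk => h6 j hj k hk
      _ = _ := by
          simp_rw [sum_add_distrib, sum_ite_eq', ← sum_mul, ← mul_sum, ← sum_mul]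
          rw [sum_congr rfl fun j hj => if_pos hj]
          ring
  have hQ0 : 0 ≤ Q := sum_nonneg fun n hn => by
    have := hJ n hn
    positivity
  calc _ ≤ ‖T‖ ^ 2 := pow_le_pow_left₀ (mul_nonneg (by linarith) hc0) h1 2
    _ ≤ _ := h2
    _ ≤ A * Q := mul_le_mul_of_nonneg_right hA hQ0
    _ ≤ _ := by
        refine mul_le_mul_of_nonneg_left hQ1 (le_trans (sum_nonneg fun n hn => ?_) hA)
        have := hJ n hn
        positivity
end Duality

/-! ### The inequality for the zeros -/

section Main
open Complex Filter Topology

lemma natCast_mul_twist_mul_conj {q : ℕ} (χ χ' : DirichletCharacter ℂ q) (ρ ρ' : ℂ) {n : ℕ}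
    (hn : n ≠ 0) :
    (n : ℂ) * ((χ n * (n : ℂ) ^ (-ρ)) * (starRingEnd ℂ) (χ' n * (n : ℂ) ^ (-ρ'))) =
      (χ * χ'⁻¹) n * (n : ℂ) ^ (-(ρ + (starRingEnd ℂ) ρ' - 1)) := by
  have hn0 : (n : ℂ) ≠ 0 := by exact_mod_cast hn
  have h1 : (starRingEnd ℂ) (χ' n) = χ'⁻¹ n := MulChar.star_apply' χ' n
  have h2 : (starRingEnd ℂ) ((n : ℂ) ^ (-ρ')) = (n : ℂ) ^ (-(starRingEnd ℂ) ρ') := by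
    rw [← map_neg, cpow_conj _ _ (by rw [natCast_arg]; exact Real.pi_pos.ne), conj_natCast]
  have h3 : (n : ℂ) ^ (-(ρ + (starRingEnd ℂ) ρ' - 1)) =
      (n : ℂ) * ((n : ℂ) ^ (-ρ) * (n : ℂ) ^ (-(starRingEnd ℂ) ρ')) := by
    rw [show -(ρ + (starRingEnd ℂ) ρ' - 1) = 1 + (-ρ + -(starRingEnd ℂ) ρ') by ring,
      cpow_add _ _ hn0, cpow_add _ _ hn0, cpow_one]
  rw [map_mul, h1, h2, h3, MulChar.mul_apply]
  ring

/-- The inequality for the weighted sum over the zeros, before the auxiliary parameter `η` tends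
to `0`. -/
theorem GLH.eventually_sq_sum_le (hGLH : GLH) {a b η : ℝ} (ha : 0 < a) (hb : 0 < b) (hη : 0 < η)
    (hη1 : η ≤ 1) (hηa : η < a / 2) :
    ∀ᶠ q : ℕ in atTop, ∀ [NeZero q] (lam : ℝ), lam ≤ Real.log (Real.log q) →
      ∀ ρ : DirichletCharacter ℂ q → ℂ,
        (∀ χ ∈ charsWithZero q lam, IsLZeroNearOne lam χ (ρ χ)) →
        ((1 - η) * ∑ χ ∈ charsWithZero q lam, zeroDepth q (ρ χ) /
          (Real.exp ((3 * a + 2 * b) * zeroDepth q (ρ χ)) - Real.exp (2 * a * zeroDepth q (ρ χ)))) ^ 2 ≤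
        ((a + b) / (2 * b) + η) * ((1 / (a - 2 * η) + η) *
          (∑ χ ∈ charsWithZero q lam, zeroDepth q (ρ χ) /
          (Real.exp ((3 * a + 2 * b) * zeroDepth q (ρ χ)) - Real.exp (2 * a * zeroDepth q (ρ χ)))) +
          η * (∑ χ ∈ charsWithZero q lam, zeroDepth q (ρ χ) /
          (Real.exp ((3 * a + 2 * b) * zeroDepth q (ρ χ)) -
            Real.exp (2 * a * zeroDepth q (ρ χ)))) ^ 2) := by
  classical
  -- the sieve level is `q ^ r`; `x` is chosen so that `q ^ x` exceeds `q ^ (a + b) * q ^ r`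
  set r : ℝ := a / 2 - η with hr
  have hr0 : 0 < r := by rw [hr]; linarith
  have hra : r < a / 2 := by rw [hr]; linarith
  set x : ℝ := a + b + a / 2 with hx
  have hax : a < x := by rw [hx]; linarith
  obtain ⟨P, hP1, hP0, hPb, hA⟩ := exists_cutoff_sum_barbanVehov_sq_le ha hb
    (by rw [hx]; linarith : a + b ≤ x) hη
  have hAx : (x - a - b / 2) / b = (a + b) / (2 * b) := by
    rw [hx]; field_simp; ring
  rw [hAx] at hA
  filter_upwards [hGLH.eventually_norm_mollifiedSum_add_one_le ha hb hra hx hη hP1 hP0 hPb,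
    hGLH.eventually_norm_offDiagonal_le hr0 hra hax.le hη,
    eventually_diagonal_le hr0 hra hax hη, tendsto_log_natCast_atTop.eventually hA,
    eventually_ne_one_of_isLZeroNearOne,
    tendsto_log_natCast_atTop.eventually_gt_atTop 0] with q hone hoff hdiag hA hprinc hL _ lam hlam ρ hρ
  set L := Real.log q with hLdef
  set S := charsWithZero q lam with hS
  have hq0 : q ≠ 0 := NeZero.ne q
  obtain ⟨w, hw1, hwb, hws, hwT⟩ := exists_selberg_weights hq0 (R := Real.exp (r * L))
    (Real.one_lt_exp_iff.mpr (by positivity))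
  set v : DirichletCharacter ℂ q → ℝ := fun χ => zeroDepth q (ρ χ) with hv
  have hv0 : ∀ χ ∈ S, 0 < v χ := fun χ hχ =>
    mul_pos (by linarith [(hρ χ hχ).1.re_lt_one]) hL
  have hvl : ∀ χ ∈ S, v χ ≤ Real.log L := by
    intro χ hχ
    refine le_trans ?_ hlam
    have h1 : 1 - (ρ χ).re ≤ lam / L := by linarith [(hρ χ hχ).2.1]
    rwa [le_div_iff₀ hL] at h1
  have hpos : ∀ χ ∈ S, 0 < Real.exp ((3 * a + 2 * b) * v χ) - Real.exp (2 * a * v χ) := by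
    intro χ hχ
    rw [sub_pos, Real.exp_lt_exp]
    have := hv0 χ hχ
    nlinarith
  set c : DirichletCharacter ℂ q → ℝ := fun χ =>
    v χ / (Real.exp ((3 * a + 2 * b) * v χ) - Real.exp (2 * a * v χ)) with hc
  have hU0 : 0 < Real.exp (a * L) := Real.exp_pos _
  have hUX : Real.exp (a * L) ≤ Real.exp (x * L) := Real.exp_le_exp.mpr (by gcongr)
  have key := sq_sum_le_of_nearly_orthogonal (S := S) (I := Icc 1 ⌊Real.exp (x * L)⌋₊) (c := c)
    (B := fun χ => (1 / (2 * r) + η) * (c χ)⁻¹)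
    (f := fun χ n => χ n * (n : ℂ) ^ (-ρ χ)) (ψ := barbanVehov P L)
    (θ := fun n => ∑ e ∈ n.divisors, w e)
    (J := fun n => trapezoid (Real.exp (a * L)) (Real.exp (x * L)) n)
    (A := (a + b) / (2 * b) + η) (η₁ := η) (η₂ := η)
    (fun n hn => (mem_Icc.mp hn).1) (fun χ hχ => div_nonneg (hv0 χ hχ).le (hpos χ hχ).le)
    (fun n _ => trapezoid_nonneg hU0 hUX (Nat.cast_nonneg n)) hη1 hη.le hA
    (fun χ hχ => hone χ (ρ χ) w (hprinc lam hlam χ _ (hρ χ hχ)) (hρ χ hχ).1.2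
      (hρ χ hχ).1.re_lt_one.le (hρ χ hχ).2.2 (hvl χ hχ) hw1 hwb fun d hd => (hws d hd).1) ?_ ?_
  · have hsum : ∑ χ ∈ S, c χ ^ 2 * ((1 / (2 * r) + η) * (c χ)⁻¹) =
        (1 / (a - 2 * η) + η) * ∑ χ ∈ S, c χ := by
      rw [mul_sum]
      refine sum_congr rfl fun χ hχ => ?_
      have hc0 : c χ ≠ 0 := (div_pos (hv0 χ hχ) (hpos χ hχ)).ne'
      have h2r : 2 * r = a - 2 * η := by rw [hr]; ring
      rw [h2r, sq]
      field_simp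
    rw [hsum] at key
    exact key
  · intro χ hχ χ' hχ' hne
    have hs := hoff (χ * χ'⁻¹) (ρ χ + (starRingEnd ℂ) (ρ χ') - 1) w
      (by rwa [Ne, mul_inv_eq_one])
      (by
        have h1 := (hρ χ hχ).1.re_lt_one
        have h2 := (hρ χ' hχ').1.re_lt_one
        simp only [sub_re, add_re, conj_re, one_re]; linarith)
      (by
        have h1 := abs_le.mp (hρ χ hχ).2.2
        have h2 := abs_le.mp (hρ χ' hχ').2.2
        simp only [sub_im, add_im, conj_im, one_im]
        rw [abs_le]
        constructor <;> linarith [h1.1, h1.2, h2.1, h2.2])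
      (by
        have h1 : (1 - (ρ χ).re) * L ≤ Real.log L := hvl χ hχ
        have h2 : (1 - (ρ χ').re) * L ≤ Real.log L := hvl χ' hχ'
        simp only [sub_re, add_re, conj_re, one_re]; linarith)
      hwb fun d hd => (hws d hd).1
    refine le_of_eq_of_le ?_ hs
    congr 1
    refine sum_congr rfl fun n hn => ?_
    rw [natCast_mul_twist_mul_conj χ χ' _ _ (by have := (mem_Icc.mp hn).1; omega)]
  · intro χ hχ
    have hd := hdiag (v χ) w (hv0 χ hχ) (hvl χ hχ) hwb hws hwT
    have hcinv : (c χ)⁻¹ = (Real.exp (2 * x * v χ) - Real.exp (2 * a * v χ)) / v χ := by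
      rw [hc]
      simp only
      rw [inv_div, hx]
      ring_nf
    rw [hcinv]
    refine le_of_eq_of_le ?_ hd
    rw [sum_filter]
    refine sum_congr rfl fun n hn => ?_
    have hn1 : 0 < n := (mem_Icc.mp hn).1
    have hn0 : (0 : ℝ) < n := by exact_mod_cast hn1
    rw [norm_mul, norm_natCast_cpow_of_pos hn1, neg_re]
    by_cases hcop : n.Coprime q
    · rw [if_pos hcop, ← ZMod.coe_unitOfCoprime n hcop, χ.unit_norm_eq_one, one_mul]
      have h1 : 2 * v χ / L - 1 = 1 + (-(ρ χ).re + -(ρ χ).re) := by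
        have : v χ = (1 - (ρ χ).re) * L := rfl
        rw [this]; field_simp; ring
      rw [h1, Real.rpow_add hn0, Real.rpow_add hn0, Real.rpow_one]
      ring
    · have hnu : ¬ IsUnit ((n : ℕ) : ZMod q) := by rwa [ZMod.isUnit_iff_coprime]
      rw [if_neg hcop, χ.map_nonunit hnu]
      simp

/-- The bound obtained with the parameter `η` tends to `A / a`. -/
lemma exists_parameter {a A δ : ℝ} (ha : 0 < a) (hδ : 0 < δ) :
    ∃ η : ℝ, 0 < η ∧ η ≤ 1 ∧ η < a / 2 ∧ 0 < (1 - η) ^ 2 - (A + η) * η ∧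
      (A + η) * (1 / (a - 2 * η) + η) ≤ (A / a + δ) * ((1 - η) ^ 2 - (A + η) * η) := by
  have h1 : Tendsto (fun η : ℝ => (1 - η) ^ 2 - (A + η) * η) (𝓝[>] 0) (𝓝 1) := by
    have : Continuous fun η : ℝ => (1 - η) ^ 2 - (A + η) * η := by fun_prop
    simpa using (this.tendsto 0).mono_left nhdsWithin_le_nhds
  have h2 : Tendsto (fun η : ℝ => (A + η) * (1 / (a - 2 * η) + η)) (𝓝[>] 0) (𝓝 (A / a)) := by
    have : ContinuousAt (fun η : ℝ => (A + η) * (1 / (a - 2 * η) + η)) 0 := by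
      have : a - 2 * 0 ≠ 0 := by simpa using ha.ne'
      fun_prop (disch := assumption)
    have h := this.tendsto.mono_left (nhdsWithin_le_nhds (s := Set.Ioi 0))
    simpa [div_eq_mul_inv] using h
  have h3 := (h1.const_mul (A / a + δ)).sub h2
  have h4 := h3.eventually_const_lt (u := 0) (by simpa using hδ)
  have hlt : ∀ c : ℝ, 0 < c → ∀ᶠ η : ℝ in 𝓝[>] 0, η < c := fun c hc =>
    (eventually_lt_nhds hc).filter_mono nhdsWithin_le_nhds
  obtain ⟨η, hη0, hη1, hηa, h5, h6⟩ := (eventually_mem_nhdsWithin.and ((hlt 1 one_pos).and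
    ((hlt (a / 2) (half_pos ha)).and ((h1.eventually_const_lt one_pos).and h4)))).exists
  exact ⟨η, hη0, hη1.le, hηa, h5, by linarith⟩

/-- The quadratic inequality for `σ` is divided by `σ`, and `η` is taken small. -/
theorem GLH.exists_sum_zeroDepth_div_le (hGLH : GLH) {δ a b : ℝ} (hδ : 0 < δ) (ha : 0 < a)
    (hb : 0 < b) :
    ∃ q₃ : ℕ, ∀ (q : ℕ) [NeZero q], 3 ≤ q → q₃ ≤ q → ∀ lam : ℝ, lam ≤ Real.log (Real.log q) →
      ∀ ρ : DirichletCharacter ℂ q → ℂ,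
        (∀ χ ∈ charsWithZero q lam, IsLZeroNearOne lam χ (ρ χ)) →
          ∑ χ ∈ charsWithZero q lam, zeroDepth q (ρ χ) /
            (Real.exp ((3 * a + 2 * b) * zeroDepth q (ρ χ)) - Real.exp (2 * a * zeroDepth q (ρ χ)))
            ≤ (a + b) / (2 * a * b) + δ := by
  obtain ⟨η, hη0, hη1, hηa, hden, hpar⟩ := exists_parameter (A := (a + b) / (2 * b)) ha hδ
  obtain ⟨q₃, hq₃⟩ := eventually_atTop.mp (hGLH.eventually_sq_sum_le ha hb hη0 hη1 hηa)
  refine ⟨q₃, fun q _ _ hq lam hlam ρ hρ => ?_⟩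
  have h1 := hq₃ q hq lam hlam ρ hρ
  set σ := ∑ χ ∈ charsWithZero q lam, zeroDepth q (ρ χ) /
    (Real.exp ((3 * a + 2 * b) * zeroDepth q (ρ χ)) - Real.exp (2 * a * zeroDepth q (ρ χ))) with hσ
  rw [show (a + b) / (2 * a * b) = (a + b) / (2 * b) / a by field_simp]
  by_contra hlt
  rw [not_le] at hlt
  have hσ0 : 0 < σ := lt_of_le_of_lt (by positivity) hlt
  have h2 : σ * (σ * ((1 - η) ^ 2 - ((a + b) / (2 * b) + η) * η)) ≤
      σ * (((a + b) / (2 * b) + η) * (1 / (a - 2 * η) + η)) := by linarith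
  have h3 := le_of_mul_le_mul_left h2 hσ0
  have h4 := mul_lt_mul_of_pos_right hlt hden
  linarith

/-- The function `exp` is convex, so the difference quotient over `[s v, p v]` is at most `exp (p v)`. -/
lemma exp_neg_le_mul_div {p s v : ℝ} (hps : s < p) (hv : 0 < v) :
    Real.exp (-p * v) ≤ (p - s) * (v / (Real.exp (p * v) - Real.exp (s * v))) := by
  have h0 : 0 < Real.exp (p * v) - Real.exp (s * v) := by
    rw [sub_pos, Real.exp_lt_exp]; gcongr
  have h1 := Real.add_one_le_exp (-((p - s) * v))
  have h2 : Real.exp (-p * v) * Real.exp (p * v) = 1 := by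
    rw [← Real.exp_add]; simp
  have h3 : Real.exp (-p * v) * Real.exp (s * v) = Real.exp (-((p - s) * v)) := by
    rw [← Real.exp_add]; ring_nf
  rw [← mul_div_assoc, le_div_iff₀ h0, mul_sub, h2, h3]
  linarith
end Main

theorem mainTheorem5 (hGLH : GLH) :
    (∀ δ a b : ℝ, 0 < δ → 0 < a → 0 < b →
      ∃ q₃ : ℕ, ∀ (q : ℕ) [NeZero q], 3 ≤ q → q₃ ≤ q →
        ∀ lam : ℝ, lam ≤ Real.log (Real.log q) →
          ∀ ρ : DirichletCharacter ℂ q → ℂ,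
            (∀ χ ∈ charsWithZero q lam, IsLZeroNearOne lam χ (ρ χ)) →
              ∑ χ ∈ charsWithZero q lam,
                zeroDepth q (ρ χ) /
                  (Real.exp ((3 * a + 2 * b) * zeroDepth q (ρ χ)) -
                    Real.exp (2 * a * zeroDepth q (ρ χ)))
                ≤ (a + b) / (2 * a * b) + δ) ∧
    (∃ q₀ : ℕ, ∀ (q : ℕ) [NeZero q], 3 ≤ q → q₀ ≤ q →
      ∀ lam : ℝ, lam ≤ Real.log (Real.log q) →
        ∀ ρ : DirichletCharacter ℂ q → ℂ,
          (∀ χ ∈ charsWithZero q lam, IsLZeroNearOne lam χ (ρ χ)) →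
            ∑ χ ∈ charsWithZero q lam, Real.exp (-0.1 * zeroDepth q (ρ χ)) ≤ 3) := by
  refine ⟨fun δ a b hδ ha hb => hGLH.exists_sum_zeroDepth_div_le hδ ha hb, ?_⟩
  -- `3 * a + 2 * b = 0.1`, and `(a + 2 * b) * (a + b) / (2 * a * b) = 2.914…` is near its minimum
  obtain ⟨q₀, hq₀⟩ := hGLH.exists_sum_zeroDepth_div_le (δ := 1) (a := 7 / 310) (b := 1 / 62)
    one_pos (by norm_num) (by norm_num)
  refine ⟨q₀, fun q _ hq3 hq lam hlam ρ hρ => ?_⟩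
  have hL : 0 < Real.log q := Real.log_pos (by exact_mod_cast (by omega : 1 < q))
  calc ∑ χ ∈ charsWithZero q lam, Real.exp (-0.1 * zeroDepth q (ρ χ))
      ≤ ∑ χ ∈ charsWithZero q lam, (17 / 310) * (zeroDepth q (ρ χ) /
        (Real.exp ((3 * (7 / 310) + 2 * (1 / 62)) * zeroDepth q (ρ χ)) -
          Real.exp (2 * (7 / 310) * zeroDepth q (ρ χ)))) := by
        refine sum_le_sum fun χ hχ => ?_
        have hv : 0 < zeroDepth q (ρ χ) := mul_pos (by linarith [(hρ χ hχ).1.re_lt_one]) hL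
        have h := exp_neg_le_mul_div (p := 3 * (7 / 310) + 2 * (1 / 62)) (s := 2 * (7 / 310))
          (by norm_num) hv
        norm_num at h ⊢
        exact h
    _ ≤ 17 / 310 * ((7 / 310 + 1 / 62) / (2 * (7 / 310) * (1 / 62)) + 1) := by
        rw [← mul_sum]
        exact mul_le_mul_of_nonneg_left (hq₀ q hq3 hq lam hlam ρ hρ) (by norm_num)
    _ ≤ 3 := by norm_num
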